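/- Let $\kappa,\sigma,\Lambda\in\mathbb R$ with $0<\kappa<\sigma/6$. Then there are functions $C_1:\mathbb R\to(0,\infty)$ and $C_2:\mathbb R^2\to(0,\infty)$, depending only on $\kappa,\sigma,\Lambda$, with the following property. Let $\lambda\in\mathbb R$ with $|\lambda|=\Lambda$, let $\omega_1,\omega_2,\omega_3\in\mathbb R$, let $$V(x)=\tfrac12\sum_{j=1}^3\omega_j^2x_j^2,\qquad \Sigma=\{f\in H^1(\mathbb R^3): xf\in L^2(\mathbb R^3)\},\qquad \|f\|_\Sigma=\|f\|_{L^2}+\|\nabla f\|_{L^2}+\|xf\|_{L^2},$$ let $0<T\le\infty$, and let $u\in C([0,T),\Sigma)$ with $u(0)=u_0$ be a solution of $$i\partial_t u+\tfrac12\Delta u=V(x)u+\lambda|u|^2u-i\sigma|u|^4u\qquad\text{on }(0,T)\times\mathbb R^3,$$ in the sense that for every $\varphi\in C_c^\infty(\mathbb R^3;\mathbb C)$ and every $t\in(0,T)$ the function $s\mapsto\int_{\mathbb R^3} u(s)\varphi\,dx$ is differentiable at $t$ with $$i\frac{d}{dt}\int_{\mathbb R^3} u\varphi\,dx=\int_{\mathbb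 R^3}\Big(-\tfrac12u\,\Delta\varphi+\big(Vu+\lambda|u|^2u-i\sigma|u|^4u\big)\varphi\Big)\,dx .$$ For $t\in[0,T)$ put $$E_\kappa(t)=\int_{\mathbb R^3}\Big(\tfrac12|\nabla u(t,x)|^2+V(x)|u(t,x)|^2+\tfrac\lambda2|u(t,x)|^4+\kappa|u(t,x)|^6\Big)\,dx .$$ Then for every $t\in[0,T)$ the integrand of $E_\kappa(t)$ is integrable and $$E_\kappa(t)\le E_\kappa(0)+C_1(\|u_0\|_{L^2}),$$ and moreover $$\int_0^T\!\!\int_{\mathbb R^3}|u|^4|\nabla u|^2\,dx\,dt\le C_2\big(E_\kappa(0),\|u_0\|_{L^2}\big),\qquad \int_0^T\!\!\int_{\mathbb R^3}V|u|^6\,dx\,dt\le C_2\big(E_\kappa(0),\|u_0\|_{L^2}\big),$$ $$\int_0^T\!\!\int_{\mathbb R^3}|u|^{10}\,dx\,dt\le C_2\big(E_\kappa(0),\|u_0\|_{L^2}\big).$$ In particular, for a global solution ($T=\infty$) these bounds hold for all $t\ge0$ and on $[0,\infty)\times\mathbb R^3$. -/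

import Mathlib

open MeasureTheory Filter Topology
open scoped ContDiff Laplacian

noncomputable section

namespace DampedNLS

/-- Physical space `ℝ³` with the Euclidean norm. -/
abbrev R3 : Type := EuclideanSpace ℝ (Fin 3)

/-- Smooth compactly supported complex-valued functions on `ℝ³`. -/
def IsTest (φ : R3 → ℂ) : Prop := ContDiff ℝ ∞ φ ∧ HasCompactSupport φ

/-- The anisotropic quadratic confinement `V(x) = ½ ∑ⱼ wⱼ² xⱼ²`. -/
def confinement (w : Fin 3 → ℝ) (x : R3) : ℝ := (1 / 2) * ∑ j, w j ^ 2 * x j ^ 2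

/-- `g` is a weak (distributional) gradient of `f`; both are locally integrable. -/
def IsWeakGradient (f : R3 → ℂ) (g : R3 → EuclideanSpace ℂ (Fin 3)) : Prop :=
  LocallyIntegrable f ∧ LocallyIntegrable g ∧
    ∀ φ : R3 → ℂ, IsTest φ → ∀ j : Fin 3,
      ∫ x, f x * fderiv ℝ φ x (EuclideanSpace.single j 1) = -∫ x, g x j * φ x

open Classical in
/-- The weak gradient of `f`, well defined up to null sets; only its a.e. class matters below.
It is set to `0` if `f` has no weak gradient. -/
def weakGradient (f : R3 → ℂ) : R3 → EuclideanSpace ℂ (Fin 3) :=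
  if h : ∃ g, IsWeakGradient f g then h.choose else 0

/-- The energy space `Σ = {f ∈ H¹(ℝ³) : x f ∈ L²(ℝ³)}`. -/
structure MemSigma (f : R3 → ℂ) : Prop where
  memLp : MemLp f 2 volume
  weakGradient : ∃ g, IsWeakGradient f g ∧ MemLp g 2 volume
  moment : MemLp (fun x => ‖x‖ • f x) 2 volume

/-- `‖f‖_Σ = ‖f‖_{L²} + ‖∇f‖_{L²} + ‖x f‖_{L²}`. -/
def sigmaNorm (f : R3 → ℂ) : ENNReal :=
  eLpNorm f 2 volume + eLpNorm (weakGradient f) 2 volume +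
    eLpNorm (fun x => ‖x‖ • f x) 2 volume

/-- The time interval `[0, T)`, where `T = ∞` is allowed. -/
def timeInterval (T : EReal) : Set ℝ := {t | 0 ≤ t ∧ (t : EReal) < T}

/-- `u ∈ C([0, T), Σ)`. -/
structure ContinuousInSigma (T : EReal) (u : ℝ → R3 → ℂ) : Prop where
  mem : ∀ t ∈ timeInterval T, MemSigma (u t)
  cont : ∀ t₀ ∈ timeInterval T,
    Tendsto (fun t => sigmaNorm (u t - u t₀)) (𝓝[timeInterval T] t₀) (𝓝 0)

/-- `V u + λ |u|² u - i σ |u|⁴ u`, as a function of `x`, for a given function `f = u(t, ·)`. -/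
def lowerOrder (w : Fin 3 → ℝ) (lam σ : ℝ) (f : R3 → ℂ) (x : R3) : ℂ :=
  (confinement w x : ℂ) * f x + (lam : ℂ) * (‖f x‖ : ℂ) ^ 2 * f x
    - Complex.I * (σ : ℂ) * (‖f x‖ : ℂ) ^ 4 * f x

/-- `u ∈ C([0, T), Σ)` solves
`i ∂ₜ u + ½ Δ u = V u + λ |u|² u - i σ |u|⁴ u` on `(0, T) × ℝ³`: at every time `t ∈ (0, T)`
the equation holds in the sense of distributions on `ℝ³`.
(All the integrands are integrable, as `Σ ⊆ L² ∩ L⁶`.) -/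
structure IsSolution (w : Fin 3 → ℝ) (lam σ : ℝ) (T : EReal) (u : ℝ → R3 → ℂ) : Prop where
  continuousInSigma : ContinuousInSigma T u
  equation : ∀ φ : R3 → ℂ, IsTest φ → ∀ t : ℝ, 0 < t → (t : EReal) < T →
    HasDerivAt (fun s => Complex.I * ∫ x, u s x * φ x)
      (∫ x, (-(1 / 2) * (u t x * (Δ φ) x) + lowerOrder w lam σ (u t) x * φ x)) t

/-- `½ |∇f|² + V |f|² + (λ/2) |f|⁴ + κ |f|⁶`. -/
def energyDensity (w : Fin 3 → ℝ) (lam κ : ℝ) (f : R3 → ℂ) (x : R3) : ℝ :=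
  (1 / 2) * ‖weakGradient f x‖ ^ 2 + confinement w x * ‖f x‖ ^ 2
    + (lam / 2) * ‖f x‖ ^ 4 + κ * ‖f x‖ ^ 6

/-- The modified energy `E_κ` of `f = u(t, ·)`. -/
def energy (w : Fin 3 → ℝ) (lam κ : ℝ) (f : R3 → ℂ) : ℝ :=
  ∫ x, energyDensity w lam κ f x

/-- `‖f‖_{L²}` as a real number. -/
def l2norm (f : R3 → ℂ) : ℝ := (eLpNorm f 2 volume).toReal

end DampedNLS

end

noncomputable section

/-! ### Weak gradients and the algebra of the space Σ -/

namespace DampedNLS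

/-! Formally the theorem is one differentiation of the energy. Write s = |u|² and r_j, m_j for the
real and imaginary parts of ū ∂_j u. The kinetic energy loses σ∫s²|∇u|² (and a further nonnegative
term 4σ∫s ∑ r_j², which is dropped), it produces the cross term -2λ∫∑ r_j m_j, and it produces a
flux of V. The potential energy cancels the flux and loses 2σ∫V s³. The quartic energy cancels the
cross term and contributes -2σλ∫s⁴. The sextic energy loses 6σκ∫s⁵ and produces 12κ∫s ∑ r_j m_j ≤
6κ∫s²|∇u|², which is absorbed because 6κ < σ. The remaining term in s⁴ is split by Young's
inequality between s⁵ and s³, and the space-time integral of s³ is paid for by the mass, whose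
derivative is -2σ∫s³. Finally λ/2 s² + κ s³ ≥ -λ²/(16κ) s bounds the energy from below, so that the
total dissipation is finite.

The difficulty is regularity: u is only continuous with values in Σ, the equation holds when tested,
and none of these functionals can be differentiated directly. The replacement is
`IsSolution.hasDerivAt_functional`: a functional whose L² gradient lies in Σ and whose Taylor
remainder is quadratic in L² is differentiable along the flow. It rests on
`IsSolution.sq_norm_sub_isLittleO`, that is ‖u(s) - u(t)‖² = o(s - t) in L².

This principle is applied to approximations of each part of the energy. The kinetic energy is
replaced by that of difference quotients D with step h. After adding a multiple C|D|², with C =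
9λ²/(4σ), the dissipation of difference quotients is pointwise nonnegative (`dissipation_nonneg`,
`im_diffQuot_lowerOrder_le`), so Fatou's lemma gives an inequality in the limit h → 0
(`IsSolution.exists_lintegral_dissipation_le`); the added term returns with the opposite sign inside
`flux`. The confinement is replaced by V/(1 + εV), and λ/2 s² + κ s³ by a function of s with
Lipschitz gradient on ℂ. The latter is chosen so that its cross term is exactly d³ times the formal
one, d = 1/(1 + εs); hence it cancels against the kinetic dissipation multiplied by d³. This is
`totalDissipation_le`; integrated in time it is `IsSolution.regEnergy_le`, and ε → 0 gives
`IsSolution.energy_bounds`. -/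

theorem locallyIntegrable_component {g : R3 → EuclideanSpace ℂ (Fin 3)}
    (hg : LocallyIntegrable g) (j : Fin 3) : LocallyIntegrable (fun x => g x j) := fun x => by
  obtain ⟨s, hs, hi⟩ := hg x
  exact ⟨s, hs, (EuclideanSpace.proj j : EuclideanSpace ℂ (Fin 3) →L[ℂ] ℂ).integrable_comp hi⟩

theorem MemLp.component {g : R3 → EuclideanSpace ℂ (Fin 3)} {p : ENNReal}
    (hg : MemLp g p volume) (j : Fin 3) : MemLp (fun x => g x j) p volume :=
  (EuclideanSpace.proj j : EuclideanSpace ℂ (Fin 3) →L[ℂ] ℂ).comp_memLp' hg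

theorem integrable_mul_of_hasCompactSupport {f φ : R3 → ℂ} (hf : LocallyIntegrable f)
    (hφ : Continuous φ) (hc : HasCompactSupport φ) : Integrable (fun x => f x * φ x) := by
  simpa [mul_comm] using hf.integrable_smul_left_of_hasCompactSupport hφ hc

namespace IsTest

variable {φ : R3 → ℂ}

theorem continuous (h : IsTest φ) : Continuous φ := h.1.continuous

theorem fderiv_apply (h : IsTest φ) (v : R3) : IsTest (fun x => fderiv ℝ φ x v) := by
  refine ⟨(h.1.fderiv_right (m := ∞) (by simp)).clm_apply contDiff_const, ?_⟩
  exact h.2.fderiv_apply (𝕜 := ℝ) v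

theorem comp_add (h : IsTest φ) (a : R3) : IsTest (fun x => φ (x + a)) :=
  ⟨h.1.comp (contDiff_id.add contDiff_const), h.2.comp_homeomorph (Homeomorph.addRight a)⟩

theorem conj (h : IsTest φ) : IsTest (fun x => (starRingEnd ℂ) (φ x)) :=
  ⟨Complex.conjCLE.contDiff.comp h.1, h.2.comp_left (map_zero _)⟩

theorem mul_left (h : IsTest φ) {η : R3 → ℂ} (hη : ContDiff ℝ ∞ η) :
    IsTest (fun x => η x * φ x) := ⟨hη.mul h.1, h.2.mul_left⟩

theorem ofReal {ψ : R3 → ℝ} (h : ContDiff ℝ ∞ ψ) (hc : HasCompactSupport ψ) :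
    IsTest (fun x => (ψ x : ℂ)) :=
  ⟨Complex.ofRealCLM.contDiff.comp h, hc.comp_left (g := fun r : ℝ => (r : ℂ)) rfl⟩

theorem memLp (h : IsTest φ) (p : ENNReal) : MemLp φ p volume :=
  h.continuous.memLp_of_hasCompactSupport h.2

end IsTest

/-- This is the fundamental lemma of the calculus of variations, applied to each component. It makes
the chosen `weakGradient` computable up to null sets. -/
theorem IsWeakGradient.ae_eq {f : R3 → ℂ} {g g' : R3 → EuclideanSpace ℂ (Fin 3)}
    (h : IsWeakGradient f g) (h' : IsWeakGradient f g') : g =ᵐ[volume] g' := by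
  have key : ∀ j : Fin 3, ∀ᵐ x, g x j = g' x j := fun j =>
    ae_eq_of_integral_contDiff_smul_eq (locallyIntegrable_component h.2.1 j)
      (locallyIntegrable_component h'.2.1 j) fun ψ hψ hc => by
        have e := h.2.2 _ (IsTest.ofReal hψ hc) j
        rw [h'.2.2 _ (IsTest.ofReal hψ hc) j] at e
        simpa [mul_comm] using e.symm
  filter_upwards [ae_all_iff.2 key] with x hx
  ext j
  exact hx j

theorem IsWeakGradient.weakGradient {f : R3 → ℂ} {g : R3 → EuclideanSpace ℂ (Fin 3)}
    (h : IsWeakGradient f g) : IsWeakGradient f (weakGradient f) := by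
  have : ∃ g, IsWeakGradient f g := ⟨g, h⟩
  rw [DampedNLS.weakGradient, dif_pos this]
  exact this.choose_spec

theorem IsWeakGradient.weakGradient_ae_eq {f : R3 → ℂ} {g : R3 → EuclideanSpace ℂ (Fin 3)}
    (h : IsWeakGradient f g) : DampedNLS.weakGradient f =ᵐ[volume] g :=
  h.weakGradient.ae_eq h

theorem IsWeakGradient.of_memLp {f : R3 → ℂ} {g : R3 → EuclideanSpace ℂ (Fin 3)}
    (hf : MemLp f 2 volume) (hg : MemLp g 2 volume)
    (h : ∀ φ : R3 → ℂ, IsTest φ → ∀ j : Fin 3,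
      ∫ x, f x * fderiv ℝ φ x (EuclideanSpace.single j 1) = -∫ x, g x j * φ x) :
    IsWeakGradient f g :=
  ⟨hf.locallyIntegrable (by norm_num), hg.locallyIntegrable (by norm_num), h⟩

namespace MemSigma

variable {f f' : R3 → ℂ}

theorem isWeakGradient (h : MemSigma f) : IsWeakGradient f (DampedNLS.weakGradient f) :=
  let ⟨_, hg, _⟩ := h.weakGradient
  hg.weakGradient

theorem memLp_weakGradient (h : MemSigma f) : MemLp (DampedNLS.weakGradient f) 2 volume :=
  let ⟨_, hg, hm⟩ := h.weakGradient
  (memLp_congr_ae hg.weakGradient_ae_eq).2 hm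

end MemSigma

/-- The integration by parts identity defining the weak gradient, for a `Σ` function. -/
theorem MemSigma.integral_mul_fderiv {f φ : R3 → ℂ} (h : MemSigma f) (hφ : IsTest φ) (j : Fin 3) :
    ∫ x, f x * fderiv ℝ φ x (EuclideanSpace.single j 1) =
      -∫ x, DampedNLS.weakGradient f x j * φ x := h.isWeakGradient.2.2 φ hφ j

section Operations

variable {f f' : R3 → ℂ} {g g' : R3 → EuclideanSpace ℂ (Fin 3)}

theorem IsWeakGradient.add (h : IsWeakGradient f g) (h' : IsWeakGradient f' g') :
    IsWeakGradient (f + f') (g + g') := by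
  refine ⟨h.1.add h'.1, h.2.1.add h'.2.1, fun φ hφ j => ?_⟩
  have hd := hφ.fderiv_apply (EuclideanSpace.single j 1)
  simp only [Pi.add_apply, PiLp.add_apply, add_mul]
  rw [integral_add (integrable_mul_of_hasCompactSupport h.1 hd.continuous hd.2)
      (integrable_mul_of_hasCompactSupport h'.1 hd.continuous hd.2),
    integral_add (integrable_mul_of_hasCompactSupport (locallyIntegrable_component h.2.1 j)
      hφ.continuous hφ.2) (integrable_mul_of_hasCompactSupport
      (locallyIntegrable_component h'.2.1 j) hφ.continuous hφ.2), h.2.2 φ hφ j, h'.2.2 φ hφ j]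
  ring

theorem IsWeakGradient.const_smul (h : IsWeakGradient f g) (c : ℂ) :
    IsWeakGradient (c • f) (c • g) := by
  refine ⟨h.1.smul c, h.2.1.smul c, fun φ hφ j => ?_⟩
  simp only [Pi.smul_apply, PiLp.smul_apply, smul_eq_mul, mul_assoc]
  rw [integral_const_mul, integral_const_mul, h.2.2 φ hφ j]
  ring

theorem IsWeakGradient.neg (h : IsWeakGradient f g) : IsWeakGradient (-f) (-g) := by
  simpa using h.const_smul (-1)

theorem IsWeakGradient.sub (h : IsWeakGradient f g) (h' : IsWeakGradient f' g') :
    IsWeakGradient (f - f') (g - g') := by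
  simpa [sub_eq_add_neg] using h.add h'.neg

/-- Componentwise complex conjugation. -/
def conjVec (v : EuclideanSpace ℂ (Fin 3)) : EuclideanSpace ℂ (Fin 3) :=
  WithLp.toLp 2 fun j => (starRingEnd ℂ) (v j)

theorem norm_conjVec (v : EuclideanSpace ℂ (Fin 3)) : ‖conjVec v‖ = ‖v‖ := by
  simp [EuclideanSpace.norm_eq, conjVec]

theorem continuous_conjVec : Continuous conjVec := by
  unfold conjVec
  refine (PiLp.continuous_toLp 2 _).comp (continuous_pi fun j => ?_)
  fun_prop

theorem memLp_conjVec {p : ENNReal} (hg : MemLp g p volume) :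
    MemLp (fun x => conjVec (g x)) p volume :=
  hg.of_le (continuous_conjVec.comp_aestronglyMeasurable hg.1)
    (ae_of_all _ fun _ => (norm_conjVec _).le)

theorem IsWeakGradient.conj (hf : MemLp f 2 volume) (hg : MemLp g 2 volume)
    (h : IsWeakGradient f g) :
    IsWeakGradient (fun x => (starRingEnd ℂ) (f x)) (fun x => conjVec (g x)) := by
  refine .of_memLp (hf.star) (memLp_conjVec hg) fun φ hφ j => ?_
  have e := congrArg (starRingEnd ℂ) (h.2.2 _ hφ.conj j)
  rw [map_neg, ← integral_conj, ← integral_conj] at e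
  have hd : ∀ x, fderiv ℝ (fun x => (starRingEnd ℂ) (φ x)) x (EuclideanSpace.single j 1) =
      (starRingEnd ℂ) (fderiv ℝ φ x (EuclideanSpace.single j 1)) := fun x => by
    have := (Complex.conjCLE.hasFDerivAt.comp x
      ((hφ.1.differentiable (by simp)) x).hasFDerivAt).fderiv
    have h2 : (fun x => (starRingEnd ℂ) (φ x)) = Complex.conjCLE ∘ φ := rfl
    rw [h2, this]; rfl
  simpa [hd, conjVec] using e

theorem IsWeakGradient.comp_add (hf : MemLp f 2 volume) (hg : MemLp g 2 volume)
    (h : IsWeakGradient f g) (a : R3) :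
    IsWeakGradient (fun x => f (x + a)) (fun x => g (x + a)) := by
  have mp := measurePreserving_add_right (volume : Measure R3) a
  refine .of_memLp (hf.comp_measurePreserving mp) (hg.comp_measurePreserving mp) fun φ hφ j => ?_
  have e := h.2.2 _ (hφ.comp_add (-a)) j
  rw [← integral_add_right_eq_self _ a, ← integral_add_right_eq_self (fun x => g x j * _) a] at e
  simpa [fderiv_comp_add_right] using e

theorem IsTest.isWeakGradient {φ : R3 → ℂ} (hφ : IsTest φ) :
    IsWeakGradient φ
      (fun x => WithLp.toLp 2 fun j => fderiv ℝ φ x (EuclideanSpace.single j 1)) := by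
  refine ⟨hφ.continuous.locallyIntegrable, ?_, fun ψ hψ j => ?_⟩
  · refine Continuous.locallyIntegrable ?_
    refine (PiLp.continuous_toLp 2 _).comp (continuous_pi fun j => ?_)
    exact (hφ.fderiv_apply _).continuous
  · refine integral_mul_fderiv_eq_neg_fderiv_mul_of_integrable ?_ ?_ ?_
      (fun x _ => hφ.1.differentiable (by simp) x) fun x _ => hψ.1.differentiable (by simp) x
    · exact integrable_mul_of_hasCompactSupport
        (hφ.fderiv_apply _).continuous.locallyIntegrable hψ.continuous hψ.2
    · exact integrable_mul_of_hasCompactSupport hφ.continuous.locallyIntegrable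
        (hψ.fderiv_apply _).continuous (hψ.fderiv_apply _).2
    · exact integrable_mul_of_hasCompactSupport hφ.continuous.locallyIntegrable hψ.continuous hψ.2

/-- Product rule for a smooth factor. -/
theorem IsWeakGradient.smooth_mul {η : R3 → ℂ} (hη : ContDiff ℝ ∞ η) (h : IsWeakGradient f g) :
    IsWeakGradient (fun x => η x * f x) (fun x => WithLp.toLp 2 fun j =>
      η x * g x j + fderiv ℝ η x (EuclideanSpace.single j 1) * f x) := by
  have hη' : ∀ j : Fin 3, Continuous fun x => fderiv ℝ η x (EuclideanSpace.single j 1) := fun j =>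
    ((hη.continuous_fderiv (by simp)).clm_apply continuous_const)
  have l1 : ∀ (ζ u : R3 → ℂ), Continuous ζ → LocallyIntegrable u →
      LocallyIntegrable fun x => ζ x * u x := fun ζ u hζ hu => by
    rw [← locallyIntegrableOn_univ] at hu ⊢
    exact hu.continuousOn_mul hζ.continuousOn isOpen_univ.isLocallyClosed
  have l2 : ∀ j, LocallyIntegrable fun x =>
      η x * g x j + fderiv ℝ η x (EuclideanSpace.single j 1) * f x := fun j =>
    (l1 _ _ hη.continuous (locallyIntegrable_component h.2.1 j)).add (l1 _ _ (hη' j) h.1)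
  refine ⟨l1 _ _ hη.continuous h.1, fun x => ?_, fun φ hφ j => ?_⟩
  · choose s hs hi using fun j => l2 j x
    refine ⟨⋂ j, s j, by simpa using hs, ?_⟩
    refine ⟨?_, ?_⟩
    · refine (PiLp.continuous_toLp 2 _).comp_aestronglyMeasurable ?_
      exact (aemeasurable_pi_iff.2 fun j =>
        ((hi j).mono_set (Set.iInter_subset _ j)).1.aemeasurable).aestronglyMeasurable
    · refine HasFiniteIntegral.mono' (g := fun x => ∑ j, ‖η x * g x j +
        fderiv ℝ η x (EuclideanSpace.single j 1) * f x‖) ?_ (ae_of_all _ fun x => ?_)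
      · exact (integrable_finsetSum _ fun j _ =>
          ((hi j).mono_set (Set.iInter_subset _ j)).norm).2
      · rw [EuclideanSpace.norm_eq]
        refine (Real.sqrt_le_sqrt ?_).trans (Real.sqrt_sq (Finset.sum_nonneg fun j _ =>
          norm_nonneg _)).le
        exact Finset.sum_sq_le_sq_sum_of_nonneg fun j _ => norm_nonneg _
  · have hηφ := hφ.mul_left hη
    have e := h.2.2 _ hηφ j
    have hd : ∀ x, fderiv ℝ (fun x => η x * φ x) x (EuclideanSpace.single j 1) =
        η x * fderiv ℝ φ x (EuclideanSpace.single j 1) +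
          fderiv ℝ η x (EuclideanSpace.single j 1) * φ x := fun x => by
      have := ((hη.differentiable (by simp) x).hasFDerivAt.mul
        (hφ.1.differentiable (by simp) x).hasFDerivAt).fderiv
      rw [show (fun x => η x * φ x) = η * φ from rfl, this]; simp [mul_comm]
    have hd1 := hφ.fderiv_apply (EuclideanSpace.single j 1)
    have i1 : Integrable fun x => f x * (η x * fderiv ℝ φ x (EuclideanSpace.single j 1)) :=
      integrable_mul_of_hasCompactSupport h.1 (hη.continuous.mul hd1.continuous) hd1.2.mul_left
    have i2 : Integrable fun x => f x * (fderiv ℝ η x (EuclideanSpace.single j 1) * φ x) :=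
      integrable_mul_of_hasCompactSupport h.1 ((hη' j).mul hφ.continuous) hφ.2.mul_left
    have i3 : Integrable fun x => g x j * (η x * φ x) :=
      integrable_mul_of_hasCompactSupport (locallyIntegrable_component h.2.1 j)
        hηφ.continuous hηφ.2
    simp only [hd, mul_add] at e
    rw [integral_add i1 i2] at e
    have e2 : ∀ x, (η x * g x j + fderiv ℝ η x (EuclideanSpace.single j 1) * f x) * φ x =
        g x j * (η x * φ x) + f x * (fderiv ℝ η x (EuclideanSpace.single j 1) * φ x) :=
      fun x => by ring
    have e3 : ∀ x, η x * f x * fderiv ℝ φ x (EuclideanSpace.single j 1) =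
        f x * (η x * fderiv ℝ φ x (EuclideanSpace.single j 1)) := fun x => by ring
    simp only [e2, e3]
    rw [integral_add i3 i2, neg_add, ← e]
    ring

end Operations

theorem norm_toLp_le_sum (v : Fin 3 → ℂ) : ‖WithLp.toLp 2 v‖ ≤ ∑ j, ‖v j‖ := by
  rw [EuclideanSpace.norm_eq]
  exact (Real.sqrt_le_sqrt (Finset.sum_sq_le_sq_sum_of_nonneg fun j _ => norm_nonneg _)).trans
    (Real.sqrt_sq (Finset.sum_nonneg fun j _ => norm_nonneg _)).le

theorem memLp_toLp {p : ENNReal} {v : R3 → Fin 3 → ℂ}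
    (h : ∀ j, MemLp (fun x => v x j) p volume) :
    MemLp (fun x => (WithLp.toLp 2 (v x) : EuclideanSpace ℂ (Fin 3))) p volume := by
  refine MemLp.mono' (g := fun x => ∑ j, ‖v x j‖) (memLp_finsetSum _ fun j _ => (h j).norm) ?_
    (ae_of_all _ fun x => norm_toLp_le_sum _)
  exact (PiLp.continuous_toLp 2 _).comp_aestronglyMeasurable
    (aemeasurable_pi_iff.2 fun j => (h j).1.aemeasurable).aestronglyMeasurable

namespace MemSigma

variable {f f' : R3 → ℂ}

theorem add (h : MemSigma f) (h' : MemSigma f') : MemSigma (f + f') := by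
  refine ⟨h.memLp.add h'.memLp, ⟨_, h.isWeakGradient.add h'.isWeakGradient,
    h.memLp_weakGradient.add h'.memLp_weakGradient⟩, ?_⟩
  simpa [Pi.add_def, smul_add] using h.moment.add h'.moment

theorem const_smul (h : MemSigma f) (c : ℂ) : MemSigma (c • f) := by
  refine ⟨h.memLp.const_smul c, ⟨_, h.isWeakGradient.const_smul c,
    h.memLp_weakGradient.const_smul c⟩, ?_⟩
  simpa [Pi.smul_def, mul_left_comm] using h.moment.const_smul c

theorem neg (h : MemSigma f) : MemSigma (-f) := by simpa using h.const_smul (-1)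

theorem sub (h : MemSigma f) (h' : MemSigma f') : MemSigma (f - f') := by
  simpa [sub_eq_add_neg] using h.add h'.neg

theorem conj (h : MemSigma f) : MemSigma (fun x => (starRingEnd ℂ) (f x)) := by
  refine ⟨h.memLp.star, ⟨_, h.isWeakGradient.conj h.memLp h.memLp_weakGradient,
    memLp_conjVec h.memLp_weakGradient⟩, ?_⟩
  refine h.moment.star.congr_norm ?_ (ae_of_all _ fun x => by simp)
  exact (continuous_norm.aestronglyMeasurable).smul h.memLp.star.1

theorem comp_add (h : MemSigma f) (a : R3) : MemSigma (fun x => f (x + a)) := by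
  have mp := measurePreserving_add_right (volume : Measure R3) a
  refine ⟨h.memLp.comp_measurePreserving mp, ⟨_, h.isWeakGradient.comp_add h.memLp
    h.memLp_weakGradient a, h.memLp_weakGradient.comp_measurePreserving mp⟩, ?_⟩
  refine ((h.moment.comp_measurePreserving mp).norm.add
    ((h.memLp.comp_measurePreserving mp).norm.const_mul ‖a‖)).mono' ?_ (ae_of_all _ fun x => ?_)
  · exact continuous_norm.aestronglyMeasurable.smul (h.memLp.comp_measurePreserving mp).1
  · have h1 : ‖x‖ ≤ ‖x + a‖ + ‖a‖ := by simpa using norm_sub_le (x + a) a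
    simp only [norm_smul, norm_norm, Pi.add_apply, Function.comp]
    nlinarith [norm_nonneg (f (x + a))]

/-- The product rule produces a term ∇η · f. Linear growth of ∇η is affordable because both f and
|x| f lie in L². This admits the weights V/(1 + εV), whose gradient is later bounded by a multiple
of |x|, uniformly in ε. -/
theorem smooth_mul (h : MemSigma f) {η : R3 → ℂ} (hη : ContDiff ℝ ∞ η) {A B : ℝ}
    (hA : ∀ x, ‖η x‖ ≤ A) (hB : ∀ x, ‖fderiv ℝ η x‖ ≤ B * (1 + ‖x‖)) :
    MemSigma (fun x => η x * f x) := by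
  have m1 : ∀ {F : Type} [NormedAddCommGroup F] [NormedSpace ℂ F] {u : R3 → F},
      MemLp u 2 volume → MemLp (fun x => η x • u x) 2 volume := fun {F} _ _ {u} hu =>
    (hu.norm.const_mul A).mono' (hη.continuous.aestronglyMeasurable.smul hu.1)
      (ae_of_all _ fun x => by
        rw [norm_smul]; exact mul_le_mul_of_nonneg_right (hA x) (norm_nonneg _))
  have hη' : ∀ j : Fin 3, Continuous fun x => fderiv ℝ η x (EuclideanSpace.single j 1) := fun j =>
    ((hη.continuous_fderiv (by simp)).clm_apply continuous_const)
  refine ⟨m1 h.memLp, ⟨_, h.isWeakGradient.smooth_mul hη, ?_⟩, ?_⟩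
  · refine memLp_toLp fun j => (m1 (MemLp.component h.memLp_weakGradient j)).add ?_
    refine ((h.memLp.norm.add h.moment.norm).const_mul B).mono'
      ((hη' j).aestronglyMeasurable.mul h.memLp.1) (ae_of_all _ fun x => ?_)
    have h1 := (fderiv ℝ η x).le_opNorm (EuclideanSpace.single j 1)
    simp only [PiLp.norm_single, norm_one, mul_one] at h1
    have h2 := mul_le_mul_of_nonneg_right (h1.trans (hB x)) (norm_nonneg (f x))
    simp only [norm_mul, Pi.add_apply, norm_smul, norm_norm]
    linarith
  · have := m1 h.moment
    simpa [mul_left_comm] using this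

end MemSigma

theorem IsTest.memSigma {φ : R3 → ℂ} (hφ : IsTest φ) : MemSigma φ := by
  refine ⟨hφ.memLp 2, ⟨_, hφ.isWeakGradient, memLp_toLp fun j => (hφ.fderiv_apply _).memLp 2⟩, ?_⟩
  exact (continuous_norm.smul hφ.continuous).memLp_of_hasCompactSupport hφ.2.smul_left

/-! ### The norm of Σ -/

section SigmaNorm

variable {f f' : R3 → ℂ}

theorem MemSigma.sigmaNorm_lt_top (h : MemSigma f) : sigmaNorm f < ⊤ :=
  ENNReal.add_lt_top.2 ⟨ENNReal.add_lt_top.2 ⟨h.memLp.2, h.memLp_weakGradient.2⟩, h.moment.2⟩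

theorem eLpNorm_le_sigmaNorm : eLpNorm f 2 volume ≤ sigmaNorm f := by
  unfold sigmaNorm; rw [add_assoc]; exact le_self_add

theorem eLpNorm_weakGradient_le_sigmaNorm : eLpNorm (weakGradient f) 2 volume ≤ sigmaNorm f := by
  unfold sigmaNorm; exact le_add_right le_add_self

theorem eLpNorm_moment_le_sigmaNorm :
    eLpNorm (fun x => ‖x‖ • f x) 2 volume ≤ sigmaNorm f := le_add_self

theorem sigmaNorm_eq {g : R3 → EuclideanSpace ℂ (Fin 3)} (h : IsWeakGradient f g) :
    sigmaNorm f = eLpNorm f 2 volume + eLpNorm g 2 volume +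
      eLpNorm (fun x => ‖x‖ • f x) 2 volume := by
  rw [sigmaNorm, eLpNorm_congr_ae h.weakGradient_ae_eq]

theorem sigmaNorm_add_le (h : MemSigma f) (h' : MemSigma f') :
    sigmaNorm (f + f') ≤ sigmaNorm f + sigmaNorm f' := by
  rw [sigmaNorm_eq (h.isWeakGradient.add h'.isWeakGradient)]
  have h1 := eLpNorm_add_le h.memLp.1 h'.memLp.1 (p := 2) (by norm_num)
  have h2 := eLpNorm_add_le h.memLp_weakGradient.1 h'.memLp_weakGradient.1 (p := 2) (by norm_num)
  have h3 := eLpNorm_add_le h.moment.1 h'.moment.1 (p := 2) (by norm_num)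
  have e : (fun x => ‖x‖ • (f + f') x) = (fun x => ‖x‖ • f x) + fun x => ‖x‖ • f' x := by
    ext x; simp
  rw [e]
  refine (add_le_add (add_le_add h1 h2) h3).trans (le_of_eq ?_)
  unfold sigmaNorm; ring

theorem sigmaNorm_conj (h : MemSigma f) :
    sigmaNorm (fun x => (starRingEnd ℂ) (f x)) = sigmaNorm f := by
  rw [sigmaNorm_eq (h.isWeakGradient.conj h.memLp h.memLp_weakGradient), sigmaNorm]
  congr 1
  · congr 1
    · exact eLpNorm_congr_norm_ae (ae_of_all _ fun x => by simp)
    · exact eLpNorm_congr_norm_ae (ae_of_all _ fun x => norm_conjVec _)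
  · exact eLpNorm_congr_norm_ae (ae_of_all _ fun x => by simp)

end SigmaNorm

/-! ### L² tools: averages, translations, mollification -/

theorem tendsto_eLpNorm_two_iff {ι α E : Type*} [MeasurableSpace α] {μ : Measure α}
    [NormedAddCommGroup E] {l : Filter ι} {F : ι → α → E} :
    Tendsto (fun i => eLpNorm (F i) 2 μ) l (𝓝 0) ↔
      Tendsto (fun i => ∫⁻ x, ‖F i x‖ₑ ^ 2 ∂μ) l (𝓝 0) := by
  have e : ∀ i, eLpNorm (F i) 2 μ = (∫⁻ x, ‖F i x‖ₑ ^ 2 ∂μ) ^ (1 / 2 : ℝ) := fun i => by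
    rw [eLpNorm_eq_lintegral_rpow_enorm_toReal (by norm_num) (by norm_num)]
    simp
  simp only [e]
  constructor
  · intro h
    have := h.ennrpow_const 2
    simp only [← ENNReal.rpow_mul] at this
    simpa using this
  · intro h
    have := h.ennrpow_const (1 / 2)
    simpa using this

theorem eLpNorm_two_sq {α E : Type*} [MeasurableSpace α] {μ : Measure α}
    [NormedAddCommGroup E] (F : α → E) :
    eLpNorm F 2 μ ^ 2 = ∫⁻ x, ‖F x‖ₑ ^ 2 ∂μ := by
  rw [eLpNorm_eq_lintegral_rpow_enorm_toReal (by norm_num) (by norm_num), ← ENNReal.rpow_natCast,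
    ← ENNReal.rpow_mul]
  simp

/-- Jensen's inequality for the square of the norm of an average, integrated. -/
theorem lintegral_enorm_integral_sq_le {X Y E : Type*} [MeasurableSpace X] [MeasurableSpace Y]
    {μ : Measure X} [SFinite μ] {ν : Measure Y} [IsProbabilityMeasure ν]
    [NormedAddCommGroup E] [NormedSpace ℝ E] {k : X → Y → E}
    (hk : AEStronglyMeasurable (fun q : X × Y => k q.1 q.2) (μ.prod ν)) :
    ∫⁻ x, ‖∫ y, k x y ∂ν‖ₑ ^ 2 ∂μ ≤ ∫⁻ y, ∫⁻ x, ‖k x y‖ₑ ^ 2 ∂μ ∂ν := by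
  have h2 : AEMeasurable (fun q : X × Y => ‖k q.1 q.2‖ₑ ^ 2) (μ.prod ν) := hk.enorm.pow_const 2
  rw [← lintegral_lintegral_swap (f := fun x y => ‖k x y‖ₑ ^ 2) h2]
  refine lintegral_mono_ae ?_
  filter_upwards [hk.prodMk_left] with x hx
  -- After Tonelli the inequality is pointwise in x; since ν is a probability measure, the L¹ norm
  -- is at most the L² norm.
  have h3 : ∫⁻ y, ‖k x y‖ₑ ∂ν ≤ eLpNorm (fun y => k x y) 2 ν := by
    rw [← eLpNorm_one_eq_lintegral_enorm]
    exact eLpNorm_le_eLpNorm_of_exponent_le (by norm_num) hx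
  calc ‖∫ y, k x y ∂ν‖ₑ ^ 2 ≤ (eLpNorm (fun y => k x y) 2 ν) ^ 2 := by
        gcongr
        exact (enorm_integral_le_lintegral_enorm _).trans h3
    _ = _ := eLpNorm_two_sq _

/-- Translations act continuously on `L²`. -/
theorem tendsto_eLpNorm_translate_sub {E : Type*} [NormedAddCommGroup E] {g : R3 → E}
    (hg : MemLp g 2 volume) :
    Tendsto (fun a : R3 => eLpNorm (fun x => g (x + a) - g x) 2 volume) (𝓝 0) (𝓝 0) := by
  -- The translation action on `Lp` is continuous only for a finite exponent, which is passed as a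
  -- `Fact`.
  have : Fact ((2 : ENNReal) ≠ ⊤) := ⟨by norm_num⟩
  let G : Lp E 2 (volume : Measure R3) := hg.toLp g
  have hc : Continuous fun a : R3 => (DomAddAct.mk a) +ᵥ G :=
    (DomAddAct.continuous_mk).vadd continuous_const
  have h0 : Tendsto (fun a : R3 => edist ((DomAddAct.mk a) +ᵥ G) G) (𝓝 0) (𝓝 0) :=
    tendsto_iff_edist_tendsto_0.1 (hc.tendsto' 0 G (by rw [DomAddAct.mk_zero, zero_vadd]))
  refine h0.congr fun a => ?_
  rw [Lp.edist_def]
  refine eLpNorm_congr_ae ?_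
  have mp := measurePreserving_add_left (volume : Measure R3) a
  filter_upwards [DomAddAct.vadd_Lp_ae_eq
    (DomAddAct.mk a) G, hg.coeFn_toLp, mp.quasiMeasurePreserving.ae hg.coeFn_toLp]
    with x h2 h3 h4
  rw [Pi.sub_apply, h2, h3]
  simp only [Equiv.symm_apply_apply, vadd_eq_add] at *
  rw [add_comm x a]
  congr 1

/-- Mollification of `g` by the normalized bump function `b`. -/
def mollify {E : Type*} [NormedAddCommGroup E] [NormedSpace ℝ E] (b : ContDiffBump (0 : R3))
    (g : R3 → E) : R3 → E :=
  convolution (b.normed volume) g (ContinuousLinearMap.lsmul ℝ ℝ) volume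

theorem mollify_apply {E : Type*} [NormedAddCommGroup E] [NormedSpace ℝ E]
    (b : ContDiffBump (0 : R3)) (g : R3 → E) (x : R3) :
    mollify b g x = ∫ y, b.normed volume y • g (x - y) := rfl

/-- The normalized bump is a probability density, so the mollification error is an average of the
translation errors g(· - y) - g over the support of the bump, and Jensen's inequality bounds the L²
norm of the average. -/
theorem lintegral_mollify_sub_sq_le {E : Type*} [NormedAddCommGroup E] [NormedSpace ℝ E]
    [CompleteSpace E] {b : ContDiffBump (0 : R3)} {g : R3 → E} (hg : MemLp g 2 volume)
    {ε : ENNReal} (h : ∀ a : R3, ‖a‖ < b.rOut →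
      eLpNorm (fun x => g (x + a) - g x) 2 volume ≤ ε) :
    eLpNorm (mollify b g - g) 2 volume ≤ ε := by
  have hm : Measurable fun y => (b.normed volume y).toNNReal :=
    b.continuous_normed.measurable.real_toNNReal
  set ν : Measure R3 := volume.withDensity fun y => ((b.normed volume y).toNNReal : ENNReal) with hν
  have hval : ∀ y, ((b.normed volume y).toNNReal : ℝ) = b.normed volume y := fun y =>
    Real.coe_toNNReal _ (b.nonneg_normed y)
  have : IsProbabilityMeasure ν := ⟨by
    rw [hν, withDensity_apply _ .univ, Measure.restrict_univ]
    have := ofReal_integral_eq_lintegral_ofReal (b.integrable_normed (μ := volume))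
      (ae_of_all _ b.nonneg_normed)
    rw [b.integral_normed] at this
    simpa [ENNReal.ofReal] using this.symm⟩
  have hgl : LocallyIntegrable g := hg.locallyIntegrable (by norm_num)
  have e : ∀ x, (mollify b g - g) x = ∫ y, (g (x - y) - g x) ∂ν := fun x => by
    rw [hν, integral_withDensity_eq_integral_smul hm]
    simp only [NNReal.smul_def, hval, smul_sub]
    rw [integral_sub, integral_smul_const, b.integral_normed, one_smul]
    · rfl
    · exact (b.hasCompactSupport_normed.convolutionExists_left (ContinuousLinearMap.lsmul ℝ ℝ)
        b.continuous_normed hgl x)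
    · exact b.integrable_normed.smul_const _
  have hνac : ν ≪ volume := withDensity_absolutelyContinuous _ _
  have hk : AEStronglyMeasurable (fun q : R3 × R3 => g (q.1 - q.2) - g q.1) (volume.prod ν) := by
    refine AEStronglyMeasurable.mono_ac (Measure.AbsolutelyContinuous.rfl.prod hνac) ?_
    exact (hg.1.comp_quasiMeasurePreserving (quasiMeasurePreserving_sub volume volume)).sub
      (hg.1.comp_quasiMeasurePreserving Measure.quasiMeasurePreserving_fst)
  have h1 := lintegral_enorm_integral_sq_le (k := fun x y => g (x - y) - g x) hk
  simp only [← e, ← eLpNorm_two_sq] at h1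
  have h2 : ∫⁻ y, eLpNorm (fun x => g (x - y) - g x) 2 volume ^ 2 ∂ν ≤ ε ^ 2 := by
    calc _ ≤ ∫⁻ y, ε ^ 2 ∂ν := by
          refine lintegral_mono_ae ?_
          rw [hν, ae_withDensity_iff hm.coe_nnreal_ennreal]
          refine ae_of_all _ fun y hy => ?_
          have hy' : y ∈ Function.support (b.normed volume) := by
            intro h0; apply hy; simp [h0]
          rw [b.support_normed_eq, mem_ball_zero_iff] at hy'
          have := h (-y) (by simpa using hy')
          simp only [← sub_eq_add_neg] at this
          gcongr
      _ = ε ^ 2 := by simp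
  exact (ENNReal.pow_le_pow_left_iff (by norm_num)).1 (h1.trans h2)

/-! ### Density of test functions in Σ -/

section Density

variable {f : R3 → ℂ} {b : ContDiffBump (0 : R3)}

theorem isTest_mollify (hf : LocallyIntegrable f) (hc : HasCompactSupport f) :
    IsTest (mollify b f) :=
  ⟨b.hasCompactSupport_normed.contDiff_convolution_left _ b.contDiff_normed hf,
    b.hasCompactSupport_normed.convolution _ hc⟩

/-- The derivative falls on the smooth kernel, and y ↦ b(x - y) is itself a test function. Testing
the weak gradient with it moves the derivative onto f. -/
theorem fderiv_mollify {g : R3 → EuclideanSpace ℂ (Fin 3)} (h : IsWeakGradient f g)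
    (x : R3) (j : Fin 3) :
    fderiv ℝ (mollify b f) x (EuclideanSpace.single j 1) = mollify b (fun y => g y j) x := by
  have hb : ContDiff ℝ ∞ (b.normed volume) := b.contDiff_normed
  have e1 : mollify b f = convolution f (b.normed volume)
      (ContinuousLinearMap.lsmul ℝ ℝ : ℝ →L[ℝ] ℂ →L[ℝ] ℂ).flip volume :=
    (convolution_flip _).symm
  have hcd : HasCompactSupport (fderiv ℝ (b.normed volume)) :=
    b.hasCompactSupport_normed.fderiv (𝕜 := ℝ)
  have hφ : IsTest (fun y => ((b.normed volume (x - y) : ℝ) : ℂ)) :=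
    IsTest.ofReal (hb.comp (contDiff_const.sub contDiff_id))
      (b.hasCompactSupport_normed.comp_homeomorph (Homeomorph.subLeft x))
  have hd : ∀ y, fderiv ℝ (fun y => ((b.normed volume (x - y) : ℝ) : ℂ)) y
      (EuclideanSpace.single j 1) =
      -((fderiv ℝ (b.normed volume) (x - y) (EuclideanSpace.single j 1) : ℝ) : ℂ) := fun y => by
    have h1 : HasFDerivAt (fun y : R3 => x - y) (-(ContinuousLinearMap.id ℝ R3)) y :=
      (hasFDerivAt_id y).const_sub x
    have h2 := Complex.ofRealCLM.hasFDerivAt.comp y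
      (((hb.differentiable (by simp)) (x - y)).hasFDerivAt.comp y h1)
    have h3 : (fun y => ((b.normed volume (x - y) : ℝ) : ℂ)) =
      Complex.ofRealCLM ∘ b.normed volume ∘ fun y => x - y := rfl
    rw [h3, h2.fderiv]
    simp
  have e := h.2.2 _ hφ j
  simp only [hd, mul_neg, integral_neg, neg_inj] at e
  rw [e1, (b.hasCompactSupport_normed.hasFDerivAt_convolution_right _ h.1
    (hb.of_le (by simp)) x).fderiv, convolution_precompR_apply _ h.1 hcd
    (hb.continuous_fderiv (by simp)), mollify_apply, convolution_def]
  rw [← integral_sub_left_eq_self _ volume x]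
  simp only [sub_sub_cancel, Complex.real_smul, ContinuousLinearMap.flip_apply,
    ContinuousLinearMap.lsmul_apply]
  rw [← integral_sub_left_eq_self _ volume x] at e
  simp only [sub_sub_cancel] at e
  rw [← integral_sub_left_eq_self (fun y => g y j * _) volume x] at e
  simp only [sub_sub_cancel] at e
  simpa [mul_comm] using e

/-- The three terms bound the three parts of the norm: the function, the sum of the three gradient
components, and the moment. In the last one |x| ≤ R + 1 on the support of both functions, since the
mollification enlarges the support by at most 1. -/
theorem sigmaNorm_mollify_sub_le (h : MemSigma f) (hc : HasCompactSupport f) {R : ℝ}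
    (hR : ∀ x, R < ‖x‖ → f x = 0) (hb : b.rOut ≤ 1) {ε : ENNReal}
    (h0 : ∀ a : R3, ‖a‖ < b.rOut → eLpNorm (fun x => f (x + a) - f x) 2 volume ≤ ε)
    (h1 : ∀ j, ∀ a : R3, ‖a‖ < b.rOut → eLpNorm (fun x => weakGradient f (x + a) j -
      weakGradient f x j) 2 volume ≤ ε) :
    sigmaNorm (mollify b f - f) ≤ ε + 3 * ε + ENNReal.ofReal (R + 1) * ε := by
  have hl : LocallyIntegrable f := h.isWeakGradient.1
  have ht : IsTest (mollify b f) := isTest_mollify hl hc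
  have m0 := lintegral_mollify_sub_sq_le h.memLp h0
  rw [sigmaNorm_eq (ht.isWeakGradient.sub h.isWeakGradient)]
  refine add_le_add (add_le_add m0 ?_) ?_
  · calc _ ≤ eLpNorm (fun x => ∑ j, ‖(mollify b (fun y => weakGradient f y j) -
          fun y => weakGradient f y j) x‖) 2 volume := by
          refine eLpNorm_mono_real fun x => ?_
          have : ((fun x => WithLp.toLp 2 fun j => fderiv ℝ (mollify b f) x
              (EuclideanSpace.single j 1)) - weakGradient f) x = WithLp.toLp 2 fun j =>
              (mollify b (fun y => weakGradient f y j) - fun y => weakGradient f y j) x := by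
            ext j
            simp [fderiv_mollify h.isWeakGradient]
          rw [this]
          exact norm_toLp_le_sum _
      _ ≤ ∑ j, eLpNorm (fun x => ‖(mollify b (fun y => weakGradient f y j) -
          fun y => weakGradient f y j) x‖) 2 volume := by
          have := eLpNorm_sum_le (μ := volume) (p := 2) (s := Finset.univ)
            (f := fun j x => ‖(mollify b (fun y => weakGradient f y j) -
              fun y => weakGradient f y j) x‖) (fun j _ => ?_) (by norm_num)
          · convert this using 2
            ext x; simp
          · refine AEStronglyMeasurable.norm (AEStronglyMeasurable.sub ?_
              (MemLp.component h.memLp_weakGradient j).1)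
            have : mollify b (fun y => weakGradient f y j) =
                fun x => fderiv ℝ (mollify b f) x (EuclideanSpace.single j 1) := by
              ext x; rw [fderiv_mollify h.isWeakGradient]
            rw [this]
            exact (ht.fderiv_apply _).continuous.aestronglyMeasurable
      _ ≤ ∑ j : Fin 3, ε := Finset.sum_le_sum fun j _ => by
          rw [eLpNorm_norm]
          exact lintegral_mollify_sub_sq_le (MemLp.component h.memLp_weakGradient j) (h1 j)
      _ = 3 * ε := by simp
  -- If R + 1 < 0, then `ENNReal.ofReal (R + 1)` is 0 and the bound must hold trivially; it does,
  -- because f vanishes identically.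
  · by_cases hR1 : R + 1 < 0
    · have hz : f = 0 := funext fun x => hR x (by linarith [norm_nonneg x])
      have : ∀ x, (mollify b f - f) x = 0 := fun x => by simp [mollify_apply, hz]
      simp only [this, smul_zero]
      simp
    · refine (eLpNorm_le_mul_eLpNorm_of_ae_le_mul (c := R + 1) (ae_of_all _ fun x => ?_) 2).trans
        (mul_le_mul_right m0 _)
      rw [norm_smul, norm_norm]
      by_cases hx : ‖x‖ ≤ R + 1
      · exact mul_le_mul_of_nonneg_right hx (norm_nonneg _)
      · have hz : (mollify b f - f) x = 0 := by
          have h2 : f x = 0 := hR x (by linarith [not_le.1 hx])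
          have h3 : mollify b f x = 0 := by
            rw [mollify_apply]
            refine integral_eq_zero_of_ae (ae_of_all _ fun y => ?_)
            by_cases hy : y ∈ Metric.ball (0 : R3) b.rOut
            · have hy' : ‖y‖ < b.rOut := by simpa using hy
              have : R < ‖x - y‖ := by
                have := norm_sub_norm_le x y
                linarith [not_le.1 hx]
              simp [hR _ this]
            · rw [← b.support_normed_eq (μ := volume)] at hy
              simp [Function.notMem_support.1 hy]
          simp [h2, h3]
        simp [hz]

theorem exists_isTest_of_hasCompactSupport (h : MemSigma f) (hc : HasCompactSupport f)
    {δ : ENNReal} (hδ : 0 < δ) : ∃ φ, IsTest φ ∧ sigmaNorm (φ - f) ≤ δ := by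
  obtain ⟨R, hR0, hR⟩ : ∃ R : ℝ, 0 ≤ R ∧ ∀ x, R < ‖x‖ → f x = 0 := by
    obtain ⟨R, hR⟩ := hc.isCompact.isBounded.subset_closedBall 0
    refine ⟨max R 0, le_max_right _ _, fun x hx => ?_⟩
    by_contra hne
    have := hR (subset_tsupport f hne)
    rw [mem_closedBall_zero_iff] at this
    exact absurd (le_max_left R 0) (by linarith)
  have hK : ENNReal.ofReal (R + 1) ≠ ⊤ := ENNReal.ofReal_ne_top
  -- K collects the coefficients of ε in `sigmaNorm_mollify_sub_le`, so the translation errors are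
  -- required to be below δ / K.
  set K : ENNReal := 1 + 3 + ENNReal.ofReal (R + 1) with hKd
  have hKt : K ≠ ⊤ := by simp [hKd]
  have hK0 : K ≠ 0 := by simp [hKd]
  have hε : 0 < δ / K := ENNReal.div_pos hδ.ne' hKt
  have t0 := (tendsto_eLpNorm_translate_sub h.memLp).eventually (gt_mem_nhds hε)
  have t1 : ∀ j, ∀ᶠ a : R3 in 𝓝 0, eLpNorm (fun x => weakGradient f (x + a) j -
      weakGradient f x j) 2 volume < δ / K := fun j =>
    (tendsto_eLpNorm_translate_sub (MemLp.component h.memLp_weakGradient j)).eventually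
      (gt_mem_nhds hε)
  obtain ⟨r, hr, hr'⟩ := Metric.eventually_nhds_iff_ball.1 (t0.and (eventually_all.2 t1))
  have hm : 0 < min r 1 := by positivity
  let b : ContDiffBump (0 : R3) := ⟨min r 1 / 2, min r 1, by positivity, by linarith⟩
  have hbr : b.rOut = min r 1 := rfl
  have hlt : ∀ a : R3, ‖a‖ < b.rOut → a ∈ Metric.ball (0 : R3) r := fun a ha => by
    rw [mem_ball_zero_iff]; exact ha.trans_le (min_le_left _ _)
  refine ⟨mollify b f, isTest_mollify h.isWeakGradient.1 hc,
    (sigmaNorm_mollify_sub_le h hc hR (min_le_right _ _) (fun a ha => (hr' a (hlt a ha)).1.le)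
      fun j a ha => ((hr' a (hlt a ha)).2 j).le).trans (le_of_eq ?_)⟩
  calc δ / K + 3 * (δ / K) + ENNReal.ofReal (R + 1) * (δ / K) = K * (δ / K) := by
        rw [hKd]; ring
    _ = δ := ENNReal.mul_div_cancel hK0 hKt

/-- Smooth cutoff equal to `1` on the ball of radius `n + 1`. -/
def cutoff (n : ℕ) (x : R3) : ℂ :=
  (((⟨1, 2, one_pos, one_lt_two⟩ : ContDiffBump (0 : R3)) ((n + 1 : ℝ)⁻¹ • x) : ℝ) : ℂ)

theorem contDiff_cutoff (n : ℕ) : ContDiff ℝ ∞ (cutoff n) :=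
  Complex.ofRealCLM.contDiff.comp (ContDiffBump.contDiff _ |>.comp (contDiff_const_smul _))

theorem hasCompactSupport_cutoff (n : ℕ) : HasCompactSupport (cutoff n) := by
  have h := (⟨1, 2, one_pos, one_lt_two⟩ : ContDiffBump (0 : R3)).hasCompactSupport
  have h2 := h.comp_smul (c := (n + 1 : ℝ)⁻¹) (by positivity)
  exact h2.comp_left (g := fun r : ℝ => (r : ℂ)) rfl

theorem norm_cutoff_le (n : ℕ) (x : R3) : ‖cutoff n x‖ ≤ 1 := by
  rw [cutoff, Complex.norm_real, Real.norm_of_nonneg (ContDiffBump.nonneg _)]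
  exact ContDiffBump.le_one _

theorem cutoff_eventually_eq_one (x : R3) : ∀ᶠ n in atTop, cutoff n x = 1 := by
  obtain ⟨N, hN⟩ := exists_nat_ge ‖x‖
  filter_upwards [eventually_ge_atTop N] with n hn
  rw [cutoff, ContDiffBump.one_of_mem_closedBall, Complex.ofReal_one]
  rw [mem_closedBall_zero_iff, norm_smul, Real.norm_of_nonneg (by positivity)]
  have : (N : ℝ) ≤ n := by exact_mod_cast hn
  rw [inv_mul_le_iff₀ (by positivity)]
  show ‖x‖ ≤ (n + 1 : ℝ) * 1
  linarith

theorem exists_norm_fderiv_cutoff_le :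
    ∃ C, 0 ≤ C ∧ ∀ n x, ‖fderiv ℝ (cutoff n) x‖ ≤ C * (n + 1 : ℝ)⁻¹ := by
  set B : R3 → ℂ := fun x => (((⟨1, 2, one_pos, one_lt_two⟩ : ContDiffBump (0 : R3)) x : ℝ) : ℂ)
  have hB : IsTest B := IsTest.ofReal (ContDiffBump.contDiff _) (ContDiffBump.hasCompactSupport _)
  obtain ⟨C, hC⟩ := (hB.2.fderiv (𝕜 := ℝ)).exists_bound_of_continuous
    (hB.1.continuous_fderiv (by simp))
  refine ⟨C, (norm_nonneg _).trans (hC 0), fun n x => ?_⟩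
  have h1 : HasFDerivAt (fun x : R3 => (n + 1 : ℝ)⁻¹ • x)
      ((n + 1 : ℝ)⁻¹ • ContinuousLinearMap.id ℝ R3) x := ((n + 1 : ℝ)⁻¹ • ContinuousLinearMap.id ℝ R3).hasFDerivAt
  have h2 := ((hB.1.differentiable (by simp) ((n + 1 : ℝ)⁻¹ • x)).hasFDerivAt).comp x h1
  have h3 : cutoff n = B ∘ fun x : R3 => (n + 1 : ℝ)⁻¹ • x := rfl
  rw [h3, h2.fderiv]
  refine (ContinuousLinearMap.opNorm_comp_le _ _).trans ?_
  refine mul_le_mul (hC _) ?_ (norm_nonneg _) ((norm_nonneg _).trans (hC 0))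
  rw [norm_smul, Real.norm_of_nonneg (by positivity)]
  exact mul_le_of_le_one_right (by positivity) ContinuousLinearMap.norm_id_le

theorem tendsto_eLpNorm_smul_of_tendsto {F : Type*} [NormedAddCommGroup F] [NormedSpace ℂ F]
    {u : R3 → F} (hu : MemLp u 2 volume) {c : ℕ → R3 → ℂ} {C : ℝ}
    (hcm : ∀ n, Continuous (c n)) (hc : ∀ n x, ‖c n x‖ ≤ C)
    (h0 : ∀ x, Tendsto (fun n => c n x) atTop (𝓝 0)) :
    Tendsto (fun n => eLpNorm (fun x => c n x • u x) 2 volume) atTop (𝓝 0) := by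
  rw [tendsto_eLpNorm_two_iff]
  have := tendsto_lintegral_of_dominated_convergence' (μ := (volume : Measure R3))
    (F := fun n x => ‖c n x • u x‖ₑ ^ 2) (f := fun _ => 0)
    (fun x => ENNReal.ofReal C ^ 2 * ‖u x‖ₑ ^ 2)
    (fun n => ((hcm n).aestronglyMeasurable.smul hu.1).enorm.pow_const 2)
    (fun n => ae_of_all _ fun x => ?_) ?_ (ae_of_all _ fun x => ?_)
  · simpa using this
  · simp only [enorm_smul, mul_pow]
    gcongr
    rw [← ofReal_norm]
    exact ENNReal.ofReal_le_ofReal (hc n x)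
  · rw [lintegral_const_mul'' _ (hu.1.enorm.pow_const 2), ← eLpNorm_two_sq]
    exact ENNReal.mul_ne_top (by simp) (by simpa using hu.2.ne)
  · have h1 : Tendsto (fun n => c n x • u x) atTop (𝓝 0) := by
      simpa using (h0 x).smul_const (u x)
    have h2 := ((ENNReal.continuous_pow 2).tendsto _).comp h1.enorm
    simpa [Function.comp_def] using h2

/-- Multiplication by cutoff - 1 tends to 0 in L² by dominated convergence, for f, ∇f and |x| f
alike. The commutator ∇(cutoff) · f is of size 1/(n + 1) in L², because the cutoff is a dilation of
one fixed bump. -/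
theorem tendsto_sigmaNorm_cutoff_mul_sub (h : MemSigma f) :
    (∀ n, MemSigma (fun x => cutoff n x * f x)) ∧
    Tendsto (fun n => sigmaNorm ((fun x => cutoff n x * f x) - f)) atTop (𝓝 0) := by
  obtain ⟨C, hC0, hC⟩ := exists_norm_fderiv_cutoff_le
  refine ⟨fun n => h.smooth_mul (contDiff_cutoff n) (norm_cutoff_le n) (B := C) fun x => ?_, ?_⟩
  · refine (hC n x).trans (mul_le_mul_of_nonneg_left ?_ hC0)
    have : (n + 1 : ℝ)⁻¹ ≤ 1 := inv_le_one_of_one_le₀ (by linarith [n.cast_nonneg (α := ℝ)])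
    linarith [norm_nonneg x]
  · have hw := fun n => ((h.isWeakGradient.smooth_mul (contDiff_cutoff n)).sub h.isWeakGradient)
    have hc1 : ∀ n, Continuous fun x => cutoff n x - 1 := fun n =>
      (contDiff_cutoff n).continuous.sub continuous_const
    have hb1 : ∀ n x, ‖cutoff n x - 1‖ ≤ 2 := fun n x => by
      refine (norm_sub_le _ _).trans ?_
      have := norm_cutoff_le n x
      simp only [norm_one]; linarith
    have hl1 : ∀ x, Tendsto (fun n => cutoff n x - 1) atTop (𝓝 0) := fun x =>
      tendsto_nhds_of_eventually_eq ((cutoff_eventually_eq_one x).mono fun n hn => by simp [hn])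
    have T0 := tendsto_eLpNorm_smul_of_tendsto h.memLp hc1 hb1 hl1
    have T1 := tendsto_eLpNorm_smul_of_tendsto h.memLp_weakGradient hc1 hb1 hl1
    have T2 := tendsto_eLpNorm_smul_of_tendsto h.moment hc1 hb1 hl1
    have T3 : Tendsto (fun n : ℕ => ENNReal.ofReal (3 * (C * (n + 1 : ℝ)⁻¹)) * eLpNorm f 2 volume)
        atTop (𝓝 0) := by
      have h1 : Tendsto (fun n : ℕ => 3 * (C * (n + 1 : ℝ)⁻¹)) atTop (𝓝 0) := by
        have := (tendsto_one_div_add_atTop_nhds_zero_nat (𝕜 := ℝ)).const_mul (3 * C)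
        simpa [mul_assoc] using this
      have := ENNReal.Tendsto.mul_const (ENNReal.tendsto_ofReal h1)
        (b := eLpNorm f 2 volume) (Or.inr h.memLp.2.ne)
      simpa using this
    have T := (T0.add (T1.add T3)).add T2
    simp only [add_zero] at T
    refine tendsto_of_tendsto_of_tendsto_of_le_of_le tendsto_const_nhds T (fun _ => zero_le)
      fun n => ?_
    simp only
    rw [sigmaNorm_eq (hw n)]
    refine add_le_add (add_le_add (le_of_eq ?_) ?_) (le_of_eq ?_)
    · congr 1; ext x; simp [sub_mul]
    · set G := fun x => WithLp.toLp 2 (fun j : Fin 3 =>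
        fderiv ℝ (cutoff n) x (EuclideanSpace.single j 1) * f x) with hG
      have e : ((fun x => WithLp.toLp 2 fun j => cutoff n x * weakGradient f x j +
          fderiv ℝ (cutoff n) x (EuclideanSpace.single j 1) * f x) - weakGradient f) =
          (fun x => (cutoff n x - 1) • weakGradient f x) + G := by
        ext x j
        simp [hG, sub_mul]; ring
      have hcd : ∀ j : Fin 3,
          Continuous fun x => fderiv ℝ (cutoff n) x (EuclideanSpace.single j 1) := fun j =>
        ((contDiff_cutoff n).continuous_fderiv (by simp)).clm_apply continuous_const
      have hGm : AEStronglyMeasurable G volume :=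
        (PiLp.continuous_toLp 2 _).comp_aestronglyMeasurable (aemeasurable_pi_iff.2 fun j =>
          ((hcd j).aestronglyMeasurable.mul h.memLp.1).aemeasurable).aestronglyMeasurable
      rw [e]
      refine (eLpNorm_add_le ((hc1 n).aestronglyMeasurable.smul h.memLp_weakGradient.1) hGm
        (by norm_num)).trans (add_le_add le_rfl ?_)
      refine eLpNorm_le_mul_eLpNorm_of_ae_le_mul (ae_of_all _ fun x => ?_) 2
      refine (norm_toLp_le_sum _).trans ?_
      calc _ ≤ ∑ _j : Fin 3, C * (n + 1 : ℝ)⁻¹ * ‖f x‖ := Finset.sum_le_sum fun j _ => by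
            rw [norm_mul]
            refine mul_le_mul_of_nonneg_right (le_trans ?_ (hC n x)) (norm_nonneg _)
            simpa using (fderiv ℝ (cutoff n) x).le_opNorm (EuclideanSpace.single j 1)
        _ = _ := by simp; ring
    · congr 1; ext x; simp [sub_mul]; ring

/-- Test functions are dense in `Σ`. -/
theorem MemSigma.exists_isTest (h : MemSigma f) {δ : ENNReal} (hδ : 0 < δ) :
    ∃ φ, IsTest φ ∧ sigmaNorm (φ - f) ≤ δ := by
  obtain ⟨hm, ht⟩ := tendsto_sigmaNorm_cutoff_mul_sub h
  have hδ2 : 0 < δ / 2 := ENNReal.half_pos hδ.ne'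
  obtain ⟨n, hn⟩ := (ht.eventually (gt_mem_nhds hδ2)).exists
  obtain ⟨φ, hφ, hφn⟩ := exists_isTest_of_hasCompactSupport (hm n)
    (hasCompactSupport_cutoff n).mul_right hδ2
  refine ⟨φ, hφ, ?_⟩
  have e : φ - f = (φ - fun x => cutoff n x * f x) + ((fun x => cutoff n x * f x) - f) := by
    simp
  rw [e, ← ENNReal.add_halves δ]
  exact (sigmaNorm_add_le (hφ.memSigma.sub (hm n)) ((hm n).sub h)).trans (add_le_add hφn hn.le)

theorem MemSigma.exists_seq_isTest (h : MemSigma f) : ∃ φ : ℕ → R3 → ℂ, (∀ n, IsTest (φ n)) ∧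
    Tendsto (fun n => sigmaNorm (φ n - f)) atTop (𝓝 0) := by
  have h1 : ∀ n : ℕ, ∃ φ, IsTest φ ∧ sigmaNorm (φ - f) ≤ (n + 1 : ENNReal)⁻¹ := fun n =>
    h.exists_isTest (ENNReal.inv_pos.2 (by simp))
  choose φ hφ hb using h1
  refine ⟨φ, hφ, tendsto_of_tendsto_of_tendsto_of_le_of_le tendsto_const_nhds ?_
    (fun _ => zero_le) hb⟩
  have := (tendsto_add_atTop_iff_nat 1).2 ENNReal.tendsto_inv_nat_nhds_zero
  simpa using this

end Density

/-! ### The Sobolev embedding of Σ into L⁶ -/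

section Sobolev

variable {f : R3 → ℂ}

theorem IsTest.norm_fderiv_le {φ : R3 → ℂ} (x : R3) : ‖fderiv ℝ φ x‖ ≤
    3 * ‖(WithLp.toLp 2 fun j => fderiv ℝ φ x (EuclideanSpace.single j 1) :
      EuclideanSpace ℂ (Fin 3))‖ := by
  refine ContinuousLinearMap.opNorm_le_bound _ (by positivity) fun v => ?_
  set G : EuclideanSpace ℂ (Fin 3) := WithLp.toLp 2 fun j =>
    fderiv ℝ φ x (EuclideanSpace.single j 1) with hG
  have hv : v = ∑ j, v j • (EuclideanSpace.single j (1 : ℝ) : R3) := by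
    ext i; simp [Finset.sum_apply, Pi.single_apply]
  calc ‖fderiv ℝ φ x v‖ = ‖∑ j, v j • G j‖ := by
        conv_lhs => rw [hv]
        simp [hG]
    _ ≤ ∑ j, ‖v j • G j‖ := norm_sum_le _ _
    _ ≤ ∑ _j : Fin 3, ‖G‖ * ‖v‖ := Finset.sum_le_sum fun j _ => by
        rw [norm_smul, mul_comm]
        exact mul_le_mul (PiLp.norm_apply_le G j) (PiLp.norm_apply_le v j) (norm_nonneg _)
          (norm_nonneg _)
    _ = 3 * ‖G‖ * ‖v‖ := by simp; ring

/-- This is the Gagliardo–Nirenberg–Sobolev inequality in dimension 3 with p = 2, for which 1/6 =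
1/2 - 1/3. The factor 3 compares the operator norm of the derivative with the Euclidean norm of the
gradient. -/
theorem exists_eLpNorm_six_le_of_isTest : ∃ S : NNReal, ∀ φ : R3 → ℂ, IsTest φ →
    eLpNorm φ 6 volume ≤ S * sigmaNorm φ := by
  refine ⟨SNormLESNormFDerivOfEqConst ℂ (volume : Measure R3) 2 * 3, fun φ hφ => ?_⟩
  have h1 := eLpNorm_le_eLpNorm_fderiv_of_eq (μ := (volume : Measure R3)) (p := 2) (p' := 6)
    (hφ.1.of_le (by simp)) hφ.2 (by norm_num) (by simp) (by simp; norm_num)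
  have h2 : eLpNorm (fderiv ℝ φ) 2 volume ≤ 3 * sigmaNorm φ := by
    refine (eLpNorm_le_mul_eLpNorm_of_ae_le_mul
      (ae_of_all _ fun x => IsTest.norm_fderiv_le (φ := φ) x) 2).trans ?_
    rw [← eLpNorm_congr_ae hφ.isWeakGradient.weakGradient_ae_eq]
    simp only [ENNReal.ofReal_ofNat]
    gcongr
    exact eLpNorm_weakGradient_le_sigmaNorm
  refine (show eLpNorm φ 6 volume ≤ _ from h1).trans ?_
  push_cast
  rw [mul_assoc]
  gcongr

/-- A sequence converging in `L²` has an almost everywhere convergent subsequence. -/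
theorem exists_subseq_tendsto_ae {E : Type*} [NormedAddCommGroup E] {F : ℕ → R3 → E} {g : R3 → E}
    (hF : ∀ n, AEStronglyMeasurable (F n) volume) (hg : AEStronglyMeasurable g volume)
    (h : Tendsto (fun n => eLpNorm (F n - g) 2 volume) atTop (𝓝 0)) :
    ∃ ns : ℕ → ℕ, StrictMono ns ∧ ∀ᵐ x, Tendsto (fun n => F (ns n) x) atTop (𝓝 (g x)) :=
  (tendstoInMeasure_of_tendsto_eLpNorm (by norm_num) hF hg h).exists_seq_tendsto_ae

/-- The Sobolev embedding `Σ ⊆ L⁶`. -/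
theorem exists_eLpNorm_six_le : ∃ S : NNReal, ∀ f : R3 → ℂ, MemSigma f →
    eLpNorm f 6 volume ≤ S * sigmaNorm f := by
  obtain ⟨S, hS⟩ := exists_eLpNorm_six_le_of_isTest
  refine ⟨S, fun f hf => ?_⟩
  obtain ⟨φ, hφ, ht⟩ := hf.exists_seq_isTest
  have ht2 : Tendsto (fun n => eLpNorm (φ n - f) 2 volume) atTop (𝓝 0) :=
    tendsto_of_tendsto_of_tendsto_of_le_of_le tendsto_const_nhds ht (fun _ => zero_le)
      fun _ => eLpNorm_le_sigmaNorm
  obtain ⟨ns, hns, hae⟩ := exists_subseq_tendsto_ae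
    (fun n => (hφ n).continuous.aestronglyMeasurable) hf.memLp.1 ht2
  -- The L⁶ norm is lower semicontinuous under almost everywhere convergence, so the inequality
  -- passes to the limit without knowing beforehand that f lies in L⁶.
  refine (Lp.eLpNorm_lim_le_liminf_eLpNorm (p := 6)
    (fun n => (hφ (ns n)).continuous.aestronglyMeasurable) f hae).trans ?_
  have hlim : Tendsto (fun n => (S : ENNReal) * (sigmaNorm (φ (ns n) - f) + sigmaNorm f)) atTop
      (𝓝 (S * (0 + sigmaNorm f))) :=
    ENNReal.Tendsto.const_mul ((ht.comp hns.tendsto_atTop).add tendsto_const_nhds)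
      (Or.inr ENNReal.coe_ne_top)
  rw [zero_add] at hlim
  rw [← hlim.liminf_eq]
  refine liminf_le_liminf (Eventually.of_forall fun n => (hS _ (hφ _)).trans ?_)
  gcongr
  have := sigmaNorm_add_le ((hφ (ns n)).memSigma.sub hf) hf
  simpa using this

/-- A constant for the Sobolev embedding `Σ ⊆ L⁶`. -/
def sobolevConst : NNReal := exists_eLpNorm_six_le.choose

theorem MemSigma.eLpNorm_six_le (h : MemSigma f) :
    eLpNorm f 6 volume ≤ sobolevConst * sigmaNorm f := exists_eLpNorm_six_le.choose_spec f h

theorem eLpNorm_six_pow {α E : Type*} [MeasurableSpace α] {μ : Measure α}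
    [NormedAddCommGroup E] (F : α → E) :
    eLpNorm F 6 μ ^ 6 = ∫⁻ x, ‖F x‖ₑ ^ 6 ∂μ := by
  rw [eLpNorm_eq_lintegral_rpow_enorm_toReal (by norm_num) (by norm_num), ← ENNReal.rpow_natCast,
    ← ENNReal.rpow_mul]
  simp

end Sobolev

/-- Dominated convergence with a bound that converges in `L¹`. -/
theorem tendsto_lintegral_enorm_of_le_add {α E : Type*} [MeasurableSpace α] {μ : Measure α}
    [NormedAddCommGroup E] {Y : ℕ → α → E} {B : α → ENNReal} {b : ℕ → α → ENNReal}
    (hY : ∀ n, AEStronglyMeasurable (Y n) μ) (hb : ∀ n, AEMeasurable (b n) μ)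
    (hB : ∫⁻ x, B x ∂μ ≠ ⊤) (h0 : ∀ᵐ x ∂μ, Tendsto (fun n => Y n x) atTop (𝓝 0))
    (hle : ∀ n, ∀ᵐ x ∂μ, ‖Y n x‖ₑ ≤ B x + b n x)
    (hb0 : Tendsto (fun n => ∫⁻ x, b n x ∂μ) atTop (𝓝 0)) :
    Tendsto (fun n => ∫⁻ x, ‖Y n x‖ₑ ∂μ) atTop (𝓝 0) := by
  -- The truncated difference ‖Y n‖ - b n is dominated by the fixed function B; the part that was
  -- subtracted tends to 0 in L¹.
  have h1 : Tendsto (fun n => ∫⁻ x, (‖Y n x‖ₑ - b n x) ∂μ) atTop (𝓝 0) := by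
    have := tendsto_lintegral_of_dominated_convergence' (μ := μ)
      (F := fun n x => ‖Y n x‖ₑ - b n x) (f := fun _ => 0) B
      (fun n => (hY n).enorm.sub (hb n))
      (fun n => (hle n).mono fun x hx => tsub_le_iff_right.2 hx) hB ?_
    · simpa using this
    · filter_upwards [h0] with x hx
      refine tendsto_of_tendsto_of_tendsto_of_le_of_le tendsto_const_nhds (by simpa using hx.enorm)
        (fun _ => zero_le) fun n => tsub_le_self
  have h2 := h1.add hb0
  rw [add_zero] at h2
  refine tendsto_of_tendsto_of_tendsto_of_le_of_le tendsto_const_nhds h2 (fun _ => zero_le)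
    fun n => ?_
  simp only
  rw [← lintegral_add_right' _ (hb n)]
  exact lintegral_mono fun x => le_tsub_add

/-! ### Integral functionals of the jet and their continuity on Σ -/

section Jets

/-- Values of a position, a function, its translate and its gradient. -/
abbrev Jet : Type := R3 × ℂ × ℂ × EuclideanSpace ℂ (Fin 3)

/-- The position, value, translated value and gradient of `f` at `x`. -/
def jet (a : R3) (f : R3 → ℂ) (x : R3) : Jet := (x, f x, f (x + a), weakGradient f x)

/-- The function of the jet controlled by the norm of `Σ`. -/
def jetWeight (q : Jet) : ℝ :=
  (1 + ‖q.1‖ ^ 2) * (‖q.2.1‖ ^ 2 + ‖q.2.2.1‖ ^ 2) + ‖q.2.2.2‖ ^ 2 + ‖q.2.1‖ ^ 6 + ‖q.2.2.1‖ ^ 6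

/-- Continuous functions of the jet that induce continuous functionals on `Σ`. -/
structure JetAdmissible {E : Type*} [NormedAddCommGroup E] (Ψ : Jet → E) : Prop where
  continuous : Continuous Ψ
  bound : ∃ (C : ℝ) (k : R3 → ℝ), 0 ≤ C ∧ Integrable k ∧ ∀ q, ‖Ψ q‖ ≤ C * jetWeight q + k q.1

theorem jetWeight_nonneg (q : Jet) : 0 ≤ jetWeight q := by unfold jetWeight; positivity

theorem continuous_jetWeight : Continuous jetWeight := by unfold jetWeight; fun_prop

variable {f f' : R3 → ℂ} {E : Type*} [NormedAddCommGroup E] {Ψ : Jet → E}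

theorem JetAdmissible.of_le (hΨ : Continuous Ψ) (C : ℝ) (hC : 0 ≤ C)
    (h : ∀ q, ‖Ψ q‖ ≤ C * jetWeight q) : JetAdmissible Ψ :=
  ⟨hΨ, C, 0, hC, integrable_zero _ _ _, by simpa using h⟩

theorem MemSigma.aestronglyMeasurable_jet (h : MemSigma f) (a : R3) :
    AEStronglyMeasurable (jet a f) volume :=
  aestronglyMeasurable_id.prodMk (h.memLp.1.prodMk
    ((h.comp_add a).memLp.1.prodMk h.memLp_weakGradient.1))

/-- The quadratic terms are controlled by the norm of Σ, the sixth powers by the Sobolev embedding.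
The weight |x|² on the translate costs |x|² ≤ 2|x + a|² + 2|a|², which gives the coefficient 3 + (1
+ 2|a|²) + 2. -/
theorem lintegral_jetWeight_le (h : MemSigma f) (a : R3) :
    ∫⁻ x, ENNReal.ofReal (jetWeight (jet a f x)) ≤
      ENNReal.ofReal (6 + 2 * ‖a‖ ^ 2) * sigmaNorm f ^ 2 +
        2 * (sobolevConst * sigmaNorm f) ^ 6 := by
  have mp := measurePreserving_add_right (volume : Measure R3) a
  have me : MeasurableEmbedding fun x : R3 => x + a := (Homeomorph.addRight a).measurableEmbedding
  have hfm := h.memLp.1.enorm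
  have e1 : ∫⁻ x, ‖f x‖ₑ ^ 2 ≤ sigmaNorm f ^ 2 := by
    rw [← eLpNorm_two_sq]; gcongr; exact eLpNorm_le_sigmaNorm
  have e2 : ∫⁻ x, ‖weakGradient f x‖ₑ ^ 2 ≤ sigmaNorm f ^ 2 := by
    rw [← eLpNorm_two_sq]; gcongr; exact eLpNorm_weakGradient_le_sigmaNorm
  have e3 : ∫⁻ x, ‖(‖x‖ • f x)‖ₑ ^ 2 ≤ sigmaNorm f ^ 2 := by
    rw [← eLpNorm_two_sq]; gcongr; exact eLpNorm_moment_le_sigmaNorm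
  have e4 : ∫⁻ x, ‖f x‖ₑ ^ 6 ≤ (sobolevConst * sigmaNorm f) ^ 6 := by
    rw [← eLpNorm_six_pow]; gcongr; exact h.eLpNorm_six_le
  have e5 : ∫⁻ x, ‖f (x + a)‖ₑ ^ 6 ≤ (sobolevConst * sigmaNorm f) ^ 6 := by
    rw [mp.lintegral_comp_emb me (fun y => ‖f y‖ₑ ^ 6)]; exact e4
  have e6 : ∫⁻ x, ‖f (x + a)‖ₑ ^ 2 ≤ sigmaNorm f ^ 2 := by
    rw [mp.lintegral_comp_emb me (fun y => ‖f y‖ₑ ^ 2)]; exact e1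
  have e7 : ∫⁻ x, ‖(‖x + a‖ • f (x + a))‖ₑ ^ 2 ≤ sigmaNorm f ^ 2 := by
    rw [mp.lintegral_comp_emb me (fun y => ‖(‖y‖ • f y)‖ₑ ^ 2)]; exact e3
  have hfa := (h.comp_add a).memLp.1.enorm
  have hma : AEMeasurable (fun x => ‖(‖x + a‖ • f (x + a))‖ₑ) volume := (h.moment.comp_measurePreserving mp).1.enorm
  have hpt : ∀ x, ENNReal.ofReal (jetWeight (jet a f x)) ≤
      (((((‖f x‖ₑ ^ 2 + ‖(‖x‖ • f x)‖ₑ ^ 2) + ‖weakGradient f x‖ₑ ^ 2) + ‖f x‖ₑ ^ 6) +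
        ‖f (x + a)‖ₑ ^ 6) + ENNReal.ofReal (1 + 2 * ‖a‖ ^ 2) * ‖f (x + a)‖ₑ ^ 2) +
        2 * ‖(‖x + a‖ • f (x + a))‖ₑ ^ 2 := fun x => by
    have hreal : jetWeight (jet a f x) ≤ (((((‖f x‖ ^ 2 + ‖(‖x‖ • f x)‖ ^ 2) +
        ‖weakGradient f x‖ ^ 2) + ‖f x‖ ^ 6) + ‖f (x + a)‖ ^ 6) +
        (1 + 2 * ‖a‖ ^ 2) * ‖f (x + a)‖ ^ 2) + 2 * ‖(‖x + a‖ • f (x + a))‖ ^ 2 := by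
      have h1 : ‖x‖ ≤ ‖x + a‖ + ‖a‖ := by simpa using norm_sub_le (x + a) a
      have h2 : ‖x‖ ^ 2 ≤ 2 * ‖x + a‖ ^ 2 + 2 * ‖a‖ ^ 2 := by
        nlinarith [norm_nonneg x, sq_nonneg (‖x + a‖ - ‖a‖)]
      have h3 := mul_le_mul_of_nonneg_right h2 (sq_nonneg ‖f (x + a)‖)
      simp only [jetWeight, jet, norm_smul, norm_norm]
      nlinarith
    refine (ENNReal.ofReal_le_ofReal hreal).trans (le_of_eq ?_)
    simp only [← ofReal_norm]
    rw [ENNReal.ofReal_add, ENNReal.ofReal_add, ENNReal.ofReal_add, ENNReal.ofReal_add,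
      ENNReal.ofReal_add, ENNReal.ofReal_add, ENNReal.ofReal_mul, ENNReal.ofReal_mul]
    · simp only [ENNReal.ofReal_pow (norm_nonneg _), ENNReal.ofReal_ofNat]
    all_goals positivity
  calc _ ≤ _ := lintegral_mono hpt
    _ = (((((∫⁻ x, ‖f x‖ₑ ^ 2) + ∫⁻ x, ‖(‖x‖ • f x)‖ₑ ^ 2) + ∫⁻ x, ‖weakGradient f x‖ₑ ^ 2) +
        ∫⁻ x, ‖f x‖ₑ ^ 6) + ∫⁻ x, ‖f (x + a)‖ₑ ^ 6) +
        ENNReal.ofReal (1 + 2 * ‖a‖ ^ 2) * (∫⁻ x, ‖f (x + a)‖ₑ ^ 2) +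
        2 * ∫⁻ x, ‖(‖x + a‖ • f (x + a))‖ₑ ^ 2 := by
      rw [lintegral_add_right' _ ((hma.pow_const 2).const_mul _),
        lintegral_add_right' _ ((hfa.pow_const 2).const_mul _),
        lintegral_add_right' _ (hfa.pow_const 6), lintegral_add_right' _ (hfm.pow_const 6),
        lintegral_add_right' _ (h.memLp_weakGradient.1.enorm.pow_const 2),
        lintegral_add_right' _ (h.moment.1.enorm.pow_const 2),
        lintegral_const_mul'' _ (hfa.pow_const 2), lintegral_const_mul'' _ (hma.pow_const 2)]
    _ ≤ sigmaNorm f ^ 2 + sigmaNorm f ^ 2 + sigmaNorm f ^ 2 + (sobolevConst * sigmaNorm f) ^ 6 +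
        (sobolevConst * sigmaNorm f) ^ 6 + ENNReal.ofReal (1 + 2 * ‖a‖ ^ 2) * sigmaNorm f ^ 2 +
        2 * sigmaNorm f ^ 2 := by gcongr
    _ = _ := by
      have : ENNReal.ofReal (6 + 2 * ‖a‖ ^ 2) = 5 + ENNReal.ofReal (1 + 2 * ‖a‖ ^ 2) := by
        rw [← ENNReal.ofReal_ofNat 5, ← ENNReal.ofReal_add (by norm_num) (by positivity)]
        ring_nf
      rw [this]; ring

theorem integrable_jetWeight (h : MemSigma f) (a : R3) :
    Integrable fun x => jetWeight (jet a f x) := by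
  refine ⟨continuous_jetWeight.comp_aestronglyMeasurable (h.aestronglyMeasurable_jet a), ?_⟩
  rw [hasFiniteIntegral_iff_ofReal (ae_of_all _ fun x => jetWeight_nonneg _)]
  refine (lintegral_jetWeight_le h a).trans_lt ?_
  have := h.sigmaNorm_lt_top
  exact ENNReal.add_lt_top.2 ⟨ENNReal.mul_lt_top ENNReal.ofReal_lt_top (ENNReal.pow_lt_top this),
    ENNReal.mul_lt_top (by simp) (ENNReal.pow_lt_top (ENNReal.mul_lt_top (by simp) this))⟩

theorem JetAdmissible.integrable (hΨ : JetAdmissible Ψ) (h : MemSigma f) (a : R3) :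
    Integrable fun x => Ψ (jet a f x) := by
  obtain ⟨C, k, hC, hk, hb⟩ := hΨ.bound
  exact (((integrable_jetWeight h a).const_mul C).add hk).mono'
    (hΨ.continuous.comp_aestronglyMeasurable (h.aestronglyMeasurable_jet a))
    (ae_of_all _ fun x => hb _)

theorem pow_add_le (a b : ℝ) (ha : 0 ≤ a) (hb : 0 ≤ b) :
    (a + b) ^ 2 ≤ 2 * (a ^ 2 + b ^ 2) ∧ (a + b) ^ 6 ≤ 32 * (a ^ 6 + b ^ 6) := by
  refine ⟨?_, ?_⟩
  · nlinarith [sq_nonneg (a - b)]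
  · have := add_pow_le ha hb 6
    norm_num at this
    exact this

/-- The statement is almost everywhere because the chosen gradient of f' - f equals the difference
of the gradients only up to a null set. The constant 32 = 2⁵ comes from the convexity of the sixth
power. -/
theorem jetWeight_le_add (h : MemSigma f) (h' : MemSigma f') (a : R3) : ∀ᵐ x,
    jetWeight (jet a f' x) ≤ 32 * (jetWeight (jet a f x) + jetWeight (jet a (f' - f) x)) := by
  filter_upwards [(h'.isWeakGradient.sub h.isWeakGradient).weakGradient_ae_eq] with x hx
  simp only [jetWeight, jet, hx, Pi.sub_apply]
  have t : ∀ {F : Type} [NormedAddCommGroup F] (y y' : F), ‖y'‖ ≤ ‖y‖ + ‖y' - y‖ := fun y y' => by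
    simpa using norm_add_le y (y' - y)
  have p2 : ∀ {F : Type} [NormedAddCommGroup F] (y y' : F),
      ‖y'‖ ^ 2 ≤ 2 * (‖y‖ ^ 2 + ‖y' - y‖ ^ 2) := fun y y' =>
    (pow_le_pow_left₀ (norm_nonneg _) (t y y') 2).trans
      (pow_add_le _ _ (norm_nonneg _) (norm_nonneg _)).1
  have p6 : ∀ {F : Type} [NormedAddCommGroup F] (y y' : F),
      ‖y'‖ ^ 6 ≤ 32 * (‖y‖ ^ 6 + ‖y' - y‖ ^ 6) := fun y y' =>
    (pow_le_pow_left₀ (norm_nonneg _) (t y y') 6).trans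
      (pow_add_le _ _ (norm_nonneg _) (norm_nonneg _)).2
  have a1 := p2 (f x) (f' x)
  have a2 := p2 (f (x + a)) (f' (x + a))
  have a3 := p2 (weakGradient f x) (weakGradient f' x)
  have a4 := p6 (f x) (f' x)
  have a5 := p6 (f (x + a)) (f' (x + a))
  have hw : 0 ≤ 1 + ‖x‖ ^ 2 := by positivity
  have a6 := mul_le_mul_of_nonneg_left (add_le_add a1 a2) hw
  have n1 : 0 ≤ (1 + ‖x‖ ^ 2) * (‖f x‖ ^ 2 + ‖f (x + a)‖ ^ 2) := by positivity
  have n2 : 0 ≤ (1 + ‖x‖ ^ 2) * (‖f' x - f x‖ ^ 2 + ‖f' (x + a) - f (x + a)‖ ^ 2) := by positivity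
  nlinarith [sq_nonneg ‖weakGradient f x‖, sq_nonneg ‖weakGradient f' x - weakGradient f x‖]

/-- Integrals of admissible functions of the jet are continuous on `Σ`. -/
theorem JetAdmissible.tendsto_integral [NormedSpace ℝ E] (hΨ : JetAdmissible Ψ) (a : R3)
    {ι : Type*} {l : Filter ι} [l.IsCountablyGenerated] {F : ι → R3 → ℂ} (h : MemSigma f)
    (hF : ∀ᶠ i in l, MemSigma (F i))
    (ht : Tendsto (fun i => sigmaNorm (F i - f)) l (𝓝 0)) :
    Tendsto (fun i => ∫ x, Ψ (jet a (F i) x)) l (𝓝 (∫ x, Ψ (jet a f x))) := by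
  classical
  obtain ⟨C, k, hC, hk, hb⟩ := hΨ.bound
  -- Convergence in Σ yields almost everywhere convergence of the jets only along subsequences, so
  -- each sequence of indices is refined twice: once for the values and once for the gradients.
  refine tendsto_of_subseq_tendsto fun ns hns => ?_
  obtain ⟨N, hN⟩ := (hns.eventually hF).exists_forall_of_atTop
  have hGs : Tendsto (fun n => n + N) atTop atTop := tendsto_add_atTop_nat N
  set G : ℕ → R3 → ℂ := fun n => F (ns (n + N)) with hG
  have hGm : ∀ n, MemSigma (G n) := fun n => hN _ (by omega)
  have htG : Tendsto (fun n => sigmaNorm (G n - f)) atTop (𝓝 0) := ht.comp (hns.comp hGs)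
  have t0 : Tendsto (fun n => eLpNorm (G n - f) 2 volume) atTop (𝓝 0) :=
    tendsto_of_tendsto_of_tendsto_of_le_of_le tendsto_const_nhds htG (fun _ => zero_le)
      fun _ => eLpNorm_le_sigmaNorm
  have t1 : Tendsto (fun n => eLpNorm (weakGradient (G n) - weakGradient f) 2 volume)
      atTop (𝓝 0) := by
    refine tendsto_of_tendsto_of_tendsto_of_le_of_le tendsto_const_nhds htG (fun _ => zero_le)
      fun n => ?_
    simp only
    rw [← eLpNorm_congr_ae ((hGm n).isWeakGradient.sub h.isWeakGradient).weakGradient_ae_eq]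
    exact eLpNorm_weakGradient_le_sigmaNorm
  obtain ⟨m1, hm1, hae1⟩ := exists_subseq_tendsto_ae (fun n => (hGm n).memLp.1) h.memLp.1 t0
  obtain ⟨m2, hm2, hae2⟩ := exists_subseq_tendsto_ae
    (fun n => (hGm (m1 n)).memLp_weakGradient.1) h.memLp_weakGradient.1
    (t1.comp hm1.tendsto_atTop)
  have hm : Tendsto (fun n => m1 (m2 n)) atTop atTop :=
    hm1.tendsto_atTop.comp hm2.tendsto_atTop
  refine ⟨fun n => m1 (m2 n) + N, ?_⟩
  set H : ℕ → R3 → ℂ := fun n => G (m1 (m2 n)) with hH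
  have hHm : ∀ n, MemSigma (H n) := fun n => hGm _
  have htH : Tendsto (fun n => sigmaNorm (H n - f)) atTop (𝓝 0) := htG.comp hm
  have mp := measurePreserving_add_right (volume : Measure R3) a
  have hjet : ∀ᵐ x, Tendsto (fun n => jet a (H n) x) atTop (𝓝 (jet a f x)) := by
    filter_upwards [hae1, mp.quasiMeasurePreserving.ae hae1, hae2] with x h1 h2 h3
    exact tendsto_const_nhds.prodMk_nhds ((h1.comp hm2.tendsto_atTop).prodMk_nhds
      ((h2.comp hm2.tendsto_atTop).prodMk_nhds h3))
  have hint := fun n => hΨ.integrable (hHm n) a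
  -- The difference is bounded by C times the weights of H n and f plus 2|k|. By `jetWeight_le_add`
  -- the weight of H n is at most 32 times those of f and H n - f, hence 33 C on the fixed part and
  -- 32 C on the vanishing part.
  have hlim := tendsto_lintegral_enorm_of_le_add (μ := (volume : Measure R3))
    (Y := fun n x => Ψ (jet a (H n) x) - Ψ (jet a f x))
    (B := fun x => ENNReal.ofReal (33 * C * jetWeight (jet a f x) + 2 * ‖k x‖))
    (b := fun n x => ENNReal.ofReal (32 * C) * ENNReal.ofReal (jetWeight (jet a (H n - f) x)))
    (fun n => ((hint n).1.sub (hΨ.integrable h a).1))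
    (fun n => (((integrable_jetWeight ((hHm n).sub h) a).1.aemeasurable).ennreal_ofReal).const_mul
      _) ?_ ?_ (fun n => ?_) ?_
  · refine tendsto_integral_of_L1 _ (hΨ.integrable h a).1 (Eventually.of_forall hint) hlim
  · exact ((((integrable_jetWeight h a).const_mul (33 * C)).add
      (hk.norm.const_mul 2)).lintegral_lt_top).ne
  · filter_upwards [hjet] with x hx
    have := ((hΨ.continuous.tendsto _).comp hx).sub_const (Ψ (jet a f x))
    simpa using this
  · filter_upwards [jetWeight_le_add h (hHm n) a] with x hx
    rw [← ENNReal.ofReal_mul (by positivity), ← ENNReal.ofReal_add, ← ofReal_norm]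
    · refine ENNReal.ofReal_le_ofReal ((norm_sub_le _ _).trans ?_)
      have b1 := hb (jet a (H n) x)
      have b2 := hb (jet a f x)
      have b3 := mul_le_mul_of_nonneg_left hx hC
      have b4 := Real.le_norm_self (k x)
      simp only [jet] at b1 b2 b3 ⊢
      linarith
    · have := jetWeight_nonneg (jet a f x); positivity
    · have := jetWeight_nonneg (jet a (H n - f) x); positivity
  · have hs : Tendsto (fun n => ENNReal.ofReal (32 * C) *
        (ENNReal.ofReal (6 + 2 * ‖a‖ ^ 2) * sigmaNorm (H n - f) ^ 2 +
        2 * (sobolevConst * sigmaNorm (H n - f)) ^ 6)) atTop (𝓝 0) := by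
      have c1 := ENNReal.Tendsto.const_mul (a := ENNReal.ofReal (6 + 2 * ‖a‖ ^ 2))
        (ENNReal.Tendsto.pow (n := 2) htH) (Or.inr ENNReal.ofReal_ne_top)
      have c2 := ENNReal.Tendsto.const_mul (a := 2) (ENNReal.Tendsto.pow (n := 6) (ENNReal.Tendsto.const_mul
        (a := (sobolevConst : ENNReal)) htH (Or.inr ENNReal.coe_ne_top)))
        (Or.inr (by norm_num))
      have := ENNReal.Tendsto.const_mul (a := ENNReal.ofReal (32 * C)) (c1.add c2)
        (Or.inr ENNReal.ofReal_ne_top)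
      simpa using this
    refine tendsto_of_tendsto_of_tendsto_of_le_of_le tendsto_const_nhds hs (fun _ => zero_le)
      fun n => ?_
    simp only
    rw [lintegral_const_mul'' _ ((integrable_jetWeight ((hHm n).sub h)
      a).1.aemeasurable.ennreal_ofReal)]
    gcongr
    exact lintegral_jetWeight_le ((hHm n).sub h) a

end Jets

/-! ### The chain rule in Σ -/

section ChainRule

variable {f : R3 → ℂ} {F : ℂ → ℂ} {C : ℝ}

theorem norm_le_of_fderiv_le (hF : ContDiff ℝ 1 F) (hC : ∀ z, ‖fderiv ℝ F z‖ ≤ C) (h0 : F 0 = 0)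
    (z : ℂ) : ‖F z‖ ≤ C * ‖z‖ := by
  have := convex_univ.norm_image_sub_le_of_norm_fderiv_le (𝕜 := ℝ) (f := F) (C := C)
    (fun z _ => hF.differentiable (by simp) z) (fun z _ => hC z) (Set.mem_univ 0) (Set.mem_univ z)
  simpa [h0] using this

theorem IsTest.integral_comp_mul_fderiv {φ ψ : R3 → ℂ} (hφ : IsTest φ) (hψ : IsTest ψ)
    (hF : ContDiff ℝ 1 F) (j : Fin 3) :
    ∫ x, F (φ x) * fderiv ℝ ψ x (EuclideanSpace.single j 1) =
      -∫ x, fderiv ℝ F (φ x) (fderiv ℝ φ x (EuclideanSpace.single j 1)) * ψ x := by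
  have hFφ : ContDiff ℝ 1 (fun x => F (φ x)) := hF.comp (hφ.1.of_le (by simp))
  have hd : ∀ x, fderiv ℝ (fun x => F (φ x)) x (EuclideanSpace.single j 1) =
      fderiv ℝ F (φ x) (fderiv ℝ φ x (EuclideanSpace.single j 1)) := fun x => by
    have := ((hF.differentiable (by simp) (φ x)).hasFDerivAt.comp x
      (hφ.1.differentiable (by simp) x).hasFDerivAt).fderiv
    rw [show (fun x => F (φ x)) = F ∘ φ from rfl, this]; rfl
  simp only [← hd]
  refine integral_mul_fderiv_eq_neg_fderiv_mul_of_integrable ?_ ?_ ?_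
      (fun x _ => hFφ.differentiable (by simp) x) fun x _ => hψ.1.differentiable (by simp) x
  · exact integrable_mul_of_hasCompactSupport ((hFφ.continuous_fderiv (by simp)).clm_apply
      continuous_const).locallyIntegrable hψ.continuous hψ.2
  · exact integrable_mul_of_hasCompactSupport hFφ.continuous.locallyIntegrable
      (hψ.fderiv_apply _).continuous (hψ.fderiv_apply _).2
  · exact integrable_mul_of_hasCompactSupport hFφ.continuous.locallyIntegrable hψ.continuous hψ.2

theorem IsTest.integrable_sq {ψ : R3 → ℂ} (hψ : IsTest ψ) : Integrable fun x => ‖ψ x‖ ^ 2 :=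
  (memLp_two_iff_integrable_sq_norm hψ.continuous.aestronglyMeasurable).1 (hψ.memLp 2)

theorem sq_le_jetWeight (q : Jet) : ‖q.2.1‖ ^ 2 + ‖q.2.2.2‖ ^ 2 ≤ jetWeight q := by
  have h1 : 0 ≤ ‖q.1‖ ^ 2 * (‖q.2.1‖ ^ 2 + ‖q.2.2.1‖ ^ 2) := by positivity
  have h2 : 0 ≤ ‖q.2.1‖ ^ 6 + ‖q.2.2.1‖ ^ 6 + ‖q.2.2.1‖ ^ 2 := by positivity
  unfold jetWeight
  linarith

theorem norm_mul_le_jetWeight {A B : ℂ} {q : Jet} (hC0 : 0 ≤ C)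
    (hA : ‖A‖ ≤ C * ‖q.2.1‖ ∨ ‖A‖ ≤ C * ‖q.2.2.2‖) :
    ‖A * B‖ ≤ C * jetWeight q + C * ‖B‖ ^ 2 := by
  have hw := sq_le_jetWeight q
  have key : ∀ r : ℝ, 0 ≤ r → r ^ 2 ≤ jetWeight q → ‖A‖ ≤ C * r →
      ‖A * B‖ ≤ C * jetWeight q + C * ‖B‖ ^ 2 := fun r hr h1 h2 => by
    rw [norm_mul]
    calc ‖A‖ * ‖B‖ ≤ C * r * ‖B‖ := by gcongr
      _ ≤ C * (r ^ 2 + ‖B‖ ^ 2) := by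
        rw [mul_assoc]
        exact mul_le_mul_of_nonneg_left (by nlinarith [norm_nonneg B, sq_nonneg (r - ‖B‖)]) hC0
      _ ≤ C * (jetWeight q + ‖B‖ ^ 2) := by gcongr
      _ = _ := by ring
  rcases hA with h | h
  · exact key _ (norm_nonneg _) (by nlinarith [sq_nonneg ‖q.2.2.2‖]) h
  · exact key _ (norm_nonneg _) (by nlinarith [sq_nonneg ‖q.2.1‖]) h

theorem MemSigma.weakGradient_comp_memLp (h : MemSigma f) (hF : ContDiff ℝ 1 F)
    (hC : ∀ z, ‖fderiv ℝ F z‖ ≤ C) :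
    MemLp (fun x => (WithLp.toLp 2 fun j => fderiv ℝ F (f x) (DampedNLS.weakGradient f x j) :
      EuclideanSpace ℂ (Fin 3))) 2 volume := by
  refine memLp_toLp fun j => ?_
  have hg := MemLp.component h.memLp_weakGradient j
  refine (hg.norm.const_mul C).mono' ?_ (ae_of_all _ fun x => ?_)
  · have hc : Continuous fun p : ℂ × ℂ => fderiv ℝ F p.1 p.2 :=
      ((hF.continuous_fderiv (by simp)).comp continuous_fst).clm_apply continuous_snd
    exact hc.comp_aestronglyMeasurable (h.memLp.1.prodMk hg.1)
  · exact ((fderiv ℝ F (f x)).le_opNorm _).trans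
      (mul_le_mul_of_nonneg_right (hC _) (norm_nonneg _))

/-- Chain rule for weak gradients. -/
theorem MemSigma.isWeakGradient_comp (h : MemSigma f) (hF : ContDiff ℝ 1 F)
    (hC : ∀ z, ‖fderiv ℝ F z‖ ≤ C) (h0 : F 0 = 0) :
    IsWeakGradient (fun x => F (f x))
      (fun x => WithLp.toLp 2 fun j => fderiv ℝ F (f x) (DampedNLS.weakGradient f x j)) := by
  have hC0 : 0 ≤ C := (norm_nonneg _).trans (hC 0)
  have hFz := norm_le_of_fderiv_le hF hC h0
  have hFf : MemLp (fun x => F (f x)) 2 volume :=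
    (h.memLp.norm.const_mul C).mono' (hF.continuous.comp_aestronglyMeasurable h.memLp.1)
      (ae_of_all _ fun x => hFz _)
  refine .of_memLp hFf (h.weakGradient_comp_memLp hF hC) fun ψ hψ j => ?_
  obtain ⟨φ, hφ, ht⟩ := h.exists_seq_isTest
  have hdψ := hψ.fderiv_apply (EuclideanSpace.single j 1)
  -- Both sides of the identity to be proved are integrals of admissible functions of the jet, the
  -- test function ψ entering through the integrable term k of the bound. They are therefore
  -- continuous on Σ, and it suffices to know the identity for test functions.
  have a1 : JetAdmissible fun q : Jet => F q.2.1 * fderiv ℝ ψ q.1 (EuclideanSpace.single j 1) := by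
    refine ⟨?_, C, fun x => C * ‖fderiv ℝ ψ x (EuclideanSpace.single j 1)‖ ^ 2, hC0,
      hdψ.integrable_sq.const_mul C, fun q => norm_mul_le_jetWeight hC0 (Or.inl (hFz _))⟩
    exact (hF.continuous.comp (by fun_prop)).mul (hdψ.continuous.comp continuous_fst)
  have a2 : JetAdmissible fun q : Jet => fderiv ℝ F q.2.1 (q.2.2.2 j) * ψ q.1 := by
    refine ⟨?_, C, fun x => C * ‖ψ x‖ ^ 2, hC0, hψ.integrable_sq.const_mul C, fun q =>
      norm_mul_le_jetWeight hC0 (Or.inr ?_)⟩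
    · refine Continuous.mul ?_ (hψ.continuous.comp continuous_fst)
      exact ((hF.continuous_fderiv (by simp)).comp (by fun_prop)).clm_apply (by fun_prop)
    · exact ((fderiv ℝ F q.2.1).le_opNorm _).trans (mul_le_mul (hC _)
        (PiLp.norm_apply_le _ j) (norm_nonneg _) hC0)
  have t1 := a1.tendsto_integral 0 h (Eventually.of_forall fun n => (hφ n).memSigma) ht
  have t2 := a2.tendsto_integral 0 h (Eventually.of_forall fun n => (hφ n).memSigma) ht
  refine tendsto_nhds_unique t1 (t2.neg.congr fun n => ?_)
  simp only [jet]
  rw [(hφ n).integral_comp_mul_fderiv hψ hF j]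
  congr 1
  refine integral_congr_ae ?_
  filter_upwards [(hφ n).isWeakGradient.weakGradient_ae_eq] with x hx
  rw [hx]

theorem MemSigma.comp (h : MemSigma f) (hF : ContDiff ℝ 1 F)
    (hC : ∀ z, ‖fderiv ℝ F z‖ ≤ C) (h0 : F 0 = 0) : MemSigma (fun x => F (f x)) := by
  have hFz := norm_le_of_fderiv_le hF hC h0
  have hm : AEStronglyMeasurable (fun x => F (f x)) volume :=
    hF.continuous.comp_aestronglyMeasurable h.memLp.1
  refine ⟨(h.memLp.norm.const_mul C).mono' hm (ae_of_all _ fun x => hFz _),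
    ⟨_, h.isWeakGradient_comp hF hC h0, h.weakGradient_comp_memLp hF hC⟩, ?_⟩
  refine (h.moment.norm.const_mul C).mono' (continuous_norm.aestronglyMeasurable.smul hm)
    (ae_of_all _ fun x => ?_)
  simp only [norm_smul, norm_norm]
  nlinarith [hFz (f x), norm_nonneg x]

end ChainRule

/-! ### Difference quotients and their L² limits -/

section DiffQuot

variable {f : R3 → ℂ}

theorem single_eq_smul (j : Fin 3) (r : ℝ) :
    (EuclideanSpace.single j r : R3) = r • EuclideanSpace.single j (1 : ℝ) := by
  ext i; simp

theorem continuous_single (j : Fin 3) :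
    Continuous fun s : ℝ => (EuclideanSpace.single j s : R3) := by
  have : (fun s : ℝ => (EuclideanSpace.single j s : R3)) =
      fun s => s • EuclideanSpace.single j (1 : ℝ) := funext (single_eq_smul j)
  rw [this]
  fun_prop

/-- Difference quotient in the `j`-th coordinate direction. -/
def diffQuot (h : ℝ) (j : Fin 3) (f : R3 → ℂ) (x : R3) : ℂ :=
  (h : ℂ)⁻¹ * (f (x + EuclideanSpace.single j h) - f x)

/-- By the fundamental theorem of calculus a difference quotient is the average of the derivative
over the segment. Its error is thus an average of translation errors, to which Jensen's inequality
applies. -/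
theorem IsTest.diffQuot_sub_eq {φ : R3 → ℂ} (hφ : IsTest φ) {h : ℝ} (hh : h ≠ 0) (j : Fin 3)
    (x : R3) : diffQuot h j φ x - fderiv ℝ φ x (EuclideanSpace.single j 1) =
      ∫ s in Set.Ioc (0 : ℝ) 1, (fderiv ℝ φ (x + EuclideanSpace.single j (s * h))
        (EuclideanSpace.single j 1) - fderiv ℝ φ x (EuclideanSpace.single j 1)) := by
  have hc : Continuous fun s : ℝ => fderiv ℝ φ (x + EuclideanSpace.single j (s * h))
      (EuclideanSpace.single j 1) := by
    exact (hφ.fderiv_apply _).continuous.comp (continuous_const.add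
      ((continuous_single j).comp (continuous_id.mul continuous_const)))
  have hd : ∀ s : ℝ, HasDerivAt (fun s : ℝ => φ (x + EuclideanSpace.single j (s * h)))
      ((h : ℂ) * fderiv ℝ φ (x + EuclideanSpace.single j (s * h)) (EuclideanSpace.single j 1)) s :=
      fun s => by
    have h1 : HasDerivAt (fun s : ℝ => x + EuclideanSpace.single j (s * h))
        (EuclideanSpace.single j h : R3) s := by
      have : HasDerivAt (fun s : ℝ => x + (s * h) • (EuclideanSpace.single j (1 : ℝ) : R3))
          ((1 * h) • (EuclideanSpace.single j (1 : ℝ) : R3)) s :=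
        (((hasDerivAt_id s).mul_const h).smul_const _).const_add x
      simpa only [← single_eq_smul, one_mul] using this
    have h2 := (hφ.1.differentiable (by simp) (x + EuclideanSpace.single j
      (s * h))).hasFDerivAt.comp_hasDerivAt s h1
    rw [single_eq_smul j h, map_smul] at h2
    simpa [Function.comp_def] using h2
  have e := intervalIntegral.integral_eq_sub_of_hasDerivAt (a := 0) (b := 1) (fun s _ => hd s)
    ((continuous_const.mul hc).intervalIntegrable _ _)
  rw [← intervalIntegral.integral_of_le zero_le_one, intervalIntegral.integral_sub
    (hc.intervalIntegrable _ _) (continuous_const.intervalIntegrable _ _)]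
  rw [intervalIntegral.integral_const_mul] at e
  have hh' : (h : ℂ) ≠ 0 := by exact_mod_cast hh
  have hz : (EuclideanSpace.single j (0 : ℝ) : R3) = 0 := by simp
  simp only [one_mul, zero_mul, hz, add_zero] at e
  rw [diffQuot, ← e]
  field_simp
  simp [mul_comm]

theorem IsTest.eLpNorm_diffQuot_sub_le {φ : R3 → ℂ} (hφ : IsTest φ) {h : ℝ} (hh : h ≠ 0)
    (j : Fin 3) {ε : ENNReal} (hε : ∀ s : ℝ, |s| ≤ |h| →
      eLpNorm (fun x => fderiv ℝ φ (x + EuclideanSpace.single j s) (EuclideanSpace.single j 1) -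
        fderiv ℝ φ x (EuclideanSpace.single j 1)) 2 volume ≤ ε) :
    eLpNorm (fun x => diffQuot h j φ x - fderiv ℝ φ x (EuclideanSpace.single j 1)) 2 volume
      ≤ ε := by
  have : IsProbabilityMeasure (volume.restrict (Set.Ioc (0 : ℝ) 1)) := ⟨by simp⟩
  have hc := (hφ.fderiv_apply (EuclideanSpace.single j 1)).continuous
  have h1 := lintegral_enorm_integral_sq_le (μ := (volume : Measure R3))
    (ν := volume.restrict (Set.Ioc (0 : ℝ) 1))
    (k := fun x s => fderiv ℝ φ (x + EuclideanSpace.single j (s * h)) (EuclideanSpace.single j 1) -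
      fderiv ℝ φ x (EuclideanSpace.single j 1)) (by
      refine Continuous.aestronglyMeasurable ?_
      exact (hc.comp (continuous_fst.add ((continuous_single j).comp
        (continuous_snd.mul continuous_const)))).sub (hc.comp continuous_fst))
  simp only [← hφ.diffQuot_sub_eq hh, ← eLpNorm_two_sq] at h1
  refine (ENNReal.pow_le_pow_left_iff (n := 2) (by norm_num)).1 (h1.trans ?_)
  calc _ ≤ ∫⁻ _s in Set.Ioc (0 : ℝ) 1, ε ^ 2 := by
        refine setLIntegral_mono measurable_const fun s hs => ?_
        gcongr
        refine hε _ ?_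
        rw [abs_mul, abs_of_pos hs.1]
        exact mul_le_of_le_one_left (abs_nonneg _) hs.2
    _ = ε ^ 2 := by simp

/-- The bound for test functions φ n → f is transferred by density. Replacing f by φ n in the
difference quotient costs a factor 1/|h|, which is harmless because h is fixed while n → ∞. -/
theorem MemSigma.eLpNorm_diffQuot_sub_le (hf : MemSigma f) {h : ℝ} (hh : h ≠ 0)
    (j : Fin 3) {ε : ENNReal} (hε : ∀ s : ℝ, |s| ≤ |h| →
      eLpNorm (fun x => DampedNLS.weakGradient f (x + EuclideanSpace.single j s) j -
        DampedNLS.weakGradient f x j) 2 volume ≤ ε) :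
    eLpNorm (fun x => diffQuot h j f x - DampedNLS.weakGradient f x j) 2 volume ≤ ε := by
  obtain ⟨φ, hφ, ht⟩ := hf.exists_seq_isTest
  have mp := fun a => measurePreserving_add_right (volume : Measure R3) a
  set η := fun n => sigmaNorm (φ n - f) with hη
  have e0 : ∀ n, eLpNorm (fun x => φ n x - f x) 2 volume ≤ η n := fun n => eLpNorm_le_sigmaNorm
  have m0 : ∀ n, AEStronglyMeasurable (fun x => φ n x - f x) volume := fun n =>
    (hφ n).continuous.aestronglyMeasurable.sub hf.memLp.1
  have m1 : ∀ n, AEStronglyMeasurable (fun x => fderiv ℝ (φ n) x (EuclideanSpace.single j 1) -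
      DampedNLS.weakGradient f x j) volume := fun n =>
    ((hφ n).fderiv_apply _).continuous.aestronglyMeasurable.sub
      (MemLp.component hf.memLp_weakGradient j).1
  have e1 : ∀ n, eLpNorm (fun x => fderiv ℝ (φ n) x (EuclideanSpace.single j 1) -
      DampedNLS.weakGradient f x j) 2 volume ≤ η n := fun n => by
    refine le_trans ?_ eLpNorm_weakGradient_le_sigmaNorm
    refine eLpNorm_mono_ae ?_
    filter_upwards [((hφ n).isWeakGradient.sub hf.isWeakGradient).weakGradient_ae_eq] with x hx
    rw [hx]
    exact PiLp.norm_apply_le (p := 2) (((fun x => WithLp.toLp 2 fun j => fderiv ℝ (φ n) x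
      (EuclideanSpace.single j 1)) - DampedNLS.weakGradient f) x) j
  have md : AEStronglyMeasurable (fun x => DampedNLS.weakGradient f x j) volume :=
    (MemLp.component hf.memLp_weakGradient j).1
  have b1 : ∀ n, eLpNorm (fun x => diffQuot h j (φ n) x -
      fderiv ℝ (φ n) x (EuclideanSpace.single j 1)) 2 volume ≤ η n + ε + η n := fun n => by
    refine (hφ n).eLpNorm_diffQuot_sub_le hh j fun s hs => ?_
    have e : (fun x => fderiv ℝ (φ n) (x + EuclideanSpace.single j s) (EuclideanSpace.single j 1) -
        fderiv ℝ (φ n) x (EuclideanSpace.single j 1)) =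
        (((fun x => fderiv ℝ (φ n) x (EuclideanSpace.single j 1) - DampedNLS.weakGradient f x j) ∘
          fun x => x + EuclideanSpace.single j s) + fun x =>
          DampedNLS.weakGradient f (x + EuclideanSpace.single j s) j - DampedNLS.weakGradient f x j) -
        fun x => fderiv ℝ (φ n) x (EuclideanSpace.single j 1) - DampedNLS.weakGradient f x j := by
      ext x; simp
    have mc := (m1 n).comp_measurePreserving (mp (EuclideanSpace.single j s))
    have md2 := (md.comp_measurePreserving (mp (EuclideanSpace.single j s))).sub md
    rw [e]
    refine (eLpNorm_sub_le (mc.add md2) (m1 n) (by norm_num)).trans (add_le_add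
      ((eLpNorm_add_le mc md2 (by norm_num)).trans (add_le_add ?_ (hε s hs))) (e1 n))
    rw [eLpNorm_comp_measurePreserving (m1 n) (mp _)]
    exact e1 n
  set K : ENNReal := ‖(h : ℂ)⁻¹‖ₑ with hK
  have b2 : ∀ n, eLpNorm (fun x => diffQuot h j f x - DampedNLS.weakGradient f x j) 2 volume ≤
      (η n + ε + η n) + η n + K * (η n + η n) := fun n => by
    have mc := (m0 n).comp_measurePreserving (mp (EuclideanSpace.single j h))
    have e : (fun x => diffQuot h j f x - DampedNLS.weakGradient f x j) =
        ((fun x => diffQuot h j (φ n) x - fderiv ℝ (φ n) x (EuclideanSpace.single j 1)) +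
        fun x => fderiv ℝ (φ n) x (EuclideanSpace.single j 1) - DampedNLS.weakGradient f x j) -
        (h : ℂ)⁻¹ • (((fun x => φ n x - f x) ∘ fun x => x + EuclideanSpace.single j h) -
          fun x => φ n x - f x) := by
      ext x; simp [diffQuot]; ring
    have m2 : AEStronglyMeasurable (fun x => diffQuot h j (φ n) x -
        fderiv ℝ (φ n) x (EuclideanSpace.single j 1)) volume := by
      refine AEStronglyMeasurable.sub ?_ ((hφ n).fderiv_apply _).continuous.aestronglyMeasurable
      exact (continuous_const.mul (((hφ n).comp_add _).continuous.sub
        (hφ n).continuous)).aestronglyMeasurable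
    rw [e]
    refine (eLpNorm_sub_le (m2.add (m1 n)) ((mc.sub (m0 n)).const_smul _) (by norm_num)).trans
      (add_le_add ((eLpNorm_add_le m2 (m1 n) (by norm_num)).trans (add_le_add (b1 n) (e1 n))) ?_)
    rw [eLpNorm_const_smul]
    gcongr
    refine (eLpNorm_sub_le mc (m0 n) (by norm_num)).trans (add_le_add ?_ (e0 n))
    rw [eLpNorm_comp_measurePreserving (m0 n) (mp _)]
    exact e0 n
  have hlim : Tendsto (fun n => (η n + ε + η n) + η n + K * (η n + η n)) atTop
      (𝓝 ((0 + ε + 0) + 0 + K * (0 + 0))) :=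
    (((ht.add tendsto_const_nhds).add ht).add ht).add
      (ENNReal.Tendsto.const_mul (ht.add ht) (Or.inr enorm_ne_top))
  simp only [add_zero, zero_add, mul_zero] at hlim
  exact ge_of_tendsto' hlim b2

/-- Difference quotients of a `Σ` function converge to its partial derivatives in `L²`. -/
theorem MemSigma.tendsto_diffQuot (hf : MemSigma f) (j : Fin 3) :
    Tendsto (fun h : ℝ => eLpNorm (fun x => diffQuot h j f x - DampedNLS.weakGradient f x j) 2 volume)
      (𝓝[≠] 0) (𝓝 0) := by
  rw [ENNReal.tendsto_nhds_zero]
  intro ε hε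
  have hc : Tendsto (fun s : ℝ => (EuclideanSpace.single j s : R3)) (𝓝 0) (𝓝 0) :=
    (continuous_single j).tendsto' 0 0 (by simp)
  have t := ((tendsto_eLpNorm_translate_sub (MemLp.component hf.memLp_weakGradient j)).comp
    hc).eventually (gt_mem_nhds hε)
  obtain ⟨r, hr, hr'⟩ := Metric.eventually_nhds_iff.1 t
  have hball : ∀ᶠ h : ℝ in 𝓝[≠] 0, |h| < r := by
    refine eventually_nhdsWithin_of_eventually_nhds ?_
    filter_upwards [Metric.ball_mem_nhds (0 : ℝ) hr] with h hh
    simpa using hh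
  filter_upwards [hball, self_mem_nhdsWithin] with h h1 h2
  refine hf.eLpNorm_diffQuot_sub_le h2 j fun s hs => ?_
  exact (hr' (y := s) (by simpa using hs.trans_lt h1)).le

end DiffQuot

/-! ### The weak form of the spatial operator -/

section Pairing

variable {f f' v v' : R3 → ℂ} {w : Fin 3 → ℝ} {lam σ : ℝ}

theorem enorm_integral_mul_le (hf : AEStronglyMeasurable f volume)
    (hv : AEStronglyMeasurable v volume) :
    ‖∫ x, f x * v x‖ₑ ≤ eLpNorm f 2 volume * eLpNorm v 2 volume := by
  refine (enorm_integral_le_lintegral_enorm _).trans ?_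
  rw [← eLpNorm_one_eq_lintegral_enorm]
  have h := eLpNorm_smul_le_mul_eLpNorm (p := 2) (q := 2) (r := 1) hv hf
  rw [smul_eq_mul] at h
  exact h

/-- Integrand of the weak form of `-½ Δ f + N(f)` tested with `v`. -/
def weakDensity (w : Fin 3 → ℝ) (lam σ : ℝ) (f v : R3 → ℂ) (x : R3) : ℂ :=
  (1 / 2) * ∑ j, weakGradient f x j * weakGradient v x j + lowerOrder w lam σ f x * v x

/-- The weak form of `-½ Δ f + N(f)` tested with `v`. -/
def weakForm (w : Fin 3 → ℝ) (lam σ : ℝ) (f v : R3 → ℂ) : ℂ := ∫ x, weakDensity w lam σ f v x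

theorem confinement_nonneg (w : Fin 3 → ℝ) (x : R3) : 0 ≤ confinement w x := by
  unfold confinement; positivity

theorem continuous_confinement (w : Fin 3 → ℝ) : Continuous (confinement w) := by
  unfold confinement; fun_prop

theorem confinement_le (w : Fin 3 → ℝ) (x : R3) :
    confinement w x ≤ (∑ j, w j ^ 2) * ‖x‖ ^ 2 := by
  unfold confinement
  have h : ∀ j, x j ^ 2 ≤ ‖x‖ ^ 2 := fun j => by
    rw [← sq_abs, ← Real.norm_eq_abs]
    exact pow_le_pow_left₀ (norm_nonneg _) (PiLp.norm_apply_le x j) 2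
  have h2 : ∑ j, w j ^ 2 * x j ^ 2 ≤ (∑ j, w j ^ 2) * ‖x‖ ^ 2 := by
    rw [Finset.sum_mul]
    exact Finset.sum_le_sum fun j _ => mul_le_mul_of_nonneg_left (h j) (sq_nonneg _)
  have h3 : 0 ≤ ∑ j, w j ^ 2 * x j ^ 2 := by positivity
  linarith

theorem norm_lowerOrder_le (w : Fin 3 → ℝ) (lam σ : ℝ) (f : R3 → ℂ) (x : R3) :
    ‖lowerOrder w lam σ f x‖ ≤
      (∑ j, w j ^ 2) * ‖x‖ ^ 2 * ‖f x‖ + |lam| * ‖f x‖ ^ 3 + |σ| * ‖f x‖ ^ 5 := by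
  unfold lowerOrder
  refine (norm_sub_le _ _).trans (add_le_add ((norm_add_le _ _).trans (add_le_add ?_ ?_)) ?_)
  · rw [norm_mul, Complex.norm_real, Real.norm_of_nonneg (confinement_nonneg w x)]
    exact mul_le_mul_of_nonneg_right (confinement_le w x) (norm_nonneg _)
  · simp only [norm_mul, Complex.norm_real, norm_pow, Real.norm_eq_abs, abs_norm]
    exact le_of_eq (by ring)
  · simp only [norm_mul, Complex.norm_real, norm_pow, Real.norm_eq_abs, abs_norm, Complex.norm_I]
    exact le_of_eq (by ring)

theorem pow_mul_le_add (a b : ℝ) (ha : 0 ≤ a) (hb : 0 ≤ b) :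
    a ^ 3 * b ≤ a ^ 6 + b ^ 2 ∧ a ^ 5 * b ≤ a ^ 6 + b ^ 6 := by
  refine ⟨?_, ?_⟩
  · nlinarith [sq_nonneg (a ^ 3 - b), sq_nonneg (a ^ 3), sq_nonneg b]
  · rcases le_total a b with h | h
    · have : a ^ 5 * b ≤ b ^ 5 * b := by gcongr
      nlinarith [pow_nonneg ha 6]
    · have : a ^ 5 * b ≤ a ^ 5 * a := by gcongr
      nlinarith [pow_nonneg hb 6]

/-- Young's inequality separates f from v using only the powers that Σ controls: the cubic term by
|f|³|v| ≤ |f|⁶ + |v|², the quintic one by |f|⁵|v| ≤ |f|⁶ + |v|⁶, and the potential by |x|²(|f|² +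
|v|²). -/
theorem norm_weakDensity_le (w : Fin 3 → ℝ) (lam σ : ℝ) (f v : R3 → ℂ) (x : R3) :
    ‖weakDensity w lam σ f v x‖ ≤ (3 + (∑ j, w j ^ 2) + |lam| + |σ|) *
      (jetWeight (jet 0 f x) + jetWeight (jet 0 v x)) := by
  have h1 : ‖(1 / 2 : ℂ) * ∑ j, weakGradient f x j * weakGradient v x j‖ ≤
      3 * (‖weakGradient f x‖ ^ 2 + ‖weakGradient v x‖ ^ 2) := by
    rw [norm_mul]
    have h2 : ‖∑ j, weakGradient f x j * weakGradient v x j‖ ≤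
        ∑ _j : Fin 3, ‖weakGradient f x‖ * ‖weakGradient v x‖ := by
      refine (norm_sum_le _ _).trans (Finset.sum_le_sum fun j _ => ?_)
      rw [norm_mul]
      exact mul_le_mul (PiLp.norm_apply_le _ j) (PiLp.norm_apply_le _ j) (norm_nonneg _)
        (norm_nonneg _)
    have h3 : ‖(1 / 2 : ℂ)‖ ≤ 1 := by norm_num
    have h4 : ∑ _j : Fin 3, ‖weakGradient f x‖ * ‖weakGradient v x‖ =
      3 * (‖weakGradient f x‖ * ‖weakGradient v x‖) := by simp
    have h5 : ‖weakGradient f x‖ * ‖weakGradient v x‖ ≤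
        ‖weakGradient f x‖ ^ 2 + ‖weakGradient v x‖ ^ 2 := by
      nlinarith [sq_nonneg (‖weakGradient f x‖ - ‖weakGradient v x‖),
        sq_nonneg ‖weakGradient f x‖, sq_nonneg ‖weakGradient v x‖]
    calc _ ≤ 1 * (3 * (‖weakGradient f x‖ * ‖weakGradient v x‖)) :=
          mul_le_mul h3 (h2.trans h4.le) (norm_nonneg _) zero_le_one
      _ ≤ _ := by linarith
  have hW : 0 ≤ ∑ j, w j ^ 2 := by positivity
  set W := ∑ j, w j ^ 2
  obtain ⟨p3, p5⟩ := pow_mul_le_add ‖f x‖ ‖v x‖ (norm_nonneg _) (norm_nonneg _)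
  have p1 : ‖f x‖ * ‖v x‖ ≤ ‖f x‖ ^ 2 + ‖v x‖ ^ 2 := by
    nlinarith [sq_nonneg (‖f x‖ - ‖v x‖), sq_nonneg ‖f x‖, sq_nonneg ‖v x‖]
  have h6 : ‖lowerOrder w lam σ f x * v x‖ ≤ W * (‖x‖ ^ 2 * (‖f x‖ ^ 2 + ‖v x‖ ^ 2)) +
      |lam| * (‖f x‖ ^ 6 + ‖v x‖ ^ 2) + |σ| * (‖f x‖ ^ 6 + ‖v x‖ ^ 6) := by
    rw [norm_mul]
    calc _ ≤ (W * ‖x‖ ^ 2 * ‖f x‖ + |lam| * ‖f x‖ ^ 3 + |σ| * ‖f x‖ ^ 5) * ‖v x‖ :=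
          mul_le_mul_of_nonneg_right (norm_lowerOrder_le w lam σ f x) (norm_nonneg _)
      _ = W * (‖x‖ ^ 2 * (‖f x‖ * ‖v x‖)) + |lam| * (‖f x‖ ^ 3 * ‖v x‖) +
          |σ| * (‖f x‖ ^ 5 * ‖v x‖) := by ring
      _ ≤ _ := by gcongr
  have hq : ‖weakGradient f x‖ ^ 2 + ‖x‖ ^ 2 * ‖f x‖ ^ 2 + ‖f x‖ ^ 6 ≤ jetWeight (jet 0 f x) := by
    simp only [jetWeight, jet]
    have := norm_nonneg (f x)
    have h7 : 0 ≤ ‖f x‖ ^ 2 + (1 + ‖x‖ ^ 2) * ‖f (x + 0)‖ ^ 2 + ‖f (x + 0)‖ ^ 6 := by positivity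
    nlinarith
  have hr : ‖weakGradient v x‖ ^ 2 + ‖v x‖ ^ 2 + ‖x‖ ^ 2 * ‖v x‖ ^ 2 + ‖v x‖ ^ 6 ≤
      jetWeight (jet 0 v x) := by
    simp only [jetWeight, jet]
    have h7 : 0 ≤ (1 + ‖x‖ ^ 2) * ‖v (x + 0)‖ ^ 2 + ‖v (x + 0)‖ ^ 6 := by positivity
    nlinarith
  set A := jetWeight (jet 0 f x)
  set B := jetWeight (jet 0 v x)
  have n1 := sq_nonneg ‖weakGradient f x‖
  have n2 := sq_nonneg ‖weakGradient v x‖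
  have n3 : 0 ≤ ‖x‖ ^ 2 * ‖f x‖ ^ 2 := by positivity
  have n4 : 0 ≤ ‖x‖ ^ 2 * ‖v x‖ ^ 2 := by positivity
  have n5 : 0 ≤ ‖f x‖ ^ 6 := by positivity
  have n6 : 0 ≤ ‖v x‖ ^ 6 := by positivity
  have n7 := sq_nonneg ‖v x‖
  calc _ ≤ 3 * (‖weakGradient f x‖ ^ 2 + ‖weakGradient v x‖ ^ 2) +
        (W * (‖x‖ ^ 2 * (‖f x‖ ^ 2 + ‖v x‖ ^ 2)) +
      |lam| * (‖f x‖ ^ 6 + ‖v x‖ ^ 2) + |σ| * (‖f x‖ ^ 6 + ‖v x‖ ^ 6)) :=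
        (norm_add_le _ _).trans (add_le_add h1 h6)
    _ ≤ 3 * (A + B) + (W * (A + B) + |lam| * (A + B) + |σ| * (A + B)) := by
        gcongr <;> linarith
    _ = _ := by ring

theorem MemSigma.aestronglyMeasurable_lowerOrder (h : MemSigma f) :
    AEStronglyMeasurable (lowerOrder w lam σ f) volume := by
  have hc : Continuous fun q : R3 × ℂ => (confinement w q.1 : ℂ) * q.2 +
      (lam : ℂ) * (‖q.2‖ : ℂ) ^ 2 * q.2 - Complex.I * (σ : ℂ) * (‖q.2‖ : ℂ) ^ 4 * q.2 := by
    have := continuous_confinement w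
    fun_prop
  have hp : AEStronglyMeasurable (fun x : R3 => (x, f x)) volume :=
    aestronglyMeasurable_id.prodMk h.memLp.1
  have := hc.comp_aestronglyMeasurable hp
  exact this

theorem integrable_weakDensity (h : MemSigma f) (hv : MemSigma v) :
    Integrable (weakDensity w lam σ f v) := by
  refine (((integrable_jetWeight h 0).add (integrable_jetWeight hv 0)).const_mul
    (3 + (∑ j, w j ^ 2) + |lam| + |σ|)).mono' ?_ (ae_of_all _ (norm_weakDensity_le w lam σ f v))
  have h1 : AEStronglyMeasurable (fun x => ∑ j, weakGradient f x j * weakGradient v x j) volume :=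
    Finset.aestronglyMeasurable_fun_sum Finset.univ fun j _ =>
      ((MemLp.component h.memLp_weakGradient j).1.mul (MemLp.component hv.memLp_weakGradient j).1 :
        AEStronglyMeasurable (fun x => weakGradient f x j * weakGradient v x j) volume)
  have h2 : AEStronglyMeasurable (fun x => lowerOrder w lam σ f x * v x) volume :=
    (h.aestronglyMeasurable_lowerOrder (w := w) (lam := lam) (σ := σ)).mul hv.memLp.1
  exact (h1.const_mul (1 / 2 : ℂ)).add h2

theorem weakForm_sub (h : MemSigma f) (hv : MemSigma v) (hv' : MemSigma v') :
    weakForm w lam σ f (v - v') = weakForm w lam σ f v - weakForm w lam σ f v' := by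
  unfold weakForm
  rw [← integral_sub (integrable_weakDensity h hv) (integrable_weakDensity h hv')]
  refine integral_congr_ae ?_
  filter_upwards [(hv.isWeakGradient.sub hv'.isWeakGradient).weakGradient_ae_eq] with x hx
  simp only [weakDensity, hx, Pi.sub_apply, PiLp.sub_apply, mul_sub, Finset.sum_sub_distrib]
  ring

theorem weakForm_smul (hv : MemSigma v) (c : ℂ) :
    weakForm w lam σ f (c • v) = c * weakForm w lam σ f v := by
  unfold weakForm
  rw [← integral_const_mul]
  refine integral_congr_ae ?_
  filter_upwards [(hv.isWeakGradient.const_smul c).weakGradient_ae_eq] with x hx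
  simp only [weakDensity, hx, Pi.smul_apply, PiLp.smul_apply, smul_eq_mul, mul_left_comm _ c,
    ← Finset.mul_sum]
  ring

theorem sigmaNorm_smul (hv : MemSigma v) (c : ℂ) : sigmaNorm (c • v) = ‖c‖ₑ * sigmaNorm v := by
  rw [sigmaNorm_eq (hv.isWeakGradient.const_smul c), eLpNorm_const_smul, eLpNorm_const_smul]
  have e : (fun x => ‖x‖ • (c • v) x) = c • fun x => ‖x‖ • v x := by
    ext x; simp [mul_left_comm]
  rw [e, eLpNorm_const_smul, sigmaNorm]
  ring

theorem integral_jetWeight_le {M : ℝ} (hM : 0 ≤ M) (h : MemSigma f)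
    (hf : sigmaNorm f ≤ ENNReal.ofReal M) :
    ∫ x, jetWeight (jet 0 f x) ≤ 6 * M ^ 2 + 2 * (sobolevConst * M) ^ 6 := by
  rw [integral_eq_lintegral_of_nonneg_ae (ae_of_all _ fun x => jetWeight_nonneg _)
    (integrable_jetWeight h 0).1]
  refine ENNReal.toReal_le_of_le_ofReal (by positivity) ((lintegral_jetWeight_le h 0).trans ?_)
  have e : ENNReal.ofReal (6 * M ^ 2 + 2 * (sobolevConst * M) ^ 6) =
      6 * ENNReal.ofReal M ^ 2 + 2 * (sobolevConst * ENNReal.ofReal M) ^ 6 := by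
    rw [ENNReal.ofReal_add (by positivity) (by positivity), ENNReal.ofReal_mul (by norm_num),
      ENNReal.ofReal_mul (by norm_num), ENNReal.ofReal_pow hM, ENNReal.ofReal_pow (by positivity),
      ENNReal.ofReal_mul (by positivity), ENNReal.ofReal_coe_nnreal]
    simp only [ENNReal.ofReal_ofNat]
  rw [e]
  simp only [norm_zero, ne_eq, OfNat.ofNat_ne_zero, not_false_eq_true, zero_pow, mul_zero,
    add_zero, ENNReal.ofReal_ofNat]
  gcongr

/-- The weak form is bounded on `Σ`, uniformly for `f` in bounded sets of `Σ`. -/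
theorem exists_norm_weakForm_le (w : Fin 3 → ℝ) (lam σ : ℝ) (M : ℝ) (hM : 0 ≤ M) :
    ∃ K, 0 ≤ K ∧ ∀ f v : R3 → ℂ, MemSigma f → MemSigma v → sigmaNorm f ≤ ENNReal.ofReal M →
      ∀ δ : ℝ, 0 < δ → sigmaNorm v ≤ ENNReal.ofReal δ → ‖weakForm w lam σ f v‖ ≤ K * δ := by
  set A := 3 + (∑ j, w j ^ 2) + |lam| + |σ| with hA
  have hA0 : 0 ≤ A := by positivity
  refine ⟨A * ((6 * M ^ 2 + 2 * (sobolevConst * M) ^ 6) +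
    (6 * 1 ^ 2 + 2 * (sobolevConst * 1) ^ 6)), by positivity, fun f v hf hv hfM δ hδ hvδ => ?_⟩
  have key : ∀ v : R3 → ℂ, MemSigma v → sigmaNorm v ≤ ENNReal.ofReal 1 →
      ‖weakForm w lam σ f v‖ ≤ A * ((6 * M ^ 2 + 2 * (sobolevConst * M) ^ 6) +
        (6 * 1 ^ 2 + 2 * (sobolevConst * 1) ^ 6)) := fun v hv hv1 => by
    calc ‖weakForm w lam σ f v‖ ≤ ∫ x, A * (jetWeight (jet 0 f x) + jetWeight (jet 0 v x)) :=
          norm_integral_le_of_norm_le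
            (((integrable_jetWeight hf 0).add (integrable_jetWeight hv 0)).const_mul A)
            (ae_of_all _ (norm_weakDensity_le w lam σ f v))
      _ = A * ((∫ x, jetWeight (jet 0 f x)) + ∫ x, jetWeight (jet 0 v x)) := by
          rw [integral_const_mul, integral_add (integrable_jetWeight hf 0)
            (integrable_jetWeight hv 0)]
      _ ≤ _ := by
          gcongr
          · exact integral_jetWeight_le hM hf hfM
          · exact integral_jetWeight_le zero_le_one hv hv1
  -- The pointwise bound is not homogeneous in v, but the weak form is linear in v. A bound on the
  -- unit ball of Σ, applied to v / δ, therefore gives one linear in δ.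
  have h1 := key (((δ⁻¹ : ℝ) : ℂ) • v) (hv.const_smul _) (by
    rw [sigmaNorm_smul hv, ← ofReal_norm, Complex.norm_real, Real.norm_of_nonneg (by positivity)]
    calc _ ≤ ENNReal.ofReal δ⁻¹ * ENNReal.ofReal δ := by gcongr
      _ = ENNReal.ofReal 1 := by rw [← ENNReal.ofReal_mul (by positivity), inv_mul_cancel₀ hδ.ne'])
  rw [weakForm_smul hv, norm_mul, Complex.norm_real, Real.norm_of_nonneg (by positivity),
    inv_mul_le_iff₀ hδ] at h1
  linarith

theorem IsTest.laplacian_eq {φ : R3 → ℂ} (hφ : IsTest φ) (x : R3) :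
    (Δ φ) x = ∑ j : Fin 3, fderiv ℝ (fun y => fderiv ℝ φ y (EuclideanSpace.single j 1)) x
      (EuclideanSpace.single j 1) := by
  rw [congrFun (InnerProductSpace.laplacian_eq_iteratedFDeriv_orthonormalBasis φ
    (EuclideanSpace.basisFun (Fin 3) ℝ)) x]
  refine Finset.sum_congr rfl fun j _ => ?_
  rw [iteratedFDeriv_two_apply]
  have hd : DifferentiableAt ℝ (fderiv ℝ φ) x :=
    (hφ.1.fderiv_right (m := ∞) (by simp)).differentiable (by simp) x
  rw [fderiv_clm_apply hd (differentiableAt_const _)]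
  simp

/-- One integration by parts moves a derivative from the test function to f. The right-hand side
then makes sense for every test function in Σ, which is what the extension of the equation needs. -/
theorem weakForm_of_isTest (h : MemSigma f) {φ : R3 → ℂ} (hφ : IsTest φ) :
    ∫ x, (-(1 / 2) * (f x * (Δ φ) x) + lowerOrder w lam σ f x * φ x) = weakForm w lam σ f φ := by
  have i1 : ∀ j : Fin 3, Integrable fun x => f x * fderiv ℝ (fun y => fderiv ℝ φ y
      (EuclideanSpace.single j 1)) x (EuclideanSpace.single j 1) := fun j => by
    have := (hφ.fderiv_apply (EuclideanSpace.single j 1)).fderiv_apply (EuclideanSpace.single j 1)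
    exact integrable_mul_of_hasCompactSupport h.isWeakGradient.1 this.continuous this.2
  have i2 : ∀ j : Fin 3, Integrable fun x => weakGradient f x j * fderiv ℝ φ x
      (EuclideanSpace.single j 1) := fun j => by
    have := hφ.fderiv_apply (EuclideanSpace.single j 1)
    exact integrable_mul_of_hasCompactSupport (locallyIntegrable_component
      h.isWeakGradient.2.1 j) this.continuous this.2
  have i3 : Integrable fun x => lowerOrder w lam σ f x * φ x := by
    have h1 := integrable_weakDensity (w := w) (lam := lam) (σ := σ) h hφ.memSigma
    have h2 : Integrable fun x => (1 / 2 : ℂ) * ∑ j, weakGradient f x j * weakGradient φ x j := by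
      refine ((integrable_finsetSum Finset.univ fun j _ => i2 j).const_mul (1 / 2 : ℂ)).congr ?_
      filter_upwards [hφ.isWeakGradient.weakGradient_ae_eq] with x hx
      simp [hx]
    refine (h1.sub h2).congr (ae_of_all _ fun x => ?_)
    simp [weakDensity]
  have e1 : ∀ x, -(1 / 2) * (f x * (Δ φ) x) + lowerOrder w lam σ f x * φ x =
      -(1 / 2) * (∑ j : Fin 3, f x * fderiv ℝ (fun y => fderiv ℝ φ y
      (EuclideanSpace.single j 1)) x (EuclideanSpace.single j 1)) +
      lowerOrder w lam σ f x * φ x := fun x => by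
    rw [hφ.laplacian_eq, Finset.mul_sum]
  have e2 : weakForm w lam σ f φ = ∫ x, ((1 / 2) * (∑ j : Fin 3, weakGradient f x j * fderiv ℝ φ x
      (EuclideanSpace.single j 1)) + lowerOrder w lam σ f x * φ x) := by
    refine integral_congr_ae ?_
    filter_upwards [hφ.isWeakGradient.weakGradient_ae_eq] with x hx
    simp [weakDensity, hx]
  rw [e2]
  simp only [e1]
  rw [integral_add ((integrable_finsetSum Finset.univ fun j _ => i1 j).const_mul _) i3,
    integral_add ((integrable_finsetSum Finset.univ fun j _ => i2 j).const_mul _) i3,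
    integral_const_mul, integral_const_mul, integral_finsetSum _ fun j _ => i1 j,
    integral_finsetSum _ fun j _ => i2 j]
  congr 1
  simp only [h.integral_mul_fderiv (hφ.fderiv_apply _), Finset.sum_neg_distrib]
  ring

end Pairing

/-! ### Differentiating functionals along the flow -/

section Master

variable {w : Fin 3 → ℝ} {lam σ : ℝ} {T : EReal} {u : ℝ → R3 → ℂ} {t : ℝ}

theorem timeInterval_mem_nhds (h0 : 0 < t) (hT : (t : EReal) < T) : timeInterval T ∈ 𝓝 t := by
  have h1 : ∀ᶠ s : ℝ in 𝓝 t, (s : EReal) < T :=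
    (continuous_coe_real_ereal.tendsto t).eventually (gt_mem_nhds hT)
  filter_upwards [h1, lt_mem_nhds h0] with s hs hs0
  exact ⟨hs0.le, hs⟩

theorem IsSolution.tendsto_sigmaNorm (hu : IsSolution w lam σ T u) (h0 : 0 < t)
    (hT : (t : EReal) < T) : Tendsto (fun s => sigmaNorm (u s - u t)) (𝓝 t) (𝓝 0) := by
  have := hu.continuousInSigma.cont t ⟨h0.le, hT⟩
  rwa [nhdsWithin_eq_nhds.2 (timeInterval_mem_nhds h0 hT)] at this

theorem IsSolution.memSigma (hu : IsSolution w lam σ T u) (ht : t ∈ timeInterval T) :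
    MemSigma (u t) := hu.continuousInSigma.mem t ht

theorem IsSolution.exists_bound (hu : IsSolution w lam σ T u) (h0 : 0 < t)
    (hT : (t : EReal) < T) : ∃ M r : ℝ, 0 ≤ M ∧ 0 < r ∧ ∀ s ∈ Metric.ball t r,
      0 < s ∧ (s : EReal) < T ∧ MemSigma (u s) ∧ sigmaNorm (u s) ≤ ENNReal.ofReal M := by
  have hm : MemSigma (u t) := hu.memSigma ⟨h0.le, hT⟩
  have h1 : ∀ᶠ s : ℝ in 𝓝 t, (s : EReal) < T :=
    (continuous_coe_real_ereal.tendsto t).eventually (gt_mem_nhds hT)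
  have h2 := (hu.tendsto_sigmaNorm h0 hT).eventually (gt_mem_nhds one_pos)
  obtain ⟨r, hr, hr'⟩ := Metric.eventually_nhds_iff_ball.1 ((lt_mem_nhds h0).and (h1.and h2))
  refine ⟨1 + (sigmaNorm (u t)).toReal, r, by positivity, hr, fun s hs => ?_⟩
  obtain ⟨a1, a2, a3⟩ := hr' s hs
  have hms : MemSigma (u s) := hu.memSigma ⟨le_of_lt a1, a2⟩
  refine ⟨a1, a2, hms, ?_⟩
  rw [ENNReal.ofReal_add zero_le_one ENNReal.toReal_nonneg, ENNReal.ofReal_one,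
    ENNReal.ofReal_toReal hm.sigmaNorm_lt_top.ne]
  have := sigmaNorm_add_le (hms.sub hm) hm
  rw [sub_add_cancel] at this
  exact this.trans (add_le_add a3.le le_rfl)

theorem IsSolution.hasDerivAt_of_isTest (hu : IsSolution w lam σ T u) {φ : R3 → ℂ}
    (hφ : IsTest φ) (h0 : 0 < t) (hT : (t : EReal) < T) :
    HasDerivAt (fun s => ∫ x, u s x * φ x) (-Complex.I * weakForm w lam σ (u t) φ) t := by
  have h := (hu.equation φ hφ t h0 hT).const_mul (-Complex.I)
  rw [weakForm_of_isTest (hu.memSigma ⟨h0.le, hT⟩) hφ] at h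
  refine h.congr_of_eventuallyEq (Eventually.of_forall fun s => ?_)
  simp only
  rw [← mul_assoc, neg_mul, Complex.I_mul_I]
  simp

/-- The equation holds when tested with any function of `Σ`. -/
theorem IsSolution.hasDerivAt (hu : IsSolution w lam σ T u) {v : R3 → ℂ}
    (hv : MemSigma v) (h0 : 0 < t) (hT : (t : EReal) < T) :
    HasDerivAt (fun s => ∫ x, u s x * v x) (-Complex.I * weakForm w lam σ (u t) v) t := by
  obtain ⟨M, r, hM, hr, hb⟩ := hu.exists_bound h0 hT
  obtain ⟨K, hK, hKb⟩ := exists_norm_weakForm_le w lam σ M hM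
  obtain ⟨φ, hφ, ht⟩ := hv.exists_seq_isTest
  -- Test functions approximate v in Σ. The derivatives converge uniformly for s near t because u
  -- stays in a ball of Σ there, on which the weak form is bounded uniformly.
  refine hasDerivAt_of_tendstoUniformlyOn (l := atTop) (s := Metric.ball t r)
    (f := fun n s => ∫ x, u s x * φ n x)
    (f' := fun n s => -Complex.I * weakForm w lam σ (u s) (φ n))
    (g' := fun s => -Complex.I * weakForm w lam σ (u s) v) Metric.isOpen_ball ?_
    (Eventually.of_forall fun n s hs => hu.hasDerivAt_of_isTest (hφ n) (hb s hs).1 (hb s hs).2.1)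
    (fun s hs => ?_) (Metric.mem_ball_self hr)
  · rw [Metric.tendstoUniformlyOn_iff]
    intro ε hε
    -- The denominator is K + 1 because K may vanish; it also makes the resulting inequality strict.
    have hδ : 0 < ε / (K + 1) := by positivity
    have := ht.eventually (ge_mem_nhds (ENNReal.ofReal_pos.2 hδ))
    filter_upwards [this] with n hn s hs
    have hs' := hb s hs
    rw [dist_comm, dist_eq_norm, ← mul_sub, ← weakForm_sub hs'.2.2.1 (hφ n).memSigma hv, norm_mul]
    have h1 := hKb _ _ hs'.2.2.1 ((hφ n).memSigma.sub hv) hs'.2.2.2 _ hδ hn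
    simp only [norm_neg, Complex.norm_I, one_mul]
    refine h1.trans_lt ?_
    rw [mul_div_assoc', div_lt_iff₀ (by positivity)]
    nlinarith
  · have hs' := (hb s hs).2.2.1
    rw [tendsto_iff_edist_tendsto_0]
    have hlim : Tendsto (fun n => eLpNorm (u s) 2 volume * sigmaNorm (φ n - v)) atTop (𝓝 0) := by
      simpa using ENNReal.Tendsto.const_mul (a := eLpNorm (u s) 2 volume) ht
        (Or.inr hs'.memLp.2.ne)
    refine tendsto_of_tendsto_of_tendsto_of_le_of_le tendsto_const_nhds hlim (fun _ => zero_le)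
      fun n => ?_
    have i1 : Integrable fun x => u s x * φ n x := hs'.memLp.integrable_mul (hφ n).memSigma.memLp
    have i2 : Integrable fun x => u s x * v x := hs'.memLp.integrable_mul hv.memLp
    simp only [edist_eq_enorm_sub]
    rw [← integral_sub i1 i2]
    simp only [← mul_sub]
    refine (enorm_integral_mul_le hs'.memLp.1 ((hφ n).memSigma.sub hv).memLp.1).trans ?_
    gcongr
    exact eLpNorm_le_sigmaNorm

/-- Fix s and test the equation with v, the conjugate of u(s) - u(t). By the mean value inequality
the increment of ∫ u v between t and s, which is exactly the squared L² distance, is at most K‖v‖_Σ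
|s - t|. Continuity in Σ makes ‖v‖_Σ small. -/
theorem IsSolution.sq_norm_sub_isLittleO (hu : IsSolution w lam σ T u) (h0 : 0 < t)
    (hT : (t : EReal) < T) :
    (fun s => ∫ x, ‖u s x - u t x‖ ^ 2) =o[𝓝 t] fun s => s - t := by
  obtain ⟨M, r, hM, hr, hb⟩ := hu.exists_bound h0 hT
  obtain ⟨K, hK, hKb⟩ := exists_norm_weakForm_le w lam σ M hM
  rw [Asymptotics.isLittleO_iff]
  intro ε hε
  have hδ : 0 < ε / (K + 1) := by positivity
  have hm := (hb t (Metric.mem_ball_self hr)).2.2.1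
  filter_upwards [(hu.tendsto_sigmaNorm h0 hT).eventually (ge_mem_nhds (ENNReal.ofReal_pos.2 hδ)),
    Metric.ball_mem_nhds t hr] with s hs hsr
  have hms := (hb s hsr).2.2.1
  set v : R3 → ℂ := fun x => (starRingEnd ℂ) ((u s - u t) x) with hvd
  have hv : MemSigma v := (hms.sub hm).conj
  have hvn : sigmaNorm v ≤ ENNReal.ofReal (ε / (K + 1)) := by
    rw [hvd, sigmaNorm_conj (hms.sub hm)]; exact hs
  have hmv := (convex_ball t r).norm_image_sub_le_of_norm_hasDerivWithin_le
    (f := fun s => ∫ x, u s x * v x) (C := K * (ε / (K + 1)))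
    (fun r' hr' => (hu.hasDerivAt hv (hb r' hr').1 (hb r' hr').2.1).hasDerivWithinAt)
    (fun r' hr' => by
      rw [norm_mul, norm_neg, Complex.norm_I, one_mul]
      exact hKb _ _ (hb r' hr').2.2.1 hv (hb r' hr').2.2.2 _ hδ hvn)
    (Metric.mem_ball_self hr) hsr
  have i1 : Integrable fun x => u s x * v x := hms.memLp.integrable_mul hv.memLp
  have i2 : Integrable fun x => u t x * v x := hm.memLp.integrable_mul hv.memLp
  have e : (∫ x, u s x * v x) - ∫ x, u t x * v x = ((∫ x, ‖u s x - u t x‖ ^ 2 : ℝ) : ℂ) := by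
    rw [← integral_sub i1 i2, ← integral_complex_ofReal]
    refine integral_congr_ae (ae_of_all _ fun x => ?_)
    simp only [hvd, Pi.sub_apply, ← sub_mul, Complex.mul_conj, Complex.normSq_eq_norm_sq]
  simp only [e, Complex.norm_real] at hmv
  refine hmv.trans (mul_le_mul_of_nonneg_right ?_ (norm_nonneg _))
  rw [mul_div_assoc', div_le_iff₀ (by positivity)]
  nlinarith

/-- Differentiation along the flow of functionals that are differentiable up to a quadratic
error in `L²`. -/
theorem IsSolution.hasDerivAt_functional (hu : IsSolution w lam σ T u) (h0 : 0 < t)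
    (hT : (t : EReal) < T) {𝓔 : (R3 → ℂ) → ℝ} {v : R3 → ℂ} (hv : MemSigma v) {C : ℝ}
    (hE : ∀ f, MemSigma f → |𝓔 f - 𝓔 (u t) -
      2 * (∫ x, (f x - u t x) * (starRingEnd ℂ) (v x)).re| ≤ C * ∫ x, ‖f x - u t x‖ ^ 2) :
    HasDerivAt (fun s => 𝓔 (u s))
      (2 * (weakForm w lam σ (u t) fun x => (starRingEnd ℂ) (v x)).im) t := by
  have hm : MemSigma (u t) := hu.memSigma ⟨h0.le, hT⟩
  have h1 : HasDerivAt (fun s => 2 * (∫ x, u s x * (starRingEnd ℂ) (v x)).re)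
      (2 * (weakForm w lam σ (u t) fun x => (starRingEnd ℂ) (v x)).im) t := by
    have := (Complex.reCLM.hasFDerivAt.comp_hasDerivAt t (hu.hasDerivAt hv.conj h0 hT)).const_mul 2
    simpa [Function.comp_def] using this
  rw [hasDerivAt_iff_isLittleO] at h1 ⊢
  -- The quadratic Taylor remainder does not contribute to the derivative; only the linear pairing
  -- with the fixed v does, and that is the tested equation.
  have h2 : (fun s => 𝓔 (u s) - 𝓔 (u t) -
      2 * (∫ x, (u s x - u t x) * (starRingEnd ℂ) (v x)).re) =o[𝓝 t] fun s => s - t := by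
    refine Asymptotics.IsBigO.trans_isLittleO ?_ (hu.sq_norm_sub_isLittleO h0 hT)
    refine Asymptotics.IsBigO.of_bound C ?_
    filter_upwards [timeInterval_mem_nhds h0 hT] with s hs
    rw [Real.norm_eq_abs, Real.norm_of_nonneg (integral_nonneg fun x => by positivity)]
    exact hE _ (hu.memSigma hs)
  refine (h1.add h2).congr' ?_ .rfl
  filter_upwards [timeInterval_mem_nhds h0 hT] with s hs
  have i1 : Integrable fun x => u s x * (starRingEnd ℂ) (v x) :=
    (hu.memSigma hs).memLp.integrable_mul hv.conj.memLp
  have i2 : Integrable fun x => u t x * (starRingEnd ℂ) (v x) := hm.memLp.integrable_mul hv.conj.memLp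
  simp only [sub_mul]
  rw [integral_sub i1 i2, Complex.sub_re]
  ring

end Master

/-! ### Balance laws for weighted masses and local functionals -/

section Balance

variable {w : Fin 3 → ℝ} {lam σ : ℝ} {T : EReal} {u : ℝ → R3 → ℂ} {t : ℝ} {f : R3 → ℂ}

theorem lowerOrder_eq (f : R3 → ℂ) (x : R3) : lowerOrder w lam σ f x =
    (((confinement w x + lam * ‖f x‖ ^ 2 : ℝ) : ℂ) -
      Complex.I * ((σ * ‖f x‖ ^ 4 : ℝ) : ℂ)) * f x := by
  unfold lowerOrder; push_cast; ring

/-- Paired with a real multiple of f, the potential and the cubic term are real, so only the damping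
reaches the imaginary part. This is where gauge invariance of the functionals is used. -/
theorem im_lowerOrder_mul_conj (f : R3 → ℂ) (x : R3) (γ : ℝ) :
    (lowerOrder w lam σ f x * (starRingEnd ℂ) ((γ : ℂ) * f x)).im = -(σ * γ * ‖f x‖ ^ 6) := by
  have h : lowerOrder w lam σ f x * (starRingEnd ℂ) ((γ : ℂ) * f x) =
      (((confinement w x + lam * ‖f x‖ ^ 2) * γ * ‖f x‖ ^ 2 : ℝ) : ℂ) -
        Complex.I * ((σ * ‖f x‖ ^ 4 * γ * ‖f x‖ ^ 2 : ℝ) : ℂ) := by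
    have h1 : f x * (starRingEnd ℂ) (f x) = ((‖f x‖ ^ 2 : ℝ) : ℂ) := by
      rw [Complex.mul_conj, Complex.normSq_eq_norm_sq]
    rw [lowerOrder_eq, map_mul, Complex.conj_ofReal]
    calc _ = (((confinement w x + lam * ‖f x‖ ^ 2 : ℝ) : ℂ) -
          Complex.I * ((σ * ‖f x‖ ^ 4 : ℝ) : ℂ)) * γ * (f x * (starRingEnd ℂ) (f x)) := by ring
      _ = _ := by rw [h1]; push_cast; ring
  rw [h]
  simp only [Complex.sub_im, Complex.ofReal_im, Complex.mul_im, Complex.I_re, Complex.I_im,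
    Complex.ofReal_re]
  ring

theorem norm_sq_sub_norm_sq (a b : ℂ) :
    ‖a‖ ^ 2 - ‖b‖ ^ 2 = 2 * ((a - b) * (starRingEnd ℂ) b).re + ‖a - b‖ ^ 2 := by
  simp only [← Complex.normSq_eq_norm_sq, Complex.normSq_apply, Complex.mul_re, Complex.sub_re,
    Complex.sub_im, Complex.conj_re, Complex.conj_im]
  ring

theorem MemSigma.integrable_sq (h : MemSigma f) : Integrable fun x => ‖f x‖ ^ 2 :=
  (memLp_two_iff_integrable_sq_norm h.memLp.1).1 h.memLp

/-- Local mass balance against a smooth real weight. -/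
theorem IsSolution.hasDerivAt_weighted (hu : IsSolution w lam σ T u) (h0 : 0 < t)
    (hT : (t : EReal) < T) {η : R3 → ℝ} (hη : ContDiff ℝ ∞ η) {A B : ℝ} (hA : ∀ x, |η x| ≤ A)
    (hB : ∀ x, ‖fderiv ℝ η x‖ ≤ B * (1 + ‖x‖)) :
    HasDerivAt (fun s => ∫ x, η x * ‖u s x‖ ^ 2)
      (∫ x, ((∑ j, fderiv ℝ η x (EuclideanSpace.single j 1) *
        ((starRingEnd ℂ) (u t x) * weakGradient (u t) x j).im) -
          2 * σ * (η x * ‖u t x‖ ^ 6))) t := by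
  have hm : MemSigma (u t) := hu.memSigma ⟨h0.le, hT⟩
  set ζ : R3 → ℂ := fun x => (η x : ℂ) with hζ
  have hζc : ContDiff ℝ ∞ ζ := Complex.ofRealCLM.contDiff.comp hη
  have hζd : ∀ x, fderiv ℝ ζ x = Complex.ofRealCLM.comp (fderiv ℝ η x) := fun x =>
    (Complex.ofRealCLM.hasFDerivAt.comp x (hη.differentiable (by simp) x).hasFDerivAt).fderiv
  have hζA : ∀ x, ‖ζ x‖ ≤ A := fun x => by simpa [hζ] using hA x
  have hv : MemSigma (fun x => ζ x * u t x) := hm.smooth_mul hζc hζA fun x => by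
    rw [hζd]
    refine (ContinuousLinearMap.opNorm_comp_le _ _).trans (le_trans ?_ (hB x))
    rw [Complex.ofRealCLM_norm, one_mul]
  have iη : ∀ f, MemSigma f → Integrable fun x => η x * ‖f x‖ ^ 2 := fun f hf =>
    (hf.integrable_sq.const_mul A).mono' (hη.continuous.aestronglyMeasurable.mul
      hf.integrable_sq.1) (ae_of_all _ fun x => by
        rw [norm_mul, Real.norm_eq_abs, Real.norm_of_nonneg (by positivity)]
        exact mul_le_mul_of_nonneg_right (hA x) (by positivity))
  have key := hu.hasDerivAt_functional h0 hT (𝓔 := fun f => ∫ x, η x * ‖f x‖ ^ 2) hv (C := A)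
    fun f hf => ?_
  · convert key using 1
    have hg := ((hm.isWeakGradient.smooth_mul hζc).conj hv.memLp ?_).weakGradient_ae_eq
    · rw [weakForm, ← Complex.imCLM_apply, ← ContinuousLinearMap.integral_comp_comm _
        (integrable_weakDensity hm hv.conj), ← integral_const_mul]
      refine integral_congr_ae ?_
      filter_upwards [hg] with x hx
      rw [weakDensity, hx, Complex.imCLM_apply, Complex.add_im, im_lowerOrder_mul_conj, mul_add]
      have : 2 * ((1 / 2 : ℂ) * ∑ j, weakGradient (u t) x j * conjVec (WithLp.toLp 2 fun j =>
          ζ x * weakGradient (u t) x j + fderiv ℝ ζ x (EuclideanSpace.single j 1) * u t x) j).im =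
          ∑ j, fderiv ℝ η x (EuclideanSpace.single j 1) *
            ((starRingEnd ℂ) (u t x) * weakGradient (u t) x j).im := by
        rw [show (1 / 2 : ℂ) = ((1 / 2 : ℝ) : ℂ) by norm_num, Complex.im_ofReal_mul,
          Complex.im_sum, Finset.mul_sum, Finset.mul_sum]
        refine Finset.sum_congr rfl fun j _ => ?_
        have hz : fderiv ℝ ζ x (EuclideanSpace.single j 1) =
            ((fderiv ℝ η x (EuclideanSpace.single j 1) : ℝ) : ℂ) := by rw [hζd]; rfl
        simp only [conjVec, hz]
        simp only [hζ, map_add, map_mul, Complex.conj_ofReal, Complex.mul_im, Complex.add_im, Complex.add_re,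
          Complex.mul_re, Complex.ofReal_re, Complex.ofReal_im, Complex.conj_re, Complex.conj_im]
        ring
      rw [this]; ring
    · exact (memLp_congr_ae (hm.isWeakGradient.smooth_mul hζc).weakGradient_ae_eq).1
        hv.memLp_weakGradient
  · have hd := hf.sub hm
    have i3 : Integrable fun x => (f x - u t x) * (starRingEnd ℂ) (ζ x * u t x) :=
      hd.memLp.integrable_mul hv.conj.memLp
    have i4 : Integrable fun x => η x * ‖f x - u t x‖ ^ 2 := iη _ hd
    have i5 : Integrable fun x => η x * ‖f x‖ ^ 2 - η x * ‖u t x‖ ^ 2 :=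
      (iη f hf).sub (iη _ hm)
    have e : (∫ x, η x * ‖f x‖ ^ 2) - (∫ x, η x * ‖u t x‖ ^ 2) -
        2 * (∫ x, (f x - u t x) * (starRingEnd ℂ) (ζ x * u t x)).re =
        ∫ x, η x * ‖f x - u t x‖ ^ 2 := by
      rw [← Complex.reCLM_apply, ← ContinuousLinearMap.integral_comp_comm _ i3,
        ← integral_const_mul, ← integral_sub (iη f hf) (iη _ hm), ← integral_sub i5 ((Complex.reCLM.integrable_comp i3).const_mul 2)]
      refine integral_congr_ae (ae_of_all _ fun x => ?_)
      have h1 := norm_sq_sub_norm_sq (f x) (u t x)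
      have h2 : ((f x - u t x) * (starRingEnd ℂ) (ζ x * u t x)).re =
          η x * ((f x - u t x) * (starRingEnd ℂ) (u t x)).re := by
        rw [map_mul, hζ, Complex.conj_ofReal, mul_left_comm, Complex.re_ofReal_mul]
      simp only [Complex.reCLM_apply, h2]
      linear_combination η x * h1
    rw [e, ← integral_const_mul]
    refine (abs_integral_le_integral_abs).trans (integral_mono i4.abs
      (hd.integrable_sq.const_mul A) fun x => ?_)
    simp only [abs_mul]
    rw [abs_of_nonneg (sq_nonneg ‖f x - u t x‖)]
    exact mul_le_mul_of_nonneg_right (hA x) (by positivity)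

/-- Quadratic Taylor bound for a function on `ℂ` whose gradient `2 F` is Lipschitz. -/
theorem abs_taylor_le {H : ℂ → ℝ} {F : ℂ → ℂ} {C : ℝ}
    (hH : ∀ z, HasFDerivAt H ((2 : ℝ) • Complex.reCLM.comp
      ((ContinuousLinearMap.mul ℝ ℂ).flip ((starRingEnd ℂ) (F z)))) z)
    (hF : ContDiff ℝ 1 F) (hC : ∀ z, ‖fderiv ℝ F z‖ ≤ C) (a b : ℂ) :
    |H b - H a - 2 * ((b - a) * (starRingEnd ℂ) (F a)).re| ≤ 2 * C * ‖b - a‖ ^ 2 := by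
  have hC0 : 0 ≤ C := (norm_nonneg _).trans (hC 0)
  have hlip : ∀ z, ‖F z - F a‖ ≤ C * ‖z - a‖ := fun z =>
    convex_univ.norm_image_sub_le_of_norm_fderiv_le (𝕜 := ℝ) (f := F) (C := C)
      (fun z _ => hF.differentiable (by simp) z) (fun z _ => hC z) (Set.mem_univ a) (Set.mem_univ z)
  set L : ℂ →L[ℝ] ℝ := (2 : ℝ) • Complex.reCLM.comp
      ((ContinuousLinearMap.mul ℝ ℂ).flip ((starRingEnd ℂ) (F a))) with hL
  -- After subtracting the tangent map at a, the derivative is at most 2C‖b - a‖ on the ball of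
  -- radius ‖b - a‖, so the mean value inequality yields the quadratic bound.
  have h1 := (convex_closedBall a ‖b - a‖).norm_image_sub_le_of_norm_hasFDerivWithin_le
    (f := fun z => H z - L z) (C := 2 * C * ‖b - a‖) (x := a) (y := b)
    (fun z _ => ((hH z).sub L.hasFDerivAt).hasFDerivWithinAt) (fun z hz => ?_)
    (Metric.mem_closedBall_self (norm_nonneg _)) (by simp [dist_eq_norm])
  · rw [Real.norm_eq_abs] at h1
    calc _ = |H b - L b - (H a - L a)| := by
          congr 1
          simp only [hL, smul_apply, ContinuousLinearMap.comp_apply,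
            ContinuousLinearMap.flip_apply, ContinuousLinearMap.mul_apply', Complex.reCLM_apply,
            smul_eq_mul, sub_mul, Complex.sub_re]
          ring
      _ ≤ 2 * C * ‖b - a‖ * ‖b - a‖ := h1
      _ = _ := by ring
  · refine ContinuousLinearMap.opNorm_le_bound _ (by positivity) fun ξ => ?_
    have e : ((2 : ℝ) • Complex.reCLM.comp
      ((ContinuousLinearMap.mul ℝ ℂ).flip ((starRingEnd ℂ) (F z))) - L) ξ =
      2 * (ξ * (starRingEnd ℂ) (F z - F a)).re := by
      simp only [hL, sub_apply, smul_apply,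
        ContinuousLinearMap.comp_apply, ContinuousLinearMap.flip_apply,
        ContinuousLinearMap.mul_apply', Complex.reCLM_apply, smul_eq_mul, map_sub, mul_sub,
        Complex.sub_re]
    rw [e, Real.norm_eq_abs, abs_mul, abs_two]
    have h2 : |(ξ * (starRingEnd ℂ) (F z - F a)).re| ≤ ‖ξ‖ * (C * ‖b - a‖) := by
      refine (Complex.abs_re_le_norm _).trans ?_
      rw [norm_mul, RCLike.norm_conj]
      refine mul_le_mul_of_nonneg_left ((hlip z).trans ?_) (norm_nonneg _)
      rw [mem_closedBall_iff_norm] at hz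
      exact mul_le_mul_of_nonneg_left hz hC0
    linarith

/-- Balance law for a gauge invariant local functional. -/
theorem IsSolution.hasDerivAt_local (hu : IsSolution w lam σ T u) (h0 : 0 < t)
    (hT : (t : EReal) < T) {H : ℂ → ℝ} {F : ℂ → ℂ} {γ : ℂ → ℝ} {C : ℝ}
    (hH : ∀ z, HasFDerivAt H ((2 : ℝ) • Complex.reCLM.comp
      ((ContinuousLinearMap.mul ℝ ℂ).flip ((starRingEnd ℂ) (F z)))) z)
    (hF : ContDiff ℝ 1 F) (hC : ∀ z, ‖fderiv ℝ F z‖ ≤ C) (hH0 : H 0 = 0)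
    (hγ : ∀ z, F z = (γ z : ℂ) * z) :
    HasDerivAt (fun s => ∫ x, H (u s x))
      (∫ x, ((∑ j, (weakGradient (u t) x j *
        (starRingEnd ℂ) (fderiv ℝ F (u t x) (weakGradient (u t) x j))).im) -
          2 * σ * (γ (u t x) * ‖u t x‖ ^ 6))) t := by
  have hm : MemSigma (u t) := hu.memSigma ⟨h0.le, hT⟩
  have hF0 : F 0 = 0 := by simp [hγ]
  have hC0 : 0 ≤ C := (norm_nonneg _).trans (hC 0)
  have hv : MemSigma (fun x => F (u t x)) := hm.comp hF hC hF0
  have hHc : Continuous H := continuous_iff_continuousAt.2 fun z => (hH z).continuousAt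
  have iH : ∀ f, MemSigma f → Integrable fun x => H (f x) := fun f hf =>
    (hf.integrable_sq.const_mul (2 * C)).mono' (hHc.comp_aestronglyMeasurable hf.memLp.1)
      (ae_of_all _ fun x => by
        simpa [hF0, hH0] using abs_taylor_le hH hF hC 0 (f x))
  have key := hu.hasDerivAt_functional h0 hT (𝓔 := fun f => ∫ x, H (f x)) hv (C := 2 * C)
    fun f hf => ?_
  · convert key using 1
    have hg := ((hm.isWeakGradient_comp hF hC hF0).conj hv.memLp
      (hm.weakGradient_comp_memLp hF hC)).weakGradient_ae_eq
    rw [weakForm, ← Complex.imCLM_apply, ← ContinuousLinearMap.integral_comp_comm _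
      (integrable_weakDensity hm hv.conj), ← integral_const_mul]
    refine integral_congr_ae ?_
    filter_upwards [hg] with x hx
    rw [weakDensity, hx, Complex.imCLM_apply, Complex.add_im, hγ (u t x), im_lowerOrder_mul_conj,
      mul_add]
    have : 2 * ((1 / 2 : ℂ) * ∑ j, weakGradient (u t) x j * conjVec (WithLp.toLp 2 fun j =>
        fderiv ℝ F (u t x) (weakGradient (u t) x j)) j).im =
        ∑ j, (weakGradient (u t) x j *
        (starRingEnd ℂ) (fderiv ℝ F (u t x) (weakGradient (u t) x j))).im := by
      rw [show (1 / 2 : ℂ) = ((1 / 2 : ℝ) : ℂ) by norm_num, Complex.im_ofReal_mul,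
        Complex.im_sum]
      simp only [conjVec]
      ring
    rw [this]; ring
  · have hd := hf.sub hm
    have i3 : Integrable fun x => (f x - u t x) * (starRingEnd ℂ) (F (u t x)) :=
      hd.memLp.integrable_mul hv.conj.memLp
    have i5 : Integrable fun x => H (f x) - H (u t x) := (iH f hf).sub (iH _ hm)
    rw [← Complex.reCLM_apply, ← ContinuousLinearMap.integral_comp_comm _ i3,
        ← integral_const_mul, ← integral_sub (iH f hf) (iH _ hm), ← integral_sub i5 ((Complex.reCLM.integrable_comp i3).const_mul 2),
        ← integral_const_mul]
    refine abs_integral_le_integral_abs.trans (integral_mono ?_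
      (hd.integrable_sq.const_mul (2 * C)) fun x => ?_)
    · exact (i5.sub ((Complex.reCLM.integrable_comp i3).const_mul 2)).abs
    · exact abs_taylor_le hH hF hC (u t x) (f x)

end Balance

/-! ### A Fatou lemma in time -/

section TimeLemma

/-- A Fatou type lemma for one-sided bounds on derivatives. -/
theorem lintegral_liminf_deriv_le {t r : ℝ} (ht : 0 ≤ t) {m m' k : ℕ → ℝ → ℝ}
    (hm : ∀ n, ContinuousOn (m n) (Set.Icc 0 t))
    (hd : ∀ n, ∀ s ∈ Set.Ioo 0 t, HasDerivAt (m n) (m' n s) s)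
    (hk : ∀ n, ContinuousOn (k n) (Set.Icc 0 t))
    (hle : ∀ n, ∀ s ∈ Set.Ioo 0 t, m' n s ≤ k n s)
    (hr : Tendsto (fun n => m n 0 - m n t + ∫ s in (0 : ℝ)..t, k n s) atTop (𝓝 r)) :
    0 ≤ r ∧ AEMeasurable (fun s => liminf (fun n => ENNReal.ofReal (k n s - m' n s)) atTop)
      (volume.restrict (Set.Ioo 0 t)) ∧
    ∫⁻ s in Set.Ioo 0 t, liminf (fun n => ENNReal.ofReal (k n s - m' n s)) atTop ≤
      ENNReal.ofReal r := by
  have hki : ∀ n, IntervalIntegrable (k n) volume 0 t := fun n =>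
    (hk n).intervalIntegrable_of_Icc ht
  have hprim : ∀ n, ∀ s ∈ Set.Ioo 0 t, HasDerivAt (fun s => ∫ r in (0 : ℝ)..s, k n r) (k n s) s :=
    fun n s hs => by
    have hc : ContinuousOn (k n) (Set.Ioo 0 t) := (hk n).mono Set.Ioo_subset_Icc_self
    refine intervalIntegral.integral_hasDerivAt_right ?_
      (hc.stronglyMeasurableAtFilter isOpen_Ioo s hs) (hc.continuousAt (isOpen_Ioo.mem_nhds hs))
    exact ((hk n).mono (Set.Icc_subset_Icc le_rfl hs.2.le)).intervalIntegrable_of_Icc hs.1.le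
  have hFc : ∀ n, ContinuousOn (fun s => (∫ r in (0 : ℝ)..s, k n r) - m n s) (Set.Icc 0 t) :=
    fun n => by
    have := intervalIntegral.continuousOn_primitive_interval' (hki n) Set.left_mem_uIcc
    rw [Set.uIcc_of_le ht] at this
    exact this.sub (hm n)
  have hFd : ∀ n, ∀ s ∈ Set.Ioo 0 t, HasDerivAt (fun s => (∫ r in (0 : ℝ)..s, k n r) - m n s)
      (k n s - m' n s) s := fun n s hs => (hprim n s hs).sub (hd n s hs)
  -- A continuous function with nonnegative derivative has an integrable derivative. This makes the
  -- fundamental theorem of calculus available without any prior bound on, or measurability of, m'.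
  have hFi : ∀ n, IntegrableOn (fun s => k n s - m' n s) (Set.Ioc 0 t) := fun n =>
    intervalIntegral.integrableOn_deriv_of_nonneg (hFc n) (hFd n)
      fun s hs => sub_nonneg.2 (hle n s hs)
  have hval : ∀ n, ∫⁻ s in Set.Ioo 0 t, ENNReal.ofReal (k n s - m' n s) =
      ENNReal.ofReal (m n 0 - m n t + ∫ s in (0 : ℝ)..t, k n s) := fun n => by
    rw [← ofReal_integral_eq_lintegral_ofReal ((hFi n).mono_set Set.Ioo_subset_Ioc_self)
      ((ae_restrict_iff' measurableSet_Ioo).2 (ae_of_all _ fun s hs => sub_nonneg.2 (hle n s hs))),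
      ← integral_Ioc_eq_integral_Ioo, ← intervalIntegral.integral_of_le ht,
      intervalIntegral.integral_eq_sub_of_hasDerivAt_of_le ht (hFc n) (hFd n)
        ((intervalIntegrable_iff_integrableOn_Ioc_of_le ht).2 (hFi n))]
    congr 1
    simp only [intervalIntegral.integral_same]
    ring
  have hpos : ∀ n, 0 ≤ m n 0 - m n t + ∫ s in (0 : ℝ)..t, k n s := fun n => by
    have h1 := intervalIntegral.integral_eq_sub_of_hasDerivAt_of_le ht (hFc n) (hFd n)
        ((intervalIntegrable_iff_integrableOn_Ioc_of_le ht).2 (hFi n))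
    rw [intervalIntegral.integral_of_le ht, integral_Ioc_eq_integral_Ioo] at h1
    have h2 : 0 ≤ ∫ s in Set.Ioo 0 t, (k n s - m' n s) :=
      setIntegral_nonneg measurableSet_Ioo fun s hs => sub_nonneg.2 (hle n s hs)
    rw [h1] at h2
    simp only [intervalIntegral.integral_same] at h2
    linarith
  have hmeas : ∀ n, AEMeasurable (fun s => ENNReal.ofReal (k n s - m' n s))
      (volume.restrict (Set.Ioo 0 t)) := fun n =>
    ((hFi n).mono_set Set.Ioo_subset_Ioc_self).1.aemeasurable.ennreal_ofReal
  refine ⟨ge_of_tendsto' hr hpos, ⟨fun s => liminf (fun n => (hmeas n).mk _ s) atTop,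
    Measurable.liminf fun n => (hmeas n).measurable_mk, ?_⟩, ?_⟩
  · filter_upwards [ae_all_iff.2 fun n => (hmeas n).ae_eq_mk] with s hs
    simp only [hs]
  refine (lintegral_liminf_le' hmeas).trans (le_of_eq ?_)
  simp only [hval]
  exact (ENNReal.tendsto_ofReal hr).liminf_eq

end TimeLemma

/-! ### Summation by parts and the balance of difference quotients -/

section SummationByParts

/-- After expanding, translation invariance removes the shift from the two terms containing p(x +
a). The identity is used both for the lower order terms and for each component of the gradient. -/
theorem integral_translate_sub_mul {p q : R3 → ℂ} (a : R3)
    (i0 : Integrable fun x => p x * (starRingEnd ℂ) (q x))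
    (i1 : Integrable fun x => p x * (starRingEnd ℂ) (q (x + a)))
    (i2 : Integrable fun x => p x * (starRingEnd ℂ) (q (x + -a))) :
    Integrable (fun x => (p (x + a) - p x) * (starRingEnd ℂ) (q (x + a) - q x)) ∧
    ∫ x, (p (x + a) - p x) * (starRingEnd ℂ) (q (x + a) - q x) =
      ∫ x, p x * (starRingEnd ℂ) (2 * q x - q (x + a) - q (x + -a)) := by
  have j0 := i0.comp_add_right a
  have j2 := i2.comp_add_right a
  simp only [add_neg_cancel_right] at j2
  have e : ∀ x, (p (x + a) - p x) * (starRingEnd ℂ) (q (x + a) - q x) =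
      (p (x + a) * (starRingEnd ℂ) (q (x + a)) - p (x + a) * (starRingEnd ℂ) (q x)) -
      (p x * (starRingEnd ℂ) (q (x + a)) - p x * (starRingEnd ℂ) (q x)) := fun x => by
    rw [map_sub]; ring
  have e' : ∀ x, p x * (starRingEnd ℂ) (2 * q x - q (x + a) - q (x + -a)) =
      (p x * (starRingEnd ℂ) (q x) - p x * (starRingEnd ℂ) (q (x + -a))) -
      (p x * (starRingEnd ℂ) (q (x + a)) - p x * (starRingEnd ℂ) (q x)) := fun x => by
    simp only [map_sub, map_mul, Complex.conj_ofNat]; ring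
  have k1 : Integrable fun x => p (x + a) * (starRingEnd ℂ) (q (x + a)) -
    p (x + a) * (starRingEnd ℂ) (q x) := j0.sub j2
  have k2 : Integrable fun x => p x * (starRingEnd ℂ) (q (x + a)) -
    p x * (starRingEnd ℂ) (q x) := i1.sub i0
  have k3 : Integrable fun x => p x * (starRingEnd ℂ) (q x) -
    p x * (starRingEnd ℂ) (q (x + -a)) := i0.sub i2
  refine ⟨(k1.sub k2).congr (ae_of_all _ fun x => (e x).symm), ?_⟩
  simp only [e, e']
  rw [integral_sub k1 k2, integral_sub k3 k2, integral_sub j0 j2, integral_sub i0 i2]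
  congr 2
  · exact integral_add_right_eq_self (fun x => p x * (starRingEnd ℂ) (q x)) a
  · rw [← integral_add_right_eq_self (fun x => p x * (starRingEnd ℂ) (q (x + -a))) a]
    simp only [add_neg_cancel_right]

variable {w : Fin 3 → ℝ} {lam σ : ℝ} {T : EReal} {u : ℝ → R3 → ℂ} {t : ℝ} {f v : R3 → ℂ}

theorem integrable_lowerOrder_mul (h : MemSigma f) (hv : MemSigma v) :
    Integrable fun x => lowerOrder w lam σ f x * (starRingEnd ℂ) (v x) := by
  have h1 := integrable_weakDensity (w := w) (lam := lam) (σ := σ) h hv.conj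
  have h2 : Integrable fun x => (1 / 2 : ℂ) * ∑ j, weakGradient f x j *
      weakGradient (fun x => (starRingEnd ℂ) (v x)) x j :=
    (integrable_finsetSum Finset.univ fun j _ =>
      ((MemLp.component h.memLp_weakGradient j).integrable_mul
        (MemLp.component hv.conj.memLp_weakGradient j) : Integrable fun x =>
          weakGradient f x j * weakGradient (fun x => (starRingEnd ℂ) (v x)) x j)).const_mul _
  refine (h1.sub h2).congr (ae_of_all _ fun x => ?_)
  simp [weakDensity]

/-- Symmetric second difference. -/
def secondDiff (a : R3) (f : R3 → ℂ) : R3 → ℂ :=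
  (2 : ℂ) • f - (fun x => f (x + a)) - fun x => f (x + -a)

theorem MemSigma.secondDiff (h : MemSigma f) (a : R3) : MemSigma (secondDiff a f) :=
  ((h.const_smul 2).sub (h.comp_add a)).sub (h.comp_add (-a))

theorem MemSigma.integral_mul_conj_secondDiff (h : MemSigma f) (hv : MemSigma v) (a : R3) :
    ∫ x, (f (x + a) - f x) * (starRingEnd ℂ) (v (x + a) - v x) =
      ∫ x, f x * (starRingEnd ℂ) (DampedNLS.secondDiff a v x) :=
  (integral_translate_sub_mul a (h.memLp.integrable_mul hv.conj.memLp)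
    (h.memLp.integrable_mul (hv.comp_add a).conj.memLp)
    (h.memLp.integrable_mul (hv.comp_add (-a)).conj.memLp)).2

theorem MemSigma.weakGradient_secondDiff (h : MemSigma f) (a : R3) :
    DampedNLS.weakGradient (fun x => (starRingEnd ℂ) (DampedNLS.secondDiff a f x)) =ᵐ[volume]
      fun x => conjVec ((2 : ℂ) • DampedNLS.weakGradient f x -
        DampedNLS.weakGradient f (x + a) - DampedNLS.weakGradient f (x + -a)) := by
  have h1 := ((h.isWeakGradient.const_smul 2).sub
    (h.isWeakGradient.comp_add h.memLp h.memLp_weakGradient a)).sub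
    (h.isWeakGradient.comp_add h.memLp h.memLp_weakGradient (-a))
  refine (h1.conj (h.secondDiff a).memLp ?_).weakGradient_ae_eq
  exact (memLp_congr_ae h1.weakGradient_ae_eq).1 (h.secondDiff a).memLp_weakGradient

/-- The kinetic term does not contribute to the balance of difference quotients. -/
theorem im_weakForm_secondDiff (h : MemSigma f) (a : R3) :
    Integrable (fun x => (lowerOrder w lam σ f (x + a) - lowerOrder w lam σ f x) *
      (starRingEnd ℂ) (f (x + a) - f x)) ∧
    (weakForm w lam σ f fun x => (starRingEnd ℂ) (secondDiff a f x)).im =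
      ∫ x, ((lowerOrder w lam σ f (x + a) - lowerOrder w lam σ f x) *
        (starRingEnd ℂ) (f (x + a) - f x)).im := by
  have hs := h.secondDiff a
  have mp := fun a => measurePreserving_add_right (volume : Measure R3) a
  have hc := fun j => MemLp.component h.memLp_weakGradient j
  have hN := integral_translate_sub_mul (p := lowerOrder w lam σ f) (q := f) a
    (integrable_lowerOrder_mul h h) (integrable_lowerOrder_mul h (h.comp_add a))
    (integrable_lowerOrder_mul h (h.comp_add (-a)))
  have hG := fun j => integral_translate_sub_mul (p := fun x => weakGradient f x j)
    (q := fun x => weakGradient f x j) a ((hc j).integrable_mul (hc j).star)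
    ((hc j).integrable_mul ((hc j).comp_measurePreserving (mp a)).star)
    ((hc j).integrable_mul ((hc j).comp_measurePreserving (mp (-a))).star)
  have iG : ∀ j, Integrable fun x => weakGradient f x j * (starRingEnd ℂ)
      (2 * weakGradient f x j - weakGradient f (x + a) j - weakGradient f (x + -a) j) := fun j =>
    (hc j).integrable_mul (((((hc j).const_mul 2).sub ((hc j).comp_measurePreserving (mp a))).sub
      ((hc j).comp_measurePreserving (mp (-a)))).star)
  -- Summation by parts read backwards: the kinetic pairing is the integral of |∂_j f(x + a) - ∂_j
  -- f(x)|², hence real.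
  have hreal : ∀ j, (∫ x, weakGradient f x j * (starRingEnd ℂ)
      (2 * weakGradient f x j - weakGradient f (x + a) j - weakGradient f (x + -a) j)).im = 0 :=
    fun j => by
    rw [← (hG j).2, ← Complex.imCLM_apply, ← ContinuousLinearMap.integral_comp_comm _ (hG j).1]
    refine integral_eq_zero_of_ae (ae_of_all _ fun x => ?_)
    simp only [Complex.imCLM_apply, Complex.mul_conj, Complex.ofReal_im, Pi.zero_apply]
  refine ⟨hN.1, ?_⟩
  have e : weakForm w lam σ f (fun x => (starRingEnd ℂ) (secondDiff a f x)) =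
      ((1 / 2 : ℝ) : ℂ) * ∑ j, (∫ x, weakGradient f x j * (starRingEnd ℂ)
      (2 * weakGradient f x j - weakGradient f (x + a) j - weakGradient f (x + -a) j)) +
      ∫ x, lowerOrder w lam σ f x * (starRingEnd ℂ) (secondDiff a f x) := by
    rw [← integral_finsetSum Finset.univ fun j _ => iG j, ← integral_const_mul,
      ← integral_add ((integrable_finsetSum Finset.univ fun j _ => iG j).const_mul _)
        (integrable_lowerOrder_mul h hs)]
    refine integral_congr_ae ?_
    filter_upwards [h.weakGradient_secondDiff a] with x hx
    rw [weakDensity, hx]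
    simp [conjVec]
  rw [e, Complex.add_im, Complex.im_ofReal_mul, Complex.im_sum]
  simp only [hreal, Finset.sum_const_zero, mul_zero, zero_add]
  rw [show (∫ x, lowerOrder w lam σ f x * (starRingEnd ℂ) (secondDiff a f x)) = _ from hN.2.symm,
    ← Complex.imCLM_apply, ← ContinuousLinearMap.integral_comp_comm _ hN.1]
  rfl

/-- Balance law for difference quotients. -/
theorem IsSolution.hasDerivAt_diffQuot (hu : IsSolution w lam σ T u) (h0 : 0 < t)
    (hT : (t : EReal) < T) (h : ℝ) (j : Fin 3) :
    HasDerivAt (fun s => ∫ x, 1 / 2 * ‖diffQuot h j (u s) x‖ ^ 2)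
      (∫ x, (diffQuot h j (lowerOrder w lam σ (u t)) x *
        (starRingEnd ℂ) (diffQuot h j (u t) x)).im) t := by
  have hm : MemSigma (u t) := hu.memSigma ⟨h0.le, hT⟩
  set a : R3 := EuclideanSpace.single j h with ha
  -- By summation by parts the functional c∫|f(x + a) - f(x)|² has c times the second difference as
  -- its L² gradient, in the normalization with a factor 2. The step h = 0 needs no separate
  -- treatment, since then h⁻¹ = 0 and both sides vanish.
  set c : ℝ := 1 / 2 * (h⁻¹) ^ 2 with hcd
  have hv : MemSigma (((c : ℝ) : ℂ) • secondDiff a (u t)) := (hm.secondDiff a).const_smul _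
  have hsq : ∀ f x, 1 / 2 * ‖diffQuot h j f x‖ ^ 2 =
      c * ((f (x + a) - f x) * (starRingEnd ℂ) (f (x + a) - f x)).re := fun f x => by
    rw [Complex.mul_conj, Complex.ofReal_re, Complex.normSq_eq_norm_sq, diffQuot, norm_mul,
      norm_inv, Complex.norm_real, mul_pow, inv_pow, Real.norm_eq_abs, sq_abs, hcd, inv_pow]
    ring
  have iprod : ∀ f g, MemSigma f → MemSigma g → Integrable fun x =>
      (f (x + a) - f x) * (starRingEnd ℂ) (g (x + a) - g x) := fun f g hf hg =>
    ((hf.comp_add a).sub hf).memLp.integrable_mul ((hg.comp_add a).sub hg).conj.memLp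
  have hQ : ∀ f, MemSigma f → ∫ x, 1 / 2 * ‖diffQuot h j f x‖ ^ 2 =
      c * (∫ x, (f (x + a) - f x) * (starRingEnd ℂ) (f (x + a) - f x)).re := fun f hf => by
    simp only [hsq]
    rw [integral_const_mul, ← Complex.reCLM_apply,
      ← ContinuousLinearMap.integral_comp_comm _ (iprod f f hf hf)]
    rfl
  -- The remainder is the functional itself at f - u(t). The constant 4c comes from |a - b|² ≤ 2|a|²
  -- + 2|b|² and translation invariance.
  have key := hu.hasDerivAt_functional h0 hT
    (𝓔 := fun f => ∫ x, 1 / 2 * ‖diffQuot h j f x‖ ^ 2) hv (C := 4 * c) fun f hf => ?_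
  · convert key using 1
    have e1 : (fun x => (starRingEnd ℂ) ((((c : ℝ) : ℂ) • secondDiff a (u t)) x)) =
        ((c : ℝ) : ℂ) • fun x => (starRingEnd ℂ) (secondDiff a (u t) x) := by
      ext x; simp
    obtain ⟨_, hw2⟩ := im_weakForm_secondDiff (w := w) (lam := lam) (σ := σ) hm a
    rw [e1, weakForm_smul (hm.secondDiff a).conj, Complex.im_ofReal_mul, hw2, ← integral_const_mul,
      ← integral_const_mul]
    refine integral_congr_ae (ae_of_all _ fun x => ?_)
    have e2 : diffQuot h j (lowerOrder w lam σ (u t)) x * (starRingEnd ℂ) (diffQuot h j (u t) x) =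
        ((h⁻¹ ^ 2 : ℝ) : ℂ) * ((lowerOrder w lam σ (u t) (x + a) - lowerOrder w lam σ (u t) x) *
        (starRingEnd ℂ) (u t (x + a) - u t x)) := by
      rw [diffQuot, diffQuot, map_mul, map_inv₀, Complex.conj_ofReal]
      push_cast
      ring
    simp only [e2, Complex.im_ofReal_mul, hcd]
    ring
  · have hd := hf.sub hm
    have hc0 : 0 ≤ c := by positivity
    have e1 : (∫ x, (f x - u t x) * (starRingEnd ℂ) ((((c : ℝ) : ℂ) • secondDiff a (u t)) x)) =
        c * ∫ x, ((f - u t) (x + a) - (f - u t) x) *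
          (starRingEnd ℂ) (u t (x + a) - u t x) := by
      rw [hd.integral_mul_conj_secondDiff hm a, ← integral_const_mul]
      refine integral_congr_ae (ae_of_all _ fun x => ?_)
      simp
      ring
    rw [hQ f hf, hQ _ hm, e1, Complex.re_ofReal_mul]
    have e2 : c * (∫ x, (f (x + a) - f x) * (starRingEnd ℂ) (f (x + a) - f x)).re -
        c * (∫ x, (u t (x + a) - u t x) * (starRingEnd ℂ) (u t (x + a) - u t x)).re -
        2 * (c * (∫ x, ((f - u t) (x + a) - (f - u t) x) *
          (starRingEnd ℂ) (u t (x + a) - u t x)).re) =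
        c * ∫ x, ‖(f - u t) (x + a) - (f - u t) x‖ ^ 2 := by
      have i1 := iprod f f hf hf
      have i2 := iprod _ _ hm hm
      have i3 := iprod _ _ hd hm
      have i4 : Integrable fun x => Complex.reCLM ((f (x + a) - f x) *
          (starRingEnd ℂ) (f (x + a) - f x)) - Complex.reCLM ((u t (x + a) - u t x) *
          (starRingEnd ℂ) (u t (x + a) - u t x)) :=
        (Complex.reCLM.integrable_comp i1).sub (Complex.reCLM.integrable_comp i2)
      simp only [← Complex.reCLM_apply]
      rw [← ContinuousLinearMap.integral_comp_comm _ i1,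
        ← ContinuousLinearMap.integral_comp_comm _ i2,
        ← ContinuousLinearMap.integral_comp_comm _ i3, mul_left_comm, ← mul_sub, ← mul_sub,
        ← integral_const_mul, ← integral_sub (Complex.reCLM.integrable_comp i1)
        (Complex.reCLM.integrable_comp i2), ← integral_sub i4 ((Complex.reCLM.integrable_comp i3).const_mul 2)]
      congr 1
      refine integral_congr_ae (ae_of_all _ fun x => ?_)
      have h1 := norm_sq_sub_norm_sq (f (x + a) - f x) (u t (x + a) - u t x)
      simp only [Complex.reCLM_apply, Pi.sub_apply, Complex.mul_conj, Complex.ofReal_re,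
        Complex.normSq_eq_norm_sq]
      rw [show f (x + a) - u t (x + a) - (f x - u t x) =
        f (x + a) - f x - (u t (x + a) - u t x) by ring]
      linarith
    rw [e2, abs_of_nonneg (mul_nonneg hc0 (integral_nonneg fun x => by positivity))]
    have i5 : Integrable fun x => ‖(f - u t) (x + a) - (f - u t) x‖ ^ 2 :=
      ((hd.comp_add a).sub hd).integrable_sq
    have i6 := hd.integrable_sq
    have i7 : Integrable fun x => ‖(f - u t) (x + a)‖ ^ 2 := (hd.comp_add a).integrable_sq
    calc c * ∫ x, ‖(f - u t) (x + a) - (f - u t) x‖ ^ 2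
        ≤ c * ∫ x, (2 * ‖(f - u t) (x + a)‖ ^ 2 + 2 * ‖(f - u t) x‖ ^ 2) := by
          refine mul_le_mul_of_nonneg_left (integral_mono i5
            ((i7.const_mul 2).add (i6.const_mul 2)) fun x => ?_) hc0
          have h1 := norm_sub_le ((f - u t) (x + a)) ((f - u t) x)
          have h2 := pow_le_pow_left₀ (norm_nonneg _) h1 2
          simp only
          nlinarith [sq_nonneg (‖(f - u t) (x + a)‖ - ‖(f - u t) x‖)]
      _ = 4 * c * ∫ x, ‖(f - u t) x‖ ^ 2 := by
          rw [integral_add (i7.const_mul 2) (i6.const_mul 2), integral_const_mul,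
            integral_const_mul, integral_add_right_eq_self (fun x => ‖(f - u t) x‖ ^ 2) a]
          ring
      _ = _ := rfl

end SummationByParts

/-! ### Pointwise dissipation of difference quotients -/

section Dissipation

variable {w : Fin 3 → ℝ} {lam σ : ℝ} {T : EReal} {u : ℝ → R3 → ℂ} {t : ℝ} {f : R3 → ℂ}

/-- The dissipation of a difference quotient `D` with step `h` at the value `q`. -/
def dissipation (lam σ h : ℝ) (q D : ℂ) : ℝ :=
  σ / 2 * (‖q + h * D‖ ^ 4 + ‖q‖ ^ 4) * ‖D‖ ^ 2 +
    lam * (2 * ((starRingEnd ℂ) q * D).re + h * ‖D‖ ^ 2) * ((starRingEnd ℂ) q * D).im +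
    9 * lam ^ 2 / (4 * σ) * ‖D‖ ^ 2

theorem continuous_dissipation :
    Continuous fun p : ℝ × ℂ × ℂ => dissipation lam σ p.1 p.2.1 p.2.2 := by
  unfold dissipation
  have h : Continuous fun p : ℝ × ℂ × ℂ => (starRingEnd ℂ) p.2.1 * p.2.2 :=
    (Complex.continuous_conj.comp (continuous_fst.comp continuous_snd)).mul
      (continuous_snd.comp continuous_snd)
  have h1 := Complex.continuous_re.comp h
  have h2 := Complex.continuous_im.comp h
  simp only [Function.comp_def] at h1 h2
  fun_prop

theorem norm_sq_add_real_mul (h : ℝ) (q D : ℂ) :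
    ‖q + h * D‖ ^ 2 = ‖q‖ ^ 2 + h * (2 * ((starRingEnd ℂ) q * D).re + h * ‖D‖ ^ 2) := by
  simp only [← Complex.normSq_eq_norm_sq, Complex.normSq_apply, Complex.add_re, Complex.add_im,
    Complex.mul_re, Complex.mul_im, Complex.conj_re, Complex.conj_im, Complex.ofReal_re,
    Complex.ofReal_im]
  ring

/-- With p = q + hD, the cubic term is at most |λ|(|p| + |q|)|q||D|². Since (|p| + |q|)|q| ≤ 3/2
(|p|² + |q|²), Young's inequality in |p|² and in |q|² costs 9λ²/(8σ) each time, which is exactly the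
multiple of |D|² included in the definition. -/
theorem dissipation_nonneg (hσ : 0 < σ) {h : ℝ} (hh : h ≠ 0) (q D : ℂ) :
    0 ≤ dissipation lam σ h q D := by
  have e := norm_sq_add_real_mul h q D
  set p := q + h * D with hp
  set R := 2 * ((starRingEnd ℂ) q * D).re + h * ‖D‖ ^ 2 with hR
  -- hR equals |p|² - |q|² and h|D| has size |p - q|, so dividing the difference of squares by |h|
  -- gives a bound free of h.
  have h1 : |R| ≤ ‖D‖ * (‖p‖ + ‖q‖) := by
    have hD : |h| * ‖D‖ = ‖p - q‖ := by
      rw [hp, add_sub_cancel_left, norm_mul, Complex.norm_real, Real.norm_eq_abs]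
    have h2 : |h| * |R| ≤ |h| * (‖D‖ * (‖p‖ + ‖q‖)) := by
      rw [← abs_mul, show h * R = (‖p‖ - ‖q‖) * (‖p‖ + ‖q‖) by linarith, abs_mul,
        abs_of_nonneg (a := ‖p‖ + ‖q‖) (by positivity), ← mul_assoc, hD]
      exact mul_le_mul_of_nonneg_right (abs_norm_sub_norm_le _ _) (by positivity)
    exact le_of_mul_le_mul_left h2 (abs_pos.2 hh)
  have h3 : |((starRingEnd ℂ) q * D).im| ≤ ‖q‖ * ‖D‖ := by
    refine (Complex.abs_im_le_norm _).trans (le_of_eq ?_)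
    rw [norm_mul, RCLike.norm_conj]
  have h4 : |lam * R * ((starRingEnd ℂ) q * D).im| ≤
      |lam| * (‖D‖ * (‖p‖ + ‖q‖)) * (‖q‖ * ‖D‖) := by
    rw [abs_mul, abs_mul]; gcongr
  have h5 : |lam| * ((‖p‖ + ‖q‖) * ‖q‖) ≤
      σ / 2 * (‖p‖ ^ 4 + ‖q‖ ^ 4) + 9 * lam ^ 2 / (4 * σ) := by
    have hy : ∀ y : ℝ, 3 / 2 * |lam| * y ≤ σ / 2 * y ^ 2 + 9 * lam ^ 2 / (8 * σ) := fun y => by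
      have : σ / 2 * y ^ 2 + 9 * lam ^ 2 / (8 * σ) - 3 / 2 * |lam| * y =
          (2 * σ * y - 3 * |lam|) ^ 2 / (8 * σ) := by
        rw [← sq_abs lam]; field_simp; ring
      have h6 : 0 ≤ (2 * σ * y - 3 * |lam|) ^ 2 / (8 * σ) := by positivity
      linarith
    have a1 := hy (‖p‖ ^ 2)
    have a2 := hy (‖q‖ ^ 2)
    have a3 : (‖p‖ + ‖q‖) * ‖q‖ ≤ 3 / 2 * (‖p‖ ^ 2 + ‖q‖ ^ 2) := by
      nlinarith [sq_nonneg (‖p‖ - ‖q‖), sq_nonneg ‖p‖]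
    have a4 := mul_le_mul_of_nonneg_left a3 (abs_nonneg lam)
    have a5 : 9 * lam ^ 2 / (4 * σ) = 9 * lam ^ 2 / (8 * σ) + 9 * lam ^ 2 / (8 * σ) := by
      field_simp; ring
    rw [a5]
    nlinarith
  have h6 := mul_le_mul_of_nonneg_right h5 (sq_nonneg ‖D‖)
  have h7 := neg_abs_le (lam * R * ((starRingEnd ℂ) q * D).im)
  rw [dissipation, ← hR]
  nlinarith

/-- V is quadratic, so its difference quotient is exactly the derivative at the midpoint, w_j²(x_j +
h/2). -/
theorem confinement_add_single (w : Fin 3 → ℝ) (x : R3) (j : Fin 3) (h : ℝ) :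
    confinement w (x + EuclideanSpace.single j h) =
      confinement w x + h * (w j ^ 2 * (x j + h / 2)) := by
  have : ∀ i, w i ^ 2 * (x + EuclideanSpace.single j h) i ^ 2 = w i ^ 2 * x i ^ 2 +
      if i = j then 2 * (h * (w j ^ 2 * (x j + h / 2))) else 0 := fun i => by
    rcases eq_or_ne i j with rfl | hij
    · simp; ring
    · simp [hij]
  unfold confinement
  simp only [this, Finset.sum_add_distrib, Finset.sum_ite_eq', Finset.mem_univ, if_true]
  ring

/-- Pointwise dissipation estimate for difference quotients. -/
theorem im_diffQuot_lowerOrder_le (hσ : 0 < σ) {h : ℝ} (hh : h ≠ 0) (j : Fin 3) (x : R3) :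
    dissipation lam σ h (f x) (diffQuot h j f x) ≤
      w j ^ 2 * (x j + h / 2) * (f x * (starRingEnd ℂ) (diffQuot h j f x)).im +
      9 * lam ^ 2 / (4 * σ) * ‖diffQuot h j f x‖ ^ 2 -
      (diffQuot h j (lowerOrder w lam σ f) x * (starRingEnd ℂ) (diffQuot h j f x)).im := by
  set q := f x with hq
  set D := diffQuot h j f x with hD
  have hp : f (x + EuclideanSpace.single j h) = q + h * D := by
    have : (h : ℂ) ≠ 0 := by exact_mod_cast hh
    rw [hD, diffQuot]; field_simp; rw [hq]; ring
  have e := norm_sq_add_real_mul h q D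
  set p := q + h * D with hpd
  set R := 2 * ((starRingEnd ℂ) q * D).re + h * ‖D‖ ^ 2 with hR
  have hN : (diffQuot h j (lowerOrder w lam σ f) x * (starRingEnd ℂ) D).im =
      w j ^ 2 * (x j + h / 2) * (q * (starRingEnd ℂ) D).im -
      lam * R * ((starRingEnd ℂ) q * D).im -
      σ * h⁻¹ * ((‖p‖ ^ 4 : ℝ) * p * (starRingEnd ℂ) D - (‖q‖ ^ 4 : ℝ) * q *
        (starRingEnd ℂ) D).re := by
    have e1 : diffQuot h j (lowerOrder w lam σ f) x * (starRingEnd ℂ) D =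
        ((confinement w x + h * (w j ^ 2 * (x j + h / 2)) : ℝ) : ℂ) * (D * (starRingEnd ℂ) D) +
        ((w j ^ 2 * (x j + h / 2) : ℝ) : ℂ) * (q * (starRingEnd ℂ) D) +
        ((lam * ‖p‖ ^ 2 : ℝ) : ℂ) * (D * (starRingEnd ℂ) D) +
        ((lam * R : ℝ) : ℂ) * (q * (starRingEnd ℂ) D) -
        Complex.I * (((σ * h⁻¹ : ℝ) : ℂ) * ((‖p‖ ^ 4 : ℝ) * p * (starRingEnd ℂ) D -
          (‖q‖ ^ 4 : ℝ) * q * (starRingEnd ℂ) D)) := by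
      have hc : (h : ℂ) ≠ 0 := by exact_mod_cast hh
      have e2 : ((‖p‖ : ℂ)) ^ 2 = (‖q‖ : ℂ) ^ 2 + h * R := by exact_mod_cast e
      rw [diffQuot, lowerOrder, lowerOrder, hp, confinement_add_single, ← hq]
      push_cast
      field_simp
      rw [e2, hpd]
      ring
    rw [e1]
    simp only [Complex.add_im, Complex.sub_im, Complex.im_ofReal_mul, Complex.I_mul_im,
      Complex.re_ofReal_mul, Complex.mul_conj, Complex.ofReal_im]
    have e3 : (q * (starRingEnd ℂ) D).im = -((starRingEnd ℂ) q * D).im := by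
      simp [Complex.mul_im]; ring
    rw [e3]
    ring
  -- The discrete monotonicity of z ↦ |z|⁴z: the quotient splits into the weighted square of D kept
  -- in `dissipation` and a square containing R, the discrete derivative of |f|².
  have hS : h⁻¹ * ((‖p‖ ^ 4 : ℝ) * p * (starRingEnd ℂ) D - (‖q‖ ^ 4 : ℝ) * q *
        (starRingEnd ℂ) D).re = 1 / 2 * (‖p‖ ^ 4 + ‖q‖ ^ 4) * ‖D‖ ^ 2 +
        1 / 2 * (‖p‖ ^ 2 + ‖q‖ ^ 2) * R ^ 2 := by
    have a1 : (q * (starRingEnd ℂ) D).re = ((starRingEnd ℂ) q * D).re := by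
      simp [Complex.mul_re]
    have a2 : (p * (starRingEnd ℂ) D).re = ((starRingEnd ℂ) q * D).re + h * ‖D‖ ^ 2 := by
      rw [hpd, add_mul, Complex.add_re, a1, mul_assoc, Complex.re_ofReal_mul, Complex.mul_conj,
        Complex.ofReal_re, Complex.normSq_eq_norm_sq]
    rw [Complex.sub_re, mul_assoc, mul_assoc, Complex.re_ofReal_mul, Complex.re_ofReal_mul, a1, a2]
    have a3 : ((starRingEnd ℂ) q * D).re = (R - h * ‖D‖ ^ 2) / 2 := by rw [hR]; ring
    rw [a3, show ‖p‖ ^ 4 = (‖p‖ ^ 2) ^ 2 by ring, e]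
    field_simp
    ring
  rw [hN, dissipation, ← hR, ← hpd, mul_assoc σ, hS]
  -- The second square in `hS` is nonnegative and is discarded; this is the only loss in the
  -- estimate.
  have : 0 ≤ σ * (1 / 2 * (‖p‖ ^ 2 + ‖q‖ ^ 2) * R ^ 2) := by positivity
  nlinarith

/-- A liminf below A would produce a subsequence staying below some c < A. The criterion is needed
because L² convergence of difference quotients gives almost everywhere convergence only along
subsequences. -/
theorem le_liminf_of_subseq {A : ENNReal} {b : ℕ → ENNReal}
    (h : ∀ φ : ℕ → ℕ, StrictMono φ → ∃ ψ : ℕ → ℕ, StrictMono ψ ∧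
      A ≤ liminf (fun n => b (φ (ψ n))) atTop) : A ≤ liminf b atTop := by
  by_contra! hlt
  obtain ⟨c, hc1, hc2⟩ := exists_between hlt
  obtain ⟨φ, hφ, hb⟩ := extraction_of_frequently_atTop (frequently_lt_of_liminf_lt (by isBoundedDefault) hc1)
  obtain ⟨ψ, -, hA⟩ := h φ hφ
  have h1 : liminf (fun n => b (φ (ψ n))) atTop ≤ liminf (fun _ : ℕ => c) atTop :=
    liminf_le_liminf (Eventually.of_forall fun n => (hb (ψ n)).le)
  rw [liminf_const] at h1
  exact absurd (hA.trans h1) (not_le.2 hc2)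

theorem tendsto_integral_mul_conj {F G : ℕ → R3 → ℂ} {f g : R3 → ℂ}
    (hF : ∀ n, MemLp (F n) 2 volume) (hf : MemLp f 2 volume)
    (hG : ∀ n, MemLp (G n) 2 volume) (hg : MemLp g 2 volume)
    (hFf : Tendsto (fun n => eLpNorm (F n - f) 2 volume) atTop (𝓝 0))
    (hGg : Tendsto (fun n => eLpNorm (G n - g) 2 volume) atTop (𝓝 0)) :
    Tendsto (fun n => ∫ x, F n x * (starRingEnd ℂ) (G n x)) atTop
      (𝓝 (∫ x, f x * (starRingEnd ℂ) (g x))) := by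
  have e : ∀ (a b : R3 → ℂ) (ha : MemLp a 2 volume) (hb : MemLp b 2 volume),
      inner ℂ (hb.toLp b) (ha.toLp a) = ∫ x, a x * (starRingEnd ℂ) (b x) := fun a b ha hb => by
    rw [L2.inner_def]
    refine integral_congr_ae ?_
    filter_upwards [ha.coeFn_toLp, hb.coeFn_toLp] with x h1 h2
    rw [h1, h2]
    rfl
  have h1 := (Lp.tendsto_Lp_iff_tendsto_eLpNorm'' F hF f hf).2 hFf
  have h2 := (Lp.tendsto_Lp_iff_tendsto_eLpNorm'' G hG g hg).2 hGg
  have := h2.inner (𝕜 := ℂ) h1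
  simpa only [e] using this

theorem MemSigma.memLp_diffQuot (hf : MemSigma f) (h : ℝ) (j : Fin 3) :
    MemLp (diffQuot h j f) 2 volume :=
  ((hf.comp_add _).memLp.sub hf.memLp).const_mul _

/-- The factor 3 is crude: the translation error of the derivative is bounded by twice its norm, and
one more norm comes from the triangle inequality. Only uniformity in h matters. -/
theorem MemSigma.eLpNorm_diffQuot_le (hf : MemSigma f) {h : ℝ} (hh : h ≠ 0) (j : Fin 3) :
    eLpNorm (diffQuot h j f) 2 volume ≤
      3 * eLpNorm (fun x => DampedNLS.weakGradient f x j) 2 volume := by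
  have hc := MemLp.component hf.memLp_weakGradient j
  have mp := fun a => measurePreserving_add_right (volume : Measure R3) a
  have h1 := hf.eLpNorm_diffQuot_sub_le hh j
    (ε := 2 * eLpNorm (fun x => DampedNLS.weakGradient f x j) 2 volume) fun s _ => by
    refine (eLpNorm_sub_le (hc.1.comp_measurePreserving (mp (EuclideanSpace.single j s))) hc.1
      one_le_two).trans ?_
    rw [eLpNorm_comp_measurePreserving hc.1 (mp (EuclideanSpace.single j s)), two_mul]
  have e : diffQuot h j f = (fun x => diffQuot h j f x - DampedNLS.weakGradient f x j) +
      fun x => DampedNLS.weakGradient f x j := by ext x; simp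
  rw [e]
  refine (eLpNorm_add_le ((hf.memLp_diffQuot h j).1.sub hc.1) hc.1 one_le_two).trans ?_
  refine (add_le_add h1 le_rfl).trans (le_of_eq (by ring))

theorem integral_sq_eq_toReal {E : Type*} [NormedAddCommGroup E] {F : R3 → E}
    (hF : MemLp F 2 volume) :
    ∫ x, ‖F x‖ ^ 2 = (eLpNorm F 2 volume).toReal ^ 2 := by
  rw [← ENNReal.toReal_pow, eLpNorm_two_sq, integral_eq_lintegral_of_nonneg_ae
    (f := fun x => ‖F x‖ ^ 2) (ae_of_all _ fun x => by positivity) (hF.1.norm.pow 2)]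
  congr 1
  refine lintegral_congr fun x => ?_
  rw [ENNReal.ofReal_pow (norm_nonneg _), ofReal_norm]

theorem MemSigma.integral_diffQuot_sq_le (hf : MemSigma f) {h : ℝ} (hh : h ≠ 0) (j : Fin 3) :
    ∫ x, ‖diffQuot h j f x‖ ^ 2 ≤ 9 * ∫ x, jetWeight (jet 0 f x) := by
  have hc := MemLp.component hf.memLp_weakGradient j
  have h1 := ENNReal.toReal_mono (ENNReal.mul_lt_top (by simp) hc.2).ne (hf.eLpNorm_diffQuot_le hh j)
  rw [ENNReal.toReal_mul, ENNReal.toReal_ofNat] at h1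
  calc ∫ x, ‖diffQuot h j f x‖ ^ 2 ≤ 9 * ∫ x, ‖DampedNLS.weakGradient f x j‖ ^ 2 := by
        rw [integral_sq_eq_toReal (hf.memLp_diffQuot h j), integral_sq_eq_toReal hc]
        nlinarith [pow_le_pow_left₀ ENNReal.toReal_nonneg h1 2]
    _ ≤ _ := by
        refine mul_le_mul_of_nonneg_left (integral_mono ((memLp_two_iff_integrable_sq_norm hc.1).1 hc)
          (integrable_jetWeight hf 0) fun x => ?_) (by norm_num)
        have h2 := pow_le_pow_left₀ (norm_nonneg _)
          (PiLp.norm_apply_le (DampedNLS.weakGradient f x) j) 2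
        refine h2.trans ?_
        simp only [jetWeight, jet]
        have : 0 ≤ (1 + ‖x‖ ^ 2) * (‖f x‖ ^ 2 + ‖f (x + 0)‖ ^ 2) + ‖f x‖ ^ 6 + ‖f (x + 0)‖ ^ 6 := by
          positivity
        linarith

end Dissipation

/-! ### The kinetic energy inequality -/

section KineticBalance

variable {w : Fin 3 → ℝ} {lam σ : ℝ} {T : EReal} {u : ℝ → R3 → ℂ} {t : ℝ} {f : R3 → ℂ}

theorem JetAdmissible.continuousOn {E : Type*} [NormedAddCommGroup E] [NormedSpace ℝ E]
    {Ψ : Jet → E} (hΨ : JetAdmissible Ψ) (a : R3) (hu : ContinuousInSigma T u) :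
    ContinuousOn (fun s => ∫ x, Ψ (jet a (u s) x)) (timeInterval T) := fun t₀ ht₀ =>
  hΨ.tendsto_integral a (hu.mem t₀ ht₀) (eventually_mem_nhdsWithin.mono hu.mem) (hu.cont t₀ ht₀)

theorem Icc_subset_timeInterval (ht : t ∈ timeInterval T) : Set.Icc 0 t ⊆ timeInterval T :=
  fun _ hs => ⟨hs.1, (EReal.coe_le_coe_iff.2 hs.2).trans_lt ht.2⟩

/-- The flux of the potential plus the defect `C |D|²`, for the difference quotient `D`. -/
def flux (w : Fin 3 → ℝ) (C h : ℝ) (j : Fin 3) (x : R3) (q D : ℂ) : ℝ :=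
  w j ^ 2 * (x j + h / 2) * (q * (starRingEnd ℂ) D).im + C * ‖D‖ ^ 2

theorem abs_flux_le {C : ℝ} (hC : 0 ≤ C) (h : ℝ) (j : Fin 3) (x : R3) (q D : ℂ) :
    |flux w C h j x q D| ≤ w j ^ 2 * (1 + h ^ 2) * ((1 + ‖x‖ ^ 2) * ‖q‖ ^ 2) +
      (w j ^ 2 + C) * ‖D‖ ^ 2 := by
  have h1 : |x j + h / 2| ≤ ‖x‖ + |h| := by
    refine (abs_add_le _ _).trans (add_le_add (PiLp.norm_apply_le x j) ?_)
    rw [abs_div, abs_two]; linarith [abs_nonneg h]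
  have h2 : |(q * (starRingEnd ℂ) D).im| ≤ ‖q‖ * ‖D‖ := by
    refine (Complex.abs_im_le_norm _).trans (le_of_eq ?_)
    rw [norm_mul, RCLike.norm_conj]
  have h3 : (‖x‖ + |h|) * (‖q‖ * ‖D‖) ≤
      (1 + h ^ 2) * ((1 + ‖x‖ ^ 2) * ‖q‖ ^ 2) + ‖D‖ ^ 2 := by
    have a1 : (‖x‖ + |h|) ^ 2 ≤ 2 * ((1 + h ^ 2) * (1 + ‖x‖ ^ 2)) := by
      have := sq_abs h
      nlinarith [sq_nonneg (‖x‖ - |h|), sq_nonneg (‖x‖ * |h|)]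
    have a2 := mul_le_mul_of_nonneg_right a1 (sq_nonneg ‖q‖)
    nlinarith [sq_nonneg ((‖x‖ + |h|) * ‖q‖ - ‖D‖), sq_nonneg ‖D‖]
  unfold flux
  refine (abs_add_le _ _).trans ?_
  rw [abs_mul, abs_mul, abs_of_nonneg (sq_nonneg (w j)), abs_of_nonneg (by positivity : 0 ≤ C * ‖D‖ ^ 2)]
  have h4 : |x j + h / 2| * |(q * (starRingEnd ℂ) D).im| ≤ (‖x‖ + |h|) * (‖q‖ * ‖D‖) := by gcongr
  have h5 := mul_le_mul_of_nonneg_left (h4.trans h3) (sq_nonneg (w j))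
  linarith

theorem continuous_flux (w : Fin 3 → ℝ) (C h : ℝ) (j : Fin 3) :
    Continuous fun p : R3 × ℂ × ℂ => flux w C h j p.1 p.2.1 p.2.2 := by
  unfold flux
  have h1 := Complex.continuous_im.comp ((continuous_fst.comp continuous_snd).mul
    (Complex.continuous_conj.comp (continuous_snd.comp continuous_snd)) :
    Continuous fun p : R3 × ℂ × ℂ => p.2.1 * (starRingEnd ℂ) p.2.2)
  simp only [Function.comp_def] at h1
  fun_prop

theorem quot_sq_le_jetWeight (h : ℝ) (q : Jet) :
    ‖(h : ℂ)⁻¹ * (q.2.2.1 - q.2.1)‖ ^ 2 ≤ 2 * h⁻¹ ^ 2 * jetWeight q := by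
  rw [norm_mul, norm_inv, Complex.norm_real, mul_pow, inv_pow, Real.norm_eq_abs, sq_abs]
  have h1 : ‖q.2.2.1 - q.2.1‖ ^ 2 ≤ 2 * jetWeight q := by
    have := pow_le_pow_left₀ (norm_nonneg _) (norm_sub_le q.2.2.1 q.2.1) 2
    have n : 0 ≤ ‖q.1‖ ^ 2 * (‖q.2.1‖ ^ 2 + ‖q.2.2.1‖ ^ 2) + ‖q.2.2.2‖ ^ 2 + ‖q.2.1‖ ^ 6 +
      ‖q.2.2.1‖ ^ 6 := by positivity
    unfold jetWeight
    nlinarith [sq_nonneg (‖q.2.2.1‖ - ‖q.2.1‖)]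
  calc _ ≤ (h ^ 2)⁻¹ * (2 * jetWeight q) := by gcongr
    _ = _ := by rw [inv_pow]; ring

theorem weight_sq_le_jetWeight (q : Jet) : (1 + ‖q.1‖ ^ 2) * ‖q.2.1‖ ^ 2 ≤ jetWeight q := by
  have n : 0 ≤ (1 + ‖q.1‖ ^ 2) * ‖q.2.2.1‖ ^ 2 + ‖q.2.2.2‖ ^ 2 + ‖q.2.1‖ ^ 6 +
      ‖q.2.2.1‖ ^ 6 := by positivity
  unfold jetWeight
  linarith

theorem component_sq_le_jetWeight (q : Jet) (j : Fin 3) : ‖q.2.2.2 j‖ ^ 2 ≤ jetWeight q := by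
  have h := pow_le_pow_left₀ (norm_nonneg _) (PiLp.norm_apply_le q.2.2.2 j) 2
  have n : 0 ≤ (1 + ‖q.1‖ ^ 2) * (‖q.2.1‖ ^ 2 + ‖q.2.2.1‖ ^ 2) + ‖q.2.1‖ ^ 6 +
      ‖q.2.2.1‖ ^ 6 := by positivity
  unfold jetWeight
  linarith

theorem jetAdmissible_quot (h : ℝ) :
    JetAdmissible fun q : Jet => 1 / 2 * ‖(h : ℂ)⁻¹ * (q.2.2.1 - q.2.1)‖ ^ 2 := by
  refine .of_le (by fun_prop) (h⁻¹ ^ 2) (by positivity) fun q => ?_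
  rw [Real.norm_of_nonneg (by positivity)]
  linarith [quot_sq_le_jetWeight h q]

theorem jetAdmissible_flux_quot (w : Fin 3 → ℝ) {C : ℝ} (hC : 0 ≤ C) (h : ℝ) (j : Fin 3) :
    JetAdmissible fun q : Jet => flux w C h j q.1 q.2.1 ((h : ℂ)⁻¹ * (q.2.2.1 - q.2.1)) := by
  refine .of_le ?_ (w j ^ 2 * (1 + h ^ 2) + (w j ^ 2 + C) * (2 * h⁻¹ ^ 2)) (by positivity)
    fun q => ?_
  · exact (continuous_flux w C h j).comp (by fun_prop :
      Continuous fun q : Jet => (q.1, q.2.1, (h : ℂ)⁻¹ * (q.2.2.1 - q.2.1)))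
  · refine (abs_flux_le hC h j _ _ _).trans ?_
    have h1 := quot_sq_le_jetWeight h q
    have h2 := weight_sq_le_jetWeight q
    calc _ ≤ w j ^ 2 * (1 + h ^ 2) * jetWeight q + (w j ^ 2 + C) * (2 * h⁻¹ ^ 2 * jetWeight q) := by
          gcongr
      _ = _ := by ring

theorem jetAdmissible_flux (w : Fin 3 → ℝ) {C : ℝ} (hC : 0 ≤ C) (j : Fin 3) :
    JetAdmissible fun q : Jet => flux w C 0 j q.1 q.2.1 (q.2.2.2 j) := by
  refine .of_le ?_ (w j ^ 2 + (w j ^ 2 + C)) (by positivity) fun q => ?_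
  · exact (continuous_flux w C 0 j).comp (by fun_prop :
      Continuous fun q : Jet => (q.1, q.2.1, q.2.2.2 j))
  · refine (abs_flux_le hC 0 j _ _ _).trans ?_
    have h1 := component_sq_le_jetWeight q j
    have h2 := weight_sq_le_jetWeight q
    calc _ ≤ w j ^ 2 * (1 + 0 ^ 2) * jetWeight q + (w j ^ 2 + C) * jetWeight q := by
          gcongr
      _ = _ := by ring

theorem MemSigma.integrable_flux_diffQuot (hf : MemSigma f) {C : ℝ} (hC : 0 ≤ C) (h : ℝ)
    (j : Fin 3) : Integrable fun x => flux w C h j x (f x) (diffQuot h j f x) :=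
  (jetAdmissible_flux_quot w hC h j).integrable hf (EuclideanSpace.single j h)

/-- The bound is uniform for 0 < |h| ≤ 1 and continuous along the flow, so it dominates the time
integrals of the flux as h → 0. The 9 is the square of the factor 3 in
`MemSigma.eLpNorm_diffQuot_le`. -/
theorem MemSigma.abs_integral_flux_diffQuot_le (hf : MemSigma f) {C : ℝ} (hC : 0 ≤ C) {h : ℝ}
    (hh : h ≠ 0) (hh1 : |h| ≤ 1) (j : Fin 3) :
    |∫ x, flux w C h j x (f x) (diffQuot h j f x)| ≤
      (2 * w j ^ 2 + 9 * (w j ^ 2 + C)) * ∫ x, jetWeight (jet 0 f x) := by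
  have i1 := integrable_jetWeight hf 0
  have i2 : Integrable fun x => ‖diffQuot h j f x‖ ^ 2 :=
    (memLp_two_iff_integrable_sq_norm (hf.memLp_diffQuot h j).1).1 (hf.memLp_diffQuot h j)
  have hh2 : h ^ 2 ≤ 1 := by rw [← sq_abs]; exact pow_le_one₀ (abs_nonneg h) hh1
  rw [← Real.norm_eq_abs]
  refine (norm_integral_le_of_norm_le (g := fun x => 2 * w j ^ 2 * jetWeight (jet 0 f x) +
    (w j ^ 2 + C) * ‖diffQuot h j f x‖ ^ 2) ((i1.const_mul _).add (i2.const_mul _))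
    (ae_of_all _ fun x => ?_)).trans ?_
  · refine (abs_flux_le hC h j _ _ _).trans ?_
    have h2 := weight_sq_le_jetWeight (jet 0 f x)
    have h3 : w j ^ 2 * (1 + h ^ 2) * ((1 + ‖x‖ ^ 2) * ‖f x‖ ^ 2) ≤
        w j ^ 2 * (1 + 1) * jetWeight (jet 0 f x) := by
      gcongr
      exact h2
    linarith
  · rw [integral_add (i1.const_mul _) (i2.const_mul _), integral_const_mul, integral_const_mul]
    have := mul_le_mul_of_nonneg_left (hf.integral_diffQuot_sq_le hh j)
      (by positivity : 0 ≤ w j ^ 2 + C)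
    linarith

theorem MemSigma.memLp_coord_mul (hf : MemSigma f) (j : Fin 3) :
    MemLp (fun x : R3 => (x j : ℂ) * f x) 2 volume := by
  refine hf.moment.of_le ?_ (ae_of_all _ fun x => ?_)
  · exact (by fun_prop : Continuous fun x : R3 => (x j : ℂ)).aestronglyMeasurable.mul hf.memLp.1
  · rw [norm_mul, Complex.norm_real, norm_smul, norm_norm]
    exact mul_le_mul_of_nonneg_right (PiLp.norm_apply_le x j) (norm_nonneg _)

/-- Written as L² inner products, the flux converges as h → 0 simply because the inner product is
continuous; the coordinate x_j is attached to f, where the moment controls it. -/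
theorem MemSigma.integral_flux_eq (hf : MemSigma f) {D : R3 → ℂ} (hD : MemLp D 2 volume)
    (C h : ℝ) (j : Fin 3) :
    ∫ x, flux w C h j x (f x) (D x) =
      w j ^ 2 * (∫ x, (x j : ℂ) * f x * (starRingEnd ℂ) (D x)).im +
      h * (w j ^ 2 / 2 * (∫ x, f x * (starRingEnd ℂ) (D x)).im) +
      C * (∫ x, D x * (starRingEnd ℂ) (D x)).re := by
  have i1 : Integrable fun x => (x j : ℂ) * f x * (starRingEnd ℂ) (D x) :=
    (hf.memLp_coord_mul j).integrable_mul hD.star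
  have i2 : Integrable fun x => f x * (starRingEnd ℂ) (D x) := hf.memLp.integrable_mul hD.star
  have i3 : Integrable fun x => D x * (starRingEnd ℂ) (D x) := hD.integrable_mul hD.star
  have c1 := (Complex.imCLM.integrable_comp i1).const_mul (w j ^ 2)
  have c2 := (Complex.imCLM.integrable_comp i2).const_mul (h * (w j ^ 2 / 2))
  have c3 := (Complex.reCLM.integrable_comp i3).const_mul C
  have c12 : Integrable fun x => w j ^ 2 * Complex.imCLM ((x j : ℂ) * f x * (starRingEnd ℂ) (D x)) +
    h * (w j ^ 2 / 2) * Complex.imCLM (f x * (starRingEnd ℂ) (D x)) := c1.add c2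
  rw [← mul_assoc h]
  simp only [← Complex.imCLM_apply, ← Complex.reCLM_apply]
  rw [← ContinuousLinearMap.integral_comp_comm _ i1, ← ContinuousLinearMap.integral_comp_comm _ i2,
    ← ContinuousLinearMap.integral_comp_comm _ i3, ← integral_const_mul, ← integral_const_mul,
    ← integral_const_mul, ← integral_add c1 c2, ← integral_add c12 c3]
  refine integral_congr_ae (ae_of_all _ fun x => ?_)
  simp only [flux, Complex.imCLM_apply, Complex.reCLM_apply, mul_assoc, Complex.im_ofReal_mul,
    Complex.mul_conj, Complex.ofReal_re, Complex.normSq_eq_norm_sq]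
  ring

theorem MemSigma.tendsto_integral_flux (hf : MemSigma f) (C : ℝ) (j : Fin 3) {h : ℕ → ℝ}
    (hh : Tendsto h atTop (𝓝[≠] 0)) :
    Tendsto (fun n => ∫ x, flux w C (h n) j x (f x) (diffQuot (h n) j f x)) atTop
      (𝓝 (∫ x, flux w C 0 j x (f x) (DampedNLS.weakGradient f x j))) ∧
    Tendsto (fun n => ∫ x, 1 / 2 * ‖diffQuot (h n) j f x‖ ^ 2) atTop
      (𝓝 (∫ x, 1 / 2 * ‖DampedNLS.weakGradient f x j‖ ^ 2)) := by
  have hc := MemLp.component hf.memLp_weakGradient j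
  have hD : Tendsto (fun n => eLpNorm (diffQuot (h n) j f -
      fun x => DampedNLS.weakGradient f x j) 2 volume) atTop (𝓝 0) :=
    (hf.tendsto_diffQuot j).comp hh
  have hz : ∀ g : R3 → ℂ, Tendsto (fun _ : ℕ => eLpNorm (g - g) 2 volume) atTop (𝓝 0) := fun g => by
    simp
  have t1 := tendsto_integral_mul_conj (fun _ => hf.memLp_coord_mul j) (hf.memLp_coord_mul j)
    (fun n => hf.memLp_diffQuot (h n) j) hc (hz _) hD
  have t2 := tendsto_integral_mul_conj (fun _ => hf.memLp) hf.memLp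
    (fun n => hf.memLp_diffQuot (h n) j) hc (hz _) hD
  have t3 := tendsto_integral_mul_conj (fun n => hf.memLp_diffQuot (h n) j) hc
    (fun n => hf.memLp_diffQuot (h n) j) hc hD hD
  have t0 := hh.mono_right nhdsWithin_le_nhds
  have key := (((Complex.continuous_im.tendsto _).comp t1).const_mul (w j ^ 2)).add
    (t0.mul (((Complex.continuous_im.tendsto _).comp t2).const_mul (w j ^ 2 / 2)))
  have key3 := (Complex.continuous_re.tendsto _).comp t3
  have key' := key.add (key3.const_mul C)
  refine ⟨?_, ?_⟩
  · simp only [hf.integral_flux_eq (hf.memLp_diffQuot _ j)]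
    rw [hf.integral_flux_eq hc]
    exact key'
  · have e : ∀ g : R3 → ℂ, MemLp g 2 volume → ∫ x, 1 / 2 * ‖g x‖ ^ 2 =
        1 / 2 * (∫ x, g x * (starRingEnd ℂ) (g x)).re := fun g hg => by
      have i : Integrable (fun x => g x * (starRingEnd ℂ) (g x)) volume :=
        hg.integrable_mul hg.star
      rw [← Complex.reCLM_apply, ← ContinuousLinearMap.integral_comp_comm _ i,
        ← integral_const_mul]
      refine integral_congr_ae (ae_of_all _ fun x => ?_)
      simp only [Complex.reCLM_apply, Complex.mul_conj, Complex.ofReal_re,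
        Complex.normSq_eq_norm_sq]
    simp only [e _ (hf.memLp_diffQuot _ j)]
    rw [e _ hc]
    exact key3.const_mul _

theorem MemSigma.integrable_im_diffQuot_lowerOrder (hf : MemSigma f) (h : ℝ) (j : Fin 3) :
    Integrable fun x => (diffQuot h j (lowerOrder w lam σ f) x *
      (starRingEnd ℂ) (diffQuot h j f x)).im := by
  have h1 := (im_weakForm_secondDiff (w := w) (lam := lam) (σ := σ) hf
    (EuclideanSpace.single j h)).1.const_mul ((h⁻¹ ^ 2 : ℝ) : ℂ)
  refine (Complex.imCLM.integrable_comp h1).congr (ae_of_all _ fun x => ?_)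
  simp only [Complex.imCLM_apply]
  rw [diffQuot, diffQuot, map_mul, map_inv₀, Complex.conj_ofReal]
  congr 1
  push_cast
  ring

/-- Fatou's lemma for the dissipation of difference quotients. -/
theorem MemSigma.lintegral_dissipation_le (hf : MemSigma f) (hσ : 0 < σ) (j : Fin 3) {h : ℕ → ℝ}
    (hh : Tendsto h atTop (𝓝[≠] 0)) (hne : ∀ n, h n ≠ 0) :
    ∫⁻ x, ENNReal.ofReal (dissipation lam σ 0 (f x) (DampedNLS.weakGradient f x j)) ≤
    liminf (fun n => ENNReal.ofReal (
      (∫ x, flux w (9 * lam ^ 2 / (4 * σ)) (h n) j x (f x) (diffQuot (h n) j f x)) -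
      ∫ x, (diffQuot (h n) j (lowerOrder w lam σ f) x *
        (starRingEnd ℂ) (diffQuot (h n) j f x)).im)) atTop := by
  have hc := MemLp.component hf.memLp_weakGradient j
  have hD : Tendsto (fun n => eLpNorm (diffQuot (h n) j f -
      fun x => DampedNLS.weakGradient f x j) 2 volume) atTop (𝓝 0) :=
    (hf.tendsto_diffQuot j).comp hh
  have hm : ∀ n, AEMeasurable (fun x => ENNReal.ofReal (dissipation lam σ (h n) (f x)
      (diffQuot (h n) j f x))) volume := fun n =>
    ((continuous_dissipation (lam := lam) (σ := σ)).comp_aestronglyMeasurable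
      (aestronglyMeasurable_const.prodMk
        (hf.memLp.1.prodMk (hf.memLp_diffQuot (h n) j).1))).aemeasurable.ennreal_ofReal
  have hle : ∀ n, ∫⁻ x, ENNReal.ofReal (dissipation lam σ (h n) (f x) (diffQuot (h n) j f x)) ≤
      ENNReal.ofReal (
      (∫ x, flux w (9 * lam ^ 2 / (4 * σ)) (h n) j x (f x) (diffQuot (h n) j f x)) -
      ∫ x, (diffQuot (h n) j (lowerOrder w lam σ f) x *
        (starRingEnd ℂ) (diffQuot (h n) j f x)).im) := fun n => by
    have i1 := hf.integrable_flux_diffQuot (w := w) (by positivity : 0 ≤ 9 * lam ^ 2 / (4 * σ))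
      (h n) j
    have i2 := hf.integrable_im_diffQuot_lowerOrder (w := w) (lam := lam) (σ := σ) (h n) j
    have hp : ∀ x, _ := fun x =>
      im_diffQuot_lowerOrder_le (w := w) (lam := lam) (f := f) hσ (hne n) j x
    have i3 : Integrable fun x => flux w (9 * lam ^ 2 / (4 * σ)) (h n) j x (f x)
        (diffQuot (h n) j f x) - (diffQuot (h n) j (lowerOrder w lam σ f) x *
          (starRingEnd ℂ) (diffQuot (h n) j f x)).im := i1.sub i2
    rw [← integral_sub i1 i2, ofReal_integral_eq_lintegral_ofReal i3
      (ae_of_all _ fun x => (dissipation_nonneg hσ (hne n) _ _).trans (hp x))]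
    exact lintegral_mono fun x => ENNReal.ofReal_le_ofReal (hp x)
  -- Along an almost everywhere convergent subsequence, continuity of `dissipation` in (h, q, D)
  -- identifies the limit, and its nonnegative truncation makes Fatou's lemma applicable in x.
  refine le_liminf_of_subseq fun φ hφ => ?_
  obtain ⟨ψ, hψ, hae⟩ := exists_subseq_tendsto_ae
    (fun n => (hf.memLp_diffQuot (h (φ n)) j).1) hc.1 (hD.comp hφ.tendsto_atTop)
  refine ⟨ψ, hψ, ?_⟩
  refine le_trans ?_ (liminf_le_liminf (Eventually.of_forall fun n => hle (φ (ψ n))))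
  refine le_trans (le_of_eq (lintegral_congr_ae ?_)) (lintegral_liminf_le' fun n => hm (φ (ψ n)))
  filter_upwards [hae] with x hx
  have h0 : Tendsto (fun n => h (φ (ψ n))) atTop (𝓝 0) :=
    (hh.mono_right nhdsWithin_le_nhds).comp (hφ.tendsto_atTop.comp hψ.tendsto_atTop)
  have := ((continuous_dissipation (lam := lam) (σ := σ)).tendsto
    (0, f x, DampedNLS.weakGradient f x j)).comp (h0.prodMk_nhds (tendsto_const_nhds.prodMk_nhds hx))
  exact (ENNReal.tendsto_ofReal this).liminf_eq.symm

/-- The kinetic energy balance in direction `j`, with the dissipation bounded from below. -/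
theorem IsSolution.exists_lintegral_dissipation_le (hu : IsSolution w lam σ T u) (hσ : 0 < σ)
    (ht : t ∈ timeInterval T) (j : Fin 3) :
    ∃ Φ : ℝ → ENNReal, AEMeasurable Φ (volume.restrict (Set.Ioo 0 t)) ∧
      (∀ s ∈ Set.Ioo 0 t, ∫⁻ x, ENNReal.ofReal (dissipation lam σ 0 (u s x)
        (weakGradient (u s) x j)) ≤ Φ s) ∧
      0 ≤ (∫ x, 1 / 2 * ‖weakGradient (u 0) x j‖ ^ 2) -
        (∫ x, 1 / 2 * ‖weakGradient (u t) x j‖ ^ 2) + ∫ s in (0 : ℝ)..t, ∫ x,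
        flux w (9 * lam ^ 2 / (4 * σ)) 0 j x (u s x) (weakGradient (u s) x j) ∧
      ∫⁻ s in Set.Ioo 0 t, Φ s ≤ ENNReal.ofReal ((∫ x, 1 / 2 * ‖weakGradient (u 0) x j‖ ^ 2) -
        (∫ x, 1 / 2 * ‖weakGradient (u t) x j‖ ^ 2) + ∫ s in (0 : ℝ)..t, ∫ x,
        flux w (9 * lam ^ 2 / (4 * σ)) 0 j x (u s x) (weakGradient (u s) x j)) := by
  set C : ℝ := 9 * lam ^ 2 / (4 * σ) with hCd
  have hC : 0 ≤ C := by positivity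
  set h : ℕ → ℝ := fun n => 1 / ((n : ℝ) + 1) with hhd
  have hpos : ∀ n, 0 < h n := fun n => by positivity
  have hne : ∀ n, h n ≠ 0 := fun n => (hpos n).ne'
  have hh : Tendsto h atTop (𝓝[≠] 0) :=
    tendsto_nhdsWithin_iff.2 ⟨tendsto_one_div_add_atTop_nhds_zero_nat,
      Eventually.of_forall hne⟩
  have hsub := Icc_subset_timeInterval ht
  have hmem : ∀ s ∈ Set.Icc 0 t, MemSigma (u s) := fun s hs => hu.memSigma (hsub hs)
  have hcm : ∀ n, ContinuousOn (fun s => ∫ x, 1 / 2 * ‖diffQuot (h n) j (u s) x‖ ^ 2)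
      (Set.Icc 0 t) := fun n =>
    ((jetAdmissible_quot (h n)).continuousOn (EuclideanSpace.single j (h n))
      hu.continuousInSigma).mono hsub
  have hck : ∀ n, ContinuousOn (fun s => ∫ x, flux w C (h n) j x (u s x)
      (diffQuot (h n) j (u s) x)) (Set.Icc 0 t) := fun n =>
    ((jetAdmissible_flux_quot w hC (h n) j).continuousOn (EuclideanSpace.single j (h n))
      hu.continuousInSigma).mono hsub
  have hjw : JetAdmissible jetWeight := .of_le continuous_jetWeight 1 zero_le_one fun q => by
    rw [Real.norm_of_nonneg (jetWeight_nonneg q), one_mul]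
  have hcw : ContinuousOn (fun s => ∫ x, jetWeight (jet 0 (u s) x)) (Set.Icc 0 t) :=
    (hjw.continuousOn 0 hu.continuousInSigma).mono hsub
  have hd : ∀ n, ∀ s ∈ Set.Ioo 0 t, HasDerivAt
      (fun s => ∫ x, 1 / 2 * ‖diffQuot (h n) j (u s) x‖ ^ 2)
      (∫ x, (diffQuot (h n) j (lowerOrder w lam σ (u s)) x *
        (starRingEnd ℂ) (diffQuot (h n) j (u s) x)).im) s := fun n s hs =>
    hu.hasDerivAt_diffQuot hs.1 (hsub ⟨hs.1.le, hs.2.le⟩).2 (h n) j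
  -- Nonnegativity of the dissipation gives the one-sided bound on the time derivative that the
  -- Fatou lemma in time requires, with the flux as majorant.
  have hle : ∀ n, ∀ s ∈ Set.Ioo 0 t, (∫ x, (diffQuot (h n) j (lowerOrder w lam σ (u s)) x *
        (starRingEnd ℂ) (diffQuot (h n) j (u s) x)).im) ≤
      ∫ x, flux w C (h n) j x (u s x) (diffQuot (h n) j (u s) x) := fun n s hs => by
    have hms := hmem s (Set.Ioo_subset_Icc_self hs)
    refine integral_mono (hms.integrable_im_diffQuot_lowerOrder _ j)
      (hms.integrable_flux_diffQuot hC _ j) fun x => ?_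
    have h1 := (dissipation_nonneg (lam := lam) hσ (hne n) (u s x) _).trans
      (im_diffQuot_lowerOrder_le (w := w) (f := u s) hσ (hne n) j x)
    simp only [flux]
    linarith
  have hr : Tendsto (fun n => (∫ x, 1 / 2 * ‖diffQuot (h n) j (u 0) x‖ ^ 2) -
      (∫ x, 1 / 2 * ‖diffQuot (h n) j (u t) x‖ ^ 2) +
      ∫ s in (0 : ℝ)..t, ∫ x, flux w C (h n) j x (u s x) (diffQuot (h n) j (u s) x)) atTop
      (𝓝 ((∫ x, 1 / 2 * ‖weakGradient (u 0) x j‖ ^ 2) -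
        (∫ x, 1 / 2 * ‖weakGradient (u t) x j‖ ^ 2) + ∫ s in (0 : ℝ)..t, ∫ x,
        flux w C 0 j x (u s x) (weakGradient (u s) x j))) := by
    have h0 := hmem 0 ⟨le_rfl, ht.1⟩
    have h1 := hmem t ⟨ht.1, le_rfl⟩
    refine ((h0.tendsto_integral_flux (w := w) C j hh).2.sub
      (h1.tendsto_integral_flux (w := w) C j hh).2).add ?_
    have hoc : Set.uIoc 0 t ⊆ Set.Icc 0 t := by
      rw [Set.uIoc_of_le ht.1]; exact Set.Ioc_subset_Icc_self
    refine intervalIntegral.tendsto_integral_filter_of_dominated_convergence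
      (fun s => (2 * w j ^ 2 + 9 * (w j ^ 2 + C)) * ∫ x, jetWeight (jet 0 (u s) x))
      (Eventually.of_forall fun n => ?_) (Eventually.of_forall fun n => ae_of_all _ fun s hs => ?_)
      ?_ (ae_of_all _ fun s hs => ((hmem s (hoc hs)).tendsto_integral_flux (w := w) C j hh).1)
    · rw [Set.uIoc_of_le ht.1]
      exact ((hck n).mono Set.Ioc_subset_Icc_self).aestronglyMeasurable measurableSet_Ioc
    · refine (hmem s (hoc hs)).abs_integral_flux_diffQuot_le hC (hne n) ?_ j
      rw [abs_of_pos (hpos n), hhd]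
      exact div_le_one_of_le₀ (by linarith [(Nat.cast_nonneg n : (0 : ℝ) ≤ n)]) (by positivity)
    · exact (hcw.intervalIntegrable_of_Icc ht.1).const_mul _
  obtain ⟨h1, h2, h3⟩ := lintegral_liminf_deriv_le ht.1 hcm hd hck hle hr
  exact ⟨_, h2, fun s hs => (hmem s (Set.Ioo_subset_Icc_self hs)).lintegral_dissipation_le
    hσ j hh hne, h1, h3⟩

end KineticBalance

/-! ### Space-time integrals of functions of the jet -/

section SpaceTime

variable {w : Fin 3 → ℝ} {lam σ : ℝ} {T : EReal} {u : ℝ → R3 → ℂ} {t : ℝ} {f : R3 → ℂ}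
  {Ψ Ψ' : Jet → ℝ}

theorem JetAdmissible.add (h : JetAdmissible Ψ) (h' : JetAdmissible Ψ') :
    JetAdmissible fun q => Ψ q + Ψ' q := by
  obtain ⟨C, k, hC, hk, hb⟩ := h.bound
  obtain ⟨C', k', hC', hk', hb'⟩ := h'.bound
  refine ⟨h.continuous.add h'.continuous, C + C', fun x => k x + k' x, by positivity, hk.add hk',
    fun q => (norm_add_le _ _).trans ?_⟩
  linarith [hb q, hb' q]

theorem JetAdmissible.const_mul (h : JetAdmissible Ψ) (c : ℝ) :
    JetAdmissible fun q => c * Ψ q := by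
  obtain ⟨C, k, hC, hk, hb⟩ := h.bound
  refine ⟨h.continuous.const_mul c, |c| * C, fun x => |c| * k x, by positivity, hk.const_mul _,
    fun q => ?_⟩
  rw [norm_mul, Real.norm_eq_abs]
  exact (mul_le_mul_of_nonneg_left (hb q) (abs_nonneg c)).trans (le_of_eq (by ring))

theorem JetAdmissible.sub (h : JetAdmissible Ψ) (h' : JetAdmissible Ψ') :
    JetAdmissible fun q => Ψ q - Ψ' q := by
  simpa [sub_eq_add_neg] using h.add (h'.const_mul (-1))

theorem JetAdmissible.zero : JetAdmissible fun _ : Jet => (0 : ℝ) :=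
  .of_le continuous_const 0 le_rfl fun q => by simp

theorem JetAdmissible.sum {ι : Type*} (s : Finset ι) {Θ : ι → Jet → ℝ}
    (h : ∀ i, JetAdmissible (Θ i)) : JetAdmissible fun q => ∑ i ∈ s, Θ i q := by
  classical
  induction s using Finset.induction_on with
  | empty => simpa using JetAdmissible.zero
  | insert i s hi ih => simpa [Finset.sum_insert hi] using (h i).add ih

theorem jetAdmissible_jetWeight : JetAdmissible jetWeight :=
  .of_le continuous_jetWeight 1 zero_le_one fun q => by
    rw [Real.norm_of_nonneg (jetWeight_nonneg q), one_mul]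

/-- The integral over `(0, t) × ℝ³` of a function of the jet of `u`. -/
def spaceTime (u : ℝ → R3 → ℂ) (t : ℝ) (Ψ : Jet → ℝ) : ℝ :=
  ∫ s in (0 : ℝ)..t, ∫ x, Ψ (jet 0 (u s) x)

theorem JetAdmissible.continuousOn_Icc (h : JetAdmissible Ψ) (hu : ContinuousInSigma T u)
    (ht : t ∈ timeInterval T) :
    ContinuousOn (fun s => ∫ x, Ψ (jet 0 (u s) x)) (Set.Icc 0 t) :=
  (h.continuousOn 0 hu).mono (Icc_subset_timeInterval ht)

theorem spaceTime_add (h : JetAdmissible Ψ) (h' : JetAdmissible Ψ') (hu : ContinuousInSigma T u)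
    (ht : t ∈ timeInterval T) :
    spaceTime u t (fun q => Ψ q + Ψ' q) = spaceTime u t Ψ + spaceTime u t Ψ' := by
  unfold spaceTime
  rw [← intervalIntegral.integral_add ((h.continuousOn_Icc hu ht).intervalIntegrable_of_Icc ht.1)
    ((h'.continuousOn_Icc hu ht).intervalIntegrable_of_Icc ht.1)]
  refine intervalIntegral.integral_congr fun s hs => ?_
  rw [Set.uIcc_of_le ht.1] at hs
  have hm := hu.mem s (Icc_subset_timeInterval ht hs)
  exact integral_add (h.integrable hm 0) (h'.integrable hm 0)

theorem spaceTime_const_mul (c : ℝ) (Ψ : Jet → ℝ) :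
    spaceTime u t (fun q => c * Ψ q) = c * spaceTime u t Ψ := by
  unfold spaceTime
  simp only [integral_const_mul, intervalIntegral.integral_const_mul]

theorem spaceTime_sub (h : JetAdmissible Ψ) (h' : JetAdmissible Ψ') (hu : ContinuousInSigma T u)
    (ht : t ∈ timeInterval T) :
    spaceTime u t (fun q => Ψ q - Ψ' q) = spaceTime u t Ψ - spaceTime u t Ψ' := by
  have := spaceTime_add h (h'.const_mul (-1)) hu ht
  rw [spaceTime_const_mul] at this
  simpa [sub_eq_add_neg] using this

theorem spaceTime_sum {ι : Type*} (s : Finset ι) {Θ : ι → Jet → ℝ}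
    (h : ∀ i, JetAdmissible (Θ i)) (hu : ContinuousInSigma T u) (ht : t ∈ timeInterval T) :
    spaceTime u t (fun q => ∑ i ∈ s, Θ i q) = ∑ i ∈ s, spaceTime u t (Θ i) := by
  classical
  induction s using Finset.induction_on with
  | empty => simp [spaceTime]
  | insert i s hi ih =>
    simp only [Finset.sum_insert hi]
    rw [spaceTime_add (h i) (JetAdmissible.sum s h) hu ht, ih]

theorem spaceTime_mono (h : JetAdmissible Ψ) (h' : JetAdmissible Ψ') (hu : ContinuousInSigma T u)
    (ht : t ∈ timeInterval T) (hle : ∀ q, Ψ q ≤ Ψ' q) : spaceTime u t Ψ ≤ spaceTime u t Ψ' :=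
  intervalIntegral.integral_mono_on ht.1
    ((h.continuousOn_Icc hu ht).intervalIntegrable_of_Icc ht.1)
    ((h'.continuousOn_Icc hu ht).intervalIntegrable_of_Icc ht.1) fun s hs =>
    integral_mono (h.integrable (hu.mem s (Icc_subset_timeInterval ht hs)) 0)
      (h'.integrable (hu.mem s (Icc_subset_timeInterval ht hs)) 0) fun _ => hle _

/-- The fundamental theorem of calculus for functionals of the jet. -/
theorem spaceTime_eq_sub (h : JetAdmissible Ψ) (h' : JetAdmissible Ψ')
    (hu : ContinuousInSigma T u) (ht : t ∈ timeInterval T)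
    (hd : ∀ s : ℝ, 0 < s → (s : EReal) < T → HasDerivAt (fun r => ∫ x, Ψ (jet 0 (u r) x))
      (∫ x, Ψ' (jet 0 (u s) x)) s) :
    spaceTime u t Ψ' = (∫ x, Ψ (jet 0 (u t) x)) - ∫ x, Ψ (jet 0 (u 0) x) :=
  intervalIntegral.integral_eq_sub_of_hasDerivAt_of_le ht.1 (h.continuousOn_Icc hu ht)
    (fun s hs => hd s hs.1
      (Icc_subset_timeInterval ht (Set.Ioo_subset_Icc_self hs)).2)
    ((h'.continuousOn_Icc hu ht).intervalIntegrable_of_Icc ht.1)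

/-- The kinetic energy balance, tested with a minorant of the dissipation. -/
theorem IsSolution.spaceTime_le (hu : IsSolution w lam σ T u) (hσ : 0 < σ)
    (ht : t ∈ timeInterval T) (j : Fin 3) (h : JetAdmissible Ψ)
    (hle : ∀ q : Jet, Ψ q ≤ dissipation lam σ 0 q.2.1 (q.2.2.2 j)) :
    spaceTime u t Ψ ≤ (∫ x, 1 / 2 * ‖weakGradient (u 0) x j‖ ^ 2) -
        (∫ x, 1 / 2 * ‖weakGradient (u t) x j‖ ^ 2) +
      spaceTime u t fun q => flux w (9 * lam ^ 2 / (4 * σ)) 0 j q.1 q.2.1 (q.2.2.2 j) := by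
  obtain ⟨Φ, -, h2, h3, h4⟩ := hu.exists_lintegral_dissipation_le hσ ht j
  refine (ENNReal.ofReal_le_ofReal_iff h3).1 (le_trans ?_ h4)
  rw [spaceTime, intervalIntegral.integral_of_le ht.1, integral_Ioc_eq_integral_Ioo]
  -- The minorant Ψ may change sign, so it is compared with its positive part before passing to
  -- lower integrals.
  have hofReal : ∀ {α : Type} [MeasurableSpace α] {μ : Measure α} {F : α → ℝ}, Integrable F μ →
      ENNReal.ofReal (∫ a, F a ∂μ) ≤ ∫⁻ a, ENNReal.ofReal (F a) ∂μ := fun {_ _ μ F} hF => by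
    have h1 : ∫ a, F a ∂μ ≤ ∫ a, max (F a) 0 ∂μ :=
      integral_mono hF hF.pos_part fun a => le_max_left _ _
    refine (ENNReal.ofReal_le_ofReal h1).trans ?_
    rw [ofReal_integral_eq_lintegral_ofReal hF.pos_part (ae_of_all _ fun a => le_max_right _ _)]
    exact lintegral_mono fun a => by simp [ENNReal.ofReal_max]
  refine (hofReal ?_).trans (setLIntegral_mono' measurableSet_Ioo fun s hs => ?_)
  · exact ((h.continuousOn_Icc hu.continuousInSigma ht).integrableOn_Icc).mono_set
      Set.Ioo_subset_Icc_self
  · refine (hofReal (h.integrable (hu.memSigma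
      (Icc_subset_timeInterval ht (Set.Ioo_subset_Icc_self hs))) 0)).trans ?_
    exact (lintegral_mono fun x => ENNReal.ofReal_le_ofReal (hle _)).trans (h2 s hs)

/-- Here f is fixed and the integrand varies; a bound by the weight, uniform in n, makes this
ordinary dominated convergence. It serves to remove the regularization. -/
theorem tendsto_integral_jet {Θ : ℕ → Jet → ℝ} {Θ' : Jet → ℝ} {K : ℝ}
    (hc : ∀ n, Continuous (Θ n)) (hK : ∀ n q, ‖Θ n q‖ ≤ K * jetWeight q)
    (hl : ∀ q, Tendsto (fun n => Θ n q) atTop (𝓝 (Θ' q))) (hf : MemSigma f) :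
    Tendsto (fun n => ∫ x, Θ n (jet 0 f x)) atTop (𝓝 (∫ x, Θ' (jet 0 f x))) :=
  tendsto_integral_of_dominated_convergence (fun x => K * jetWeight (jet 0 f x))
    (fun n => (hc n).comp_aestronglyMeasurable (hf.aestronglyMeasurable_jet 0))
    ((integrable_jetWeight hf 0).const_mul K) (fun n => ae_of_all _ fun _ => hK n _)
    (ae_of_all _ fun _ => hl _)

theorem tendsto_spaceTime {Θ : ℕ → Jet → ℝ} {Θ' : Jet → ℝ} {K : ℝ} (hK0 : 0 ≤ K)
    (hc : ∀ n, Continuous (Θ n)) (hK : ∀ n q, ‖Θ n q‖ ≤ K * jetWeight q)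
    (hl : ∀ q, Tendsto (fun n => Θ n q) atTop (𝓝 (Θ' q))) (hu : ContinuousInSigma T u)
    (ht : t ∈ timeInterval T) :
    Tendsto (fun n => spaceTime u t (Θ n)) atTop (𝓝 (spaceTime u t Θ')) := by
  have hoc : Set.uIoc 0 t ⊆ Set.Icc 0 t := by
    rw [Set.uIoc_of_le ht.1]; exact Set.Ioc_subset_Icc_self
  have hm : ∀ s ∈ Set.uIoc 0 t, MemSigma (u s) := fun s hs =>
    hu.mem s (Icc_subset_timeInterval ht (hoc hs))
  refine intervalIntegral.tendsto_integral_filter_of_dominated_convergence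
    (fun s => K * ∫ x, jetWeight (jet 0 (u s) x)) (Eventually.of_forall fun n => ?_)
    (Eventually.of_forall fun n => ae_of_all _ fun s hs => ?_) ?_
    (ae_of_all _ fun s hs => tendsto_integral_jet hc hK hl (hm s hs))
  · rw [Set.uIoc_of_le ht.1]
    exact (((JetAdmissible.of_le (hc n) K hK0 (hK n)).continuousOn_Icc hu ht).mono
      Set.Ioc_subset_Icc_self).aestronglyMeasurable measurableSet_Ioc
  · rw [← integral_const_mul]
    exact norm_integral_le_of_norm_le ((integrable_jetWeight (hm s hs) 0).const_mul K)
      (ae_of_all _ fun x => hK n _)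
  · exact ((jetAdmissible_jetWeight.continuousOn_Icc hu ht).intervalIntegrable_of_Icc
      ht.1).const_mul _

/-- Fatou's lemma for nonnegative functions of the jet. -/
theorem lintegral_jet_le {Θ : ℕ → Jet → ℝ} {Θ' : Jet → ℝ} {L : ℕ → ℝ} {L' : ℝ}
    (h : ∀ n, JetAdmissible (Θ n)) (h0 : ∀ n q, 0 ≤ Θ n q)
    (hl : ∀ q, Tendsto (fun n => Θ n q) atTop (𝓝 (Θ' q))) (hu : ContinuousInSigma T u)
    (ht : t ∈ timeInterval T) (hL : ∀ n, spaceTime u t (Θ n) ≤ L n)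
    (hL' : Tendsto L atTop (𝓝 L')) :
    ∫⁻ s in Set.Ioo 0 t, ∫⁻ x, ENNReal.ofReal (Θ' (jet 0 (u s) x)) ≤ ENNReal.ofReal L' := by
  have hm : ∀ s ∈ Set.Ioo 0 t, MemSigma (u s) := fun s hs =>
    hu.mem s (Icc_subset_timeInterval ht (Set.Ioo_subset_Icc_self hs))
  have e1 : ∀ n, ∫⁻ s in Set.Ioo 0 t, ENNReal.ofReal (∫ x, Θ n (jet 0 (u s) x)) ≤
      ENNReal.ofReal (L n) := fun n => by
    rw [← ofReal_integral_eq_lintegral_ofReal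
      (((h n).continuousOn_Icc hu ht).integrableOn_Icc.mono_set Set.Ioo_subset_Icc_self)
      (ae_of_all _ fun s => integral_nonneg fun x => h0 n _), ← integral_Ioc_eq_integral_Ioo,
      ← intervalIntegral.integral_of_le ht.1]
    exact ENNReal.ofReal_le_ofReal (hL n)
  have hmeas : ∀ n, AEMeasurable (fun s => ENNReal.ofReal (∫ x, Θ n (jet 0 (u s) x)))
      (volume.restrict (Set.Ioo 0 t)) := fun n =>
    ((((h n).continuousOn_Icc hu ht).mono Set.Ioo_subset_Icc_self).aestronglyMeasurable
      measurableSet_Ioo).aemeasurable.ennreal_ofReal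
  calc _ ≤ ∫⁻ s in Set.Ioo 0 t, liminf (fun n => ENNReal.ofReal (∫ x, Θ n (jet 0 (u s) x))) atTop := by
        refine setLIntegral_mono' measurableSet_Ioo fun s hs => ?_
        have e2 : ∀ n, ENNReal.ofReal (∫ x, Θ n (jet 0 (u s) x)) =
            ∫⁻ x, ENNReal.ofReal (Θ n (jet 0 (u s) x)) := fun n =>
          ofReal_integral_eq_lintegral_ofReal ((h n).integrable (hm s hs) 0)
            (ae_of_all _ fun x => h0 n _)
        simp only [e2]
        refine le_trans (le_of_eq (lintegral_congr fun x => ?_)) (lintegral_liminf_le' fun n =>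
          ((h n).integrable (hm s hs) 0).1.aemeasurable.ennreal_ofReal)
        exact (ENNReal.tendsto_ofReal (hl _)).liminf_eq.symm
    _ ≤ liminf (fun n => ∫⁻ s in Set.Ioo 0 t, ENNReal.ofReal (∫ x, Θ n (jet 0 (u s) x))) atTop :=
        lintegral_liminf_le' hmeas
    _ ≤ liminf (fun n => ENNReal.ofReal (L n)) atTop :=
        liminf_le_liminf (Eventually.of_forall e1)
    _ = _ := (ENNReal.tendsto_ofReal hL').liminf_eq

end SpaceTime

/-! ### Regularized local energies -/

section Regularization

variable {w : Fin 3 → ℝ} {lam σ κ ε : ℝ} {T : EReal} {u : ℝ → R3 → ℂ} {t : ℝ}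

/-- Balance law for a local functional of the density `|u|²`. -/
theorem IsSolution.hasDerivAt_gauge (hu : IsSolution w lam σ T u) (h0 : 0 < t)
    (hT : (t : EReal) < T) {G g g' : ℝ → ℝ} {C : ℝ}
    (hG : ∀ s, 0 ≤ s → HasDerivAt G (g s) s) (hg : ∀ s, 0 ≤ s → HasDerivAt g (g' s) s)
    (hc : ContDiff ℝ 1 fun z : ℂ => g (‖z‖ ^ 2)) (hC : ∀ s, 0 ≤ s → |g s| ≤ C)
    (hC' : ∀ s, 0 ≤ s → s * |g' s| ≤ C) (hG0 : G 0 = 0) :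
    HasDerivAt (fun s => ∫ x, G (‖u s x‖ ^ 2))
      (∫ x, ((∑ j, 2 * g' (‖u t x‖ ^ 2) *
        (((starRingEnd ℂ) (u t x) * weakGradient (u t) x j).re *
        ((starRingEnd ℂ) (u t x) * weakGradient (u t) x j).im)) -
          2 * σ * (g (‖u t x‖ ^ 2) * ‖u t x‖ ^ 6))) t := by
  have hN : ∀ z : ℂ, HasFDerivAt (fun z : ℂ => ‖z‖ ^ 2) (2 • innerSL ℝ z) z := fun z =>
    (hasStrictFDerivAt_norm_sq z).hasFDerivAt
  have hF : ∀ z : ℂ, HasFDerivAt (fun z : ℂ => g (‖z‖ ^ 2) • z)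
      (g (‖z‖ ^ 2) • ContinuousLinearMap.id ℝ ℂ +
        (g' (‖z‖ ^ 2) • (2 • innerSL ℝ z)).smulRight z) z := fun z =>
    ((hg _ (sq_nonneg _)).comp_hasFDerivAt z (hN z)).smul (hasFDerivAt_id z)
  have hFξ : ∀ z ξ : ℂ, fderiv ℝ (fun z : ℂ => g (‖z‖ ^ 2) • z) z ξ = (g (‖z‖ ^ 2) : ℂ) * ξ +
      ((2 * g' (‖z‖ ^ 2) * ((starRingEnd ℂ) z * ξ).re : ℝ) : ℂ) * z := fun z ξ => by
    rw [(hF z).fderiv]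
    simp [Complex.inner, mul_comm]
    exact Or.inl (by ring)
  -- The gradient field on ℂ is g(|z|²) z. Its derivative has norm at most |g| + 2|z|²|g'|, hence 3
  -- C.
  have key := hu.hasDerivAt_local h0 hT (H := fun z => G (‖z‖ ^ 2))
    (F := fun z : ℂ => g (‖z‖ ^ 2) • z) (γ := fun z => g (‖z‖ ^ 2)) (C := 3 * C) (fun z => ?_)
    (hc.smul contDiff_id) (fun z => ?_) (by simpa using hG0) fun z => Complex.real_smul
  · convert key using 1
    refine integral_congr_ae (ae_of_all _ fun x => ?_)
    simp only [hFξ]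
    congr 1
    refine Finset.sum_congr rfl fun j _ => ?_
    set ξ := weakGradient (u t) x j
    set z := u t x
    have e1 : ξ * (starRingEnd ℂ) ((g (‖z‖ ^ 2) : ℂ) * ξ +
      ((2 * g' (‖z‖ ^ 2) * ((starRingEnd ℂ) z * ξ).re : ℝ) : ℂ) * z) =
      (g (‖z‖ ^ 2) : ℂ) * (ξ * (starRingEnd ℂ) ξ) +
      ((2 * g' (‖z‖ ^ 2) * ((starRingEnd ℂ) z * ξ).re : ℝ) : ℂ) * ((starRingEnd ℂ) z * ξ) := by
      simp only [map_add, map_mul, Complex.conj_ofReal]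
      ring
    rw [e1, Complex.add_im, Complex.im_ofReal_mul, Complex.im_ofReal_mul, Complex.mul_conj,
      Complex.ofReal_im]
    ring
  · refine ((hG _ (sq_nonneg _)).comp_hasFDerivAt z (hN z)).congr_fderiv ?_
    ext ξ
    simp [Complex.inner]
    ring
  · refine ContinuousLinearMap.opNorm_le_bound _ ?_ fun ξ => ?_
    · linarith [(abs_nonneg _).trans (hC 0 le_rfl)]
    · rw [hFξ]
      refine (norm_add_le _ _).trans ?_
      rw [norm_mul, norm_mul, Complex.norm_real, Complex.norm_real, Real.norm_eq_abs,
        Real.norm_eq_abs, abs_mul, abs_mul, abs_two]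
      have h1 : |((starRingEnd ℂ) z * ξ).re| ≤ ‖z‖ * ‖ξ‖ := by
        refine (Complex.abs_re_le_norm _).trans (le_of_eq ?_)
        rw [norm_mul, RCLike.norm_conj]
      have h2 := mul_le_mul_of_nonneg_right (hC _ (sq_nonneg ‖z‖)) (norm_nonneg ξ)
      have h3 := mul_le_mul_of_nonneg_right (hC' _ (sq_nonneg ‖z‖)) (norm_nonneg ξ)
      calc |g (‖z‖ ^ 2)| * ‖ξ‖ + 2 * |g' (‖z‖ ^ 2)| * |((starRingEnd ℂ) z * ξ).re| * ‖z‖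
          ≤ |g (‖z‖ ^ 2)| * ‖ξ‖ + 2 * |g' (‖z‖ ^ 2)| * (‖z‖ * ‖ξ‖) * ‖z‖ := by gcongr
        _ ≤ 3 * C * ‖ξ‖ := by linarith

/-- The cut-off factor `1 / (1 + ε s)`. -/
def damp (ε s : ℝ) : ℝ := (1 + ε * s)⁻¹

theorem damp_pos (hε : 0 < ε) {s : ℝ} (hs : 0 ≤ s) : 0 < damp ε s := by
  unfold damp; positivity

theorem damp_le_one (hε : 0 < ε) {s : ℝ} (hs : 0 ≤ s) : damp ε s ≤ 1 :=
  inv_le_one_of_one_le₀ (by nlinarith [mul_nonneg hε.le hs])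

/-- This identity trades factors of ε s d for 1 - d; the derivative formulas below reduce to it. -/
theorem mul_mul_damp (hε : 0 < ε) {s : ℝ} (hs : 0 ≤ s) : ε * (s * damp ε s) = 1 - damp ε s := by
  have : 1 + ε * s ≠ 0 := by positivity
  unfold damp
  field_simp
  ring

theorem mul_damp_nonneg (hε : 0 < ε) {s : ℝ} (hs : 0 ≤ s) : 0 ≤ s * damp ε s :=
  mul_nonneg hs (damp_pos hε hs).le

theorem mul_damp_le (hε : 0 < ε) {s : ℝ} (hs : 0 ≤ s) : s * damp ε s ≤ ε⁻¹ := by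
  rw [← one_div, le_div_iff₀' hε, mul_mul_damp hε hs]
  linarith [damp_pos hε hs]

theorem hasDerivAt_damp (hε : 0 < ε) {s : ℝ} (hs : 0 ≤ s) :
    HasDerivAt (damp ε) (-ε * damp ε s ^ 2) s := by
  have h : 1 + ε * s ≠ 0 := by positivity
  have := (((hasDerivAt_id s).const_mul ε).const_add 1).inv h
  refine this.congr_deriv ?_
  simp only [damp, id]
  field_simp

theorem hasDerivAt_mul_damp (hε : 0 < ε) {s : ℝ} (hs : 0 ≤ s) :
    HasDerivAt (fun s => s * damp ε s) (damp ε s ^ 2) s := by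
  refine ((hasDerivAt_id s).mul (hasDerivAt_damp hε hs)).congr_deriv ?_
  have := mul_mul_damp hε hs
  simp only [id]
  linear_combination (-damp ε s) * this

theorem contDiff_damp {E : Type*} [NormedAddCommGroup E] [NormedSpace ℝ E] {n : WithTop ℕ∞}
    (hε : 0 < ε) {k : E → ℝ} (hk : ContDiff ℝ n k) (h0 : ∀ x, 0 ≤ k x) :
    ContDiff ℝ n fun x => damp ε (k x) :=
  (contDiff_const.add (contDiff_const.mul hk)).inv fun x => by have := h0 x; positivity

theorem continuous_damp {E : Type*} [TopologicalSpace E] (hε : 0 < ε) {k : E → ℝ}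
    (hk : Continuous k) (h0 : ∀ x, 0 ≤ k x) : Continuous fun x => damp ε (k x) :=
  (continuous_const.add (continuous_const.mul hk)).inv₀ fun x =>
    (by linarith [mul_nonneg hε.le (h0 x)] : 0 < 1 + ε * k x).ne'

theorem tendsto_damp {ε : ℕ → ℝ} (hε : Tendsto ε atTop (𝓝 0)) (s : ℝ) :
    Tendsto (fun n => damp (ε n) s) atTop (𝓝 1) := by
  have : Tendsto (fun n => 1 + ε n * s) atTop (𝓝 1) := by
    simpa using (hε.mul_const s).const_add 1
  simpa [damp] using this.inv₀ one_ne_zero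

/-- Regularization of `λ/2 s² + κ s³`. -/
def regPotential (lam κ ε s : ℝ) : ℝ :=
  s * (κ * (s * damp ε s) ^ 2 + lam / 2 * (s * damp ε s))

/-- The derivative of `regPotential`. -/
def regDeriv (lam κ ε s : ℝ) : ℝ :=
  lam / 2 * ((s * damp ε s) * (1 + damp ε s)) + κ * ((s * damp ε s) ^ 2 * (1 + 2 * damp ε s))

/-- The second derivative of `regPotential`. -/
def regDerivTwo (lam κ ε s : ℝ) : ℝ := lam * damp ε s ^ 3 + 6 * κ * (s * damp ε s ^ 4)

theorem hasDerivAt_regPotential (hε : 0 < ε) {s : ℝ} (hs : 0 ≤ s) :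
    HasDerivAt (regPotential lam κ ε) (regDeriv lam κ ε s) s := by
  have h := hasDerivAt_mul_damp hε hs
  refine ((hasDerivAt_id s).mul (((h.pow 2).const_mul κ).add (h.const_mul (lam / 2)))).congr_deriv ?_
  simp only [id, regDeriv, Pi.add_apply, Pi.pow_apply]
  push_cast
  ring

/-- This formula explains the shape of `regPotential`: the λ part of the second derivative is
exactly λ d³, which matches the kinetic dissipation damped by d³, while the κ part 6κ s d⁴ has one
more factor d ≤ 1 to spare. -/
theorem hasDerivAt_regDeriv (hε : 0 < ε) {s : ℝ} (hs : 0 ≤ s) :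
    HasDerivAt (regDeriv lam κ ε) (regDerivTwo lam κ ε s) s := by
  have h := hasDerivAt_mul_damp hε hs
  have h' := hasDerivAt_damp hε hs
  refine (((h.mul (h'.const_add 1)).const_mul (lam / 2)).add
    (((h.pow 2).mul ((h'.const_mul 2).const_add 1)).const_mul κ)).congr_deriv ?_
  have e := mul_mul_damp hε hs
  simp only [regDerivTwo, Pi.pow_apply]
  push_cast
  linear_combination (-lam / 2 * damp ε s ^ 2 - 2 * κ * (s * damp ε s) * damp ε s ^ 2) * e

theorem abs_regDeriv_le (hε : 0 < ε) {s : ℝ} (hs : 0 ≤ s) :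
    |regDeriv lam κ ε s| ≤ |lam| * ε⁻¹ + 6 * |κ| * ε⁻¹ ^ 2 := by
  have h1 := mul_damp_le hε hs
  have h2 := mul_damp_nonneg hε hs
  have h3 := damp_pos hε hs
  have h4 := damp_le_one hε hs
  set d := damp ε s
  set y := s * d
  unfold regDeriv
  refine (abs_add_le _ _).trans ?_
  rw [abs_mul, abs_mul κ, abs_div, abs_two, abs_of_nonneg (by positivity : 0 ≤ y * (1 + d)),
    abs_of_nonneg (by positivity : 0 ≤ y ^ 2 * (1 + 2 * d))]
  have a1 : y * (1 + d) ≤ ε⁻¹ * 2 := mul_le_mul h1 (by linarith) (by positivity) (by positivity)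
  have a2 : y ^ 2 * (1 + 2 * d) ≤ ε⁻¹ ^ 2 * 3 :=
    mul_le_mul (pow_le_pow_left₀ h2 h1 2) (by linarith) (by positivity) (by positivity)
  have a3 := mul_le_mul_of_nonneg_left a1 (by positivity : 0 ≤ |lam| / 2)
  have a4 := mul_le_mul_of_nonneg_left a2 (abs_nonneg κ)
  have a5 : 0 ≤ |κ| * ε⁻¹ ^ 2 := by positivity
  linarith

/-- Together with `abs_regDeriv_le` this makes the gradient of the regularized potential globally
Lipschitz on ℂ, so that its composition with u stays in Σ. -/
theorem mul_abs_regDerivTwo_le (hε : 0 < ε) {s : ℝ} (hs : 0 ≤ s) :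
    s * |regDerivTwo lam κ ε s| ≤ |lam| * ε⁻¹ + 6 * |κ| * ε⁻¹ ^ 2 := by
  have h1 := mul_damp_le hε hs
  have h2 := mul_damp_nonneg hε hs
  have h3 := damp_pos hε hs
  have h4 := damp_le_one hε hs
  have e : s * |regDerivTwo lam κ ε s| = |lam * ((s * damp ε s) * damp ε s ^ 2) +
      6 * κ * ((s * damp ε s) ^ 2 * damp ε s ^ 2)| := by
    rw [← abs_of_nonneg hs, ← abs_mul, abs_of_nonneg hs, regDerivTwo]
    ring_nf
  rw [e]
  set d := damp ε s
  set y := s * d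
  refine (abs_add_le _ _).trans ?_
  rw [abs_mul lam, abs_mul (6 * κ), abs_mul 6, abs_of_nonneg (by positivity : 0 ≤ y * d ^ 2),
    abs_of_nonneg (by positivity : 0 ≤ y ^ 2 * d ^ 2), abs_of_nonneg (by norm_num : (0 : ℝ) ≤ 6)]
  have a0 : d ^ 2 ≤ 1 := pow_le_one₀ h3.le h4
  have a1 : y * d ^ 2 ≤ ε⁻¹ * 1 := mul_le_mul h1 a0 (by positivity) (by positivity)
  have a2 : y ^ 2 * d ^ 2 ≤ ε⁻¹ ^ 2 * 1 :=
    mul_le_mul (pow_le_pow_left₀ h2 h1 2) a0 (by positivity) (by positivity)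
  have a3 := mul_le_mul_of_nonneg_left a1 (abs_nonneg lam)
  have a4 := mul_le_mul_of_nonneg_left a2 (by positivity : 0 ≤ 6 * |κ|)
  linarith

/-- With y = s d and d ≤ 1 the λ part is at least -|λ| y, and completing the square against half of
κ y² leaves the constant λ²/(2κ). -/
theorem regDeriv_ge (hε : 0 < ε) (hκ : 0 < κ) {s : ℝ} (hs : 0 ≤ s) :
    κ / 2 * (s * damp ε s) ^ 2 - lam ^ 2 / (2 * κ) ≤ regDeriv lam κ ε s := by
  have h2 := mul_damp_nonneg hε hs
  have h3 := damp_pos hε hs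
  have h4 := damp_le_one hε hs
  unfold regDeriv
  set d := damp ε s
  set y := s * d
  have a1 : -(|lam| * y) ≤ lam / 2 * (y * (1 + d)) := by
    have b1 := neg_abs_le lam
    have b2 : 0 ≤ y * (1 + d) := by positivity
    have b3 : y * (1 + d) ≤ 2 * y := by nlinarith
    have b4 := mul_le_mul_of_nonneg_right b1 b2
    have b5 := mul_le_mul_of_nonneg_left b3 (abs_nonneg lam)
    linarith
  have a2 : κ * y ^ 2 ≤ κ * (y ^ 2 * (1 + 2 * d)) := by
    have : 0 ≤ κ * y ^ 2 * d := by positivity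
    linarith
  have a3 : κ * y ^ 2 - |lam| * y - (κ / 2 * y ^ 2 - lam ^ 2 / (2 * κ)) =
      (κ * y - |lam|) ^ 2 / (2 * κ) := by
    rw [← sq_abs lam]; field_simp; ring
  have a4 : 0 ≤ (κ * y - |lam|) ^ 2 / (2 * κ) := by positivity
  linarith

/-- The minimum over y of κ y² + λ/2 y is -λ²/(16κ); it bounds the energy from below by a multiple
of the mass. -/
theorem regPotential_ge (hκ : 0 < κ) {s : ℝ} (hs : 0 ≤ s) :
    -(lam ^ 2 / (16 * κ)) * s ≤ regPotential lam κ ε s := by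
  unfold regPotential
  set y := s * damp ε s
  have a3 : κ * y ^ 2 + lam / 2 * y + lam ^ 2 / (16 * κ) = (4 * κ * y + lam) ^ 2 / (16 * κ) := by
    field_simp; ring
  have a4 : 0 ≤ (4 * κ * y + lam) ^ 2 / (16 * κ) := by positivity
  nlinarith

theorem abs_regPotential_le (hε : 0 < ε) {s : ℝ} (hs : 0 ≤ s) :
    |regPotential lam κ ε s| ≤ |κ| * s ^ 3 + |lam| * s ^ 2 := by
  have h2 := mul_damp_nonneg hε hs
  have h5 : s * damp ε s ≤ s := mul_le_of_le_one_right hs (damp_le_one hε hs)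
  unfold regPotential
  set y := s * damp ε s
  rw [abs_mul, abs_of_nonneg hs]
  have a1 : |κ * y ^ 2 + lam / 2 * y| ≤ |κ| * s ^ 2 + |lam| / 2 * s := by
    refine (abs_add_le _ _).trans ?_
    rw [abs_mul, abs_mul, abs_div, abs_two, abs_of_nonneg h2, abs_of_nonneg (sq_nonneg y)]
    gcongr
  have a2 : 0 ≤ |lam| * s ^ 2 := by positivity
  nlinarith [mul_le_mul_of_nonneg_left a1 hs]

theorem hasFDerivAt_confinement (w : Fin 3 → ℝ) (x : R3) :
    HasFDerivAt (confinement w) (∑ j, (w j ^ 2 * x j) • (EuclideanSpace.proj j : R3 →L[ℝ] ℝ)) x := by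
  have h : ∀ j ∈ (Finset.univ : Finset (Fin 3)), HasFDerivAt (fun x : R3 => w j ^ 2 * x j ^ 2)
      ((2 : ℝ) • (w j ^ 2 * x j) • (EuclideanSpace.proj j : R3 →L[ℝ] ℝ)) x := fun j _ => by
    refine (((EuclideanSpace.proj j : R3 →L[ℝ] ℝ).hasFDerivAt.pow 2).const_mul
      (w j ^ 2)).congr_fderiv ?_
    ext v
    simp
    ring
  refine ((HasFDerivAt.fun_sum h).const_mul (1 / 2)).congr_fderiv ?_
  rw [← Finset.smul_sum, smul_smul]
  norm_num

theorem norm_fderiv_confinement_le (w : Fin 3 → ℝ) (x : R3) :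
    ‖∑ j, (w j ^ 2 * x j) • (EuclideanSpace.proj j : R3 →L[ℝ] ℝ)‖ ≤ (∑ j, w j ^ 2) * ‖x‖ := by
  rw [Finset.sum_mul]
  refine norm_sum_le_of_le _ fun j _ => ?_
  rw [norm_smul, norm_mul, Real.norm_of_nonneg (sq_nonneg (w j))]
  have h1 : ‖(EuclideanSpace.proj j : R3 →L[ℝ] ℝ)‖ ≤ 1 :=
    ContinuousLinearMap.opNorm_le_bound _ zero_le_one fun v => by
      simpa using PiLp.norm_apply_le v j
  calc w j ^ 2 * ‖x j‖ * ‖(EuclideanSpace.proj j : R3 →L[ℝ] ℝ)‖ ≤ w j ^ 2 * ‖x‖ * 1 := by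
        gcongr
        exact PiLp.norm_apply_le x j
    _ = _ := mul_one _

theorem contDiff_confinement (w : Fin 3 → ℝ) {n : WithTop ℕ∞} : ContDiff ℝ n (confinement w) := by
  unfold confinement
  fun_prop

/-- The bounded regularization `V / (1 + ε V)` of the potential. -/
def regConfinement (w : Fin 3 → ℝ) (ε : ℝ) (x : R3) : ℝ :=
  confinement w x * damp ε (confinement w x)

theorem hasFDerivAt_regConfinement (hε : 0 < ε) (x : R3) :
    HasFDerivAt (regConfinement w ε) (damp ε (confinement w x) ^ 2 •
      ∑ j, (w j ^ 2 * x j) • (EuclideanSpace.proj j : R3 →L[ℝ] ℝ)) x :=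
  (hasDerivAt_mul_damp hε (confinement_nonneg w x)).comp_hasFDerivAt x (hasFDerivAt_confinement w x)

theorem fderiv_regConfinement (hε : 0 < ε) (x : R3) (j : Fin 3) :
    fderiv ℝ (regConfinement w ε) x (EuclideanSpace.single j 1) =
      damp ε (confinement w x) ^ 2 * (w j ^ 2 * x j) := by
  rw [(hasFDerivAt_regConfinement hε x).fderiv]
  simp

theorem IsSolution.hasDerivAt_regConfinement (hu : IsSolution w lam σ T u) (hε : 0 < ε)
    (h0 : 0 < t) (hT : (t : EReal) < T) :
    HasDerivAt (fun s => ∫ x, regConfinement w ε x * ‖u s x‖ ^ 2)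
      (∫ x, ((∑ j, damp ε (confinement w x) ^ 2 * (w j ^ 2 * x j) *
        ((starRingEnd ℂ) (u t x) * weakGradient (u t) x j).im) -
          2 * σ * (regConfinement w ε x * ‖u t x‖ ^ 6))) t := by
  have h := hu.hasDerivAt_weighted h0 hT (η := regConfinement w ε) (A := ε⁻¹) (B := ∑ j, w j ^ 2)
    ((contDiff_confinement w).mul (contDiff_damp hε (contDiff_confinement w) (confinement_nonneg w)))
    (fun x => ?_) fun x => ?_
  · simpa only [fderiv_regConfinement hε] using h
  · rw [regConfinement, abs_of_nonneg (mul_damp_nonneg hε (confinement_nonneg w x))]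
    exact mul_damp_le hε (confinement_nonneg w x)
  · rw [(hasFDerivAt_regConfinement hε x).fderiv, norm_smul, norm_pow,
      Real.norm_of_nonneg (damp_pos hε (confinement_nonneg w x)).le]
    have h1 := norm_fderiv_confinement_le w x
    have h2 : damp ε (confinement w x) ^ 2 ≤ 1 :=
      pow_le_one₀ (damp_pos hε (confinement_nonneg w x)).le (damp_le_one hε (confinement_nonneg w x))
    have h3 : 0 ≤ ∑ j, w j ^ 2 := by positivity
    calc _ ≤ 1 * ((∑ j, w j ^ 2) * ‖x‖) := mul_le_mul h2 h1 (norm_nonneg _) zero_le_one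
      _ ≤ _ := by linarith

theorem IsSolution.hasDerivAt_mass (hu : IsSolution w lam σ T u)
    (h0 : 0 < t) (hT : (t : EReal) < T) :
    HasDerivAt (fun s => ∫ x, ‖u s x‖ ^ 2) (∫ x, -(2 * σ) * ‖u t x‖ ^ 6) t := by
  simpa using hu.hasDerivAt_weighted h0 hT (η := fun _ => 1) (A := 1) (B := 0) contDiff_const
    (by simp) (by simp)

theorem IsSolution.hasDerivAt_regPotential (hu : IsSolution w lam σ T u) (hε : 0 < ε)
    (h0 : 0 < t) (hT : (t : EReal) < T) :
    HasDerivAt (fun s => ∫ x, regPotential lam κ ε (‖u s x‖ ^ 2))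
      (∫ x, ((∑ j, 2 * regDerivTwo lam κ ε (‖u t x‖ ^ 2) *
        (((starRingEnd ℂ) (u t x) * weakGradient (u t) x j).re *
        ((starRingEnd ℂ) (u t x) * weakGradient (u t) x j).im)) -
          2 * σ * (regDeriv lam κ ε (‖u t x‖ ^ 2) * ‖u t x‖ ^ 6))) t := by
  have hn : ContDiff ℝ 1 fun z : ℂ => ‖z‖ ^ 2 := contDiff_norm_sq ℝ
  have hd : ContDiff ℝ 1 fun z : ℂ => damp ε (‖z‖ ^ 2) :=
    contDiff_damp hε hn fun z => sq_nonneg _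
  refine hu.hasDerivAt_gauge h0 hT (fun s hs => DampedNLS.hasDerivAt_regPotential hε hs)
    (fun s hs => hasDerivAt_regDeriv hε hs) ?_ (fun s hs => abs_regDeriv_le hε hs)
    (fun s hs => mul_abs_regDerivTwo_le hε hs) (by simp [regPotential])
  unfold regDeriv
  exact (contDiff_const.mul ((hn.mul hd).mul (contDiff_const.add hd))).add
    (contDiff_const.mul (((hn.mul hd).pow 2).mul (contDiff_const.add (contDiff_const.mul hd))))

end Regularization

/-! ### The regularized energy inequality -/

section RegularizedEnergy

variable {w : Fin 3 → ℝ} {lam σ κ ε : ℝ} {T : EReal} {u : ℝ → R3 → ℂ} {t : ℝ} {f : R3 → ℂ}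

/-- The density `|f|²` as a function of the jet. -/
def dens (q : Jet) : ℝ := ‖q.2.1‖ ^ 2

/-- `Re (conj f ∂ⱼ f)` as a function of the jet. -/
def reCurrent (j : Fin 3) (q : Jet) : ℝ := ((starRingEnd ℂ) q.2.1 * q.2.2.2 j).re

/-- `Im (conj f ∂ⱼ f)` as a function of the jet. -/
def imCurrent (j : Fin 3) (q : Jet) : ℝ := ((starRingEnd ℂ) q.2.1 * q.2.2.2 j).im

@[fun_prop]
theorem continuous_dens : Continuous dens := by unfold dens; fun_prop

theorem continuous_conj_mul_component (j : Fin 3) :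
    Continuous fun q : Jet => (starRingEnd ℂ) q.2.1 * q.2.2.2 j :=
  (Complex.continuous_conj.comp (by fun_prop : Continuous fun q : Jet => q.2.1)).mul
    (by fun_prop)

@[fun_prop]
theorem continuous_reCurrent (j : Fin 3) : Continuous (reCurrent j) :=
  Complex.continuous_re.comp (continuous_conj_mul_component j)

@[fun_prop]
theorem continuous_imCurrent (j : Fin 3) : Continuous (imCurrent j) :=
  Complex.continuous_im.comp (continuous_conj_mul_component j)

@[fun_prop]
theorem continuous_confinement_fst (w : Fin 3 → ℝ) : Continuous fun q : Jet => confinement w q.1 :=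
  (continuous_confinement w).comp continuous_fst

theorem dens_nonneg (q : Jet) : 0 ≤ dens q := sq_nonneg _

theorem dens_cube (q : Jet) : dens q ^ 3 = ‖q.2.1‖ ^ 6 := by unfold dens; ring

theorem dens_le_jetWeight (q : Jet) : dens q ≤ jetWeight q := by
  have h := weight_sq_le_jetWeight q
  have : 0 ≤ ‖q.1‖ ^ 2 * ‖q.2.1‖ ^ 2 := by positivity
  unfold dens
  linarith

theorem dens_cube_le_jetWeight (q : Jet) : dens q ^ 3 ≤ jetWeight q := by
  rw [dens_cube]
  have n : 0 ≤ (1 + ‖q.1‖ ^ 2) * (‖q.2.1‖ ^ 2 + ‖q.2.2.1‖ ^ 2) + ‖q.2.2.2‖ ^ 2 + ‖q.2.2.1‖ ^ 6 := by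
    positivity
  unfold jetWeight
  linarith

theorem dens_sq_le_jetWeight (q : Jet) : dens q ^ 2 ≤ jetWeight q := by
  have h1 := dens_le_jetWeight q
  have h2 := dens_cube_le_jetWeight q
  have h3 := mul_nonneg (dens_nonneg q) (sq_nonneg (dens q - 1))
  linarith

theorem confinement_mul_dens_le (w : Fin 3 → ℝ) (q : Jet) :
    confinement w q.1 * dens q ≤ (∑ j, w j ^ 2) * jetWeight q := by
  have h1 := mul_le_mul_of_nonneg_right (confinement_le w q.1) (dens_nonneg q)
  have h2 := weight_sq_le_jetWeight q
  have h3 : ‖q.1‖ ^ 2 * dens q ≤ jetWeight q := by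
    unfold dens
    linarith [sq_nonneg ‖q.2.1‖]
  have h4 : 0 ≤ ∑ j, w j ^ 2 := by positivity
  have h5 := mul_le_mul_of_nonneg_left h3 h4
  linarith

theorem abs_imCurrent_le (j : Fin 3) (q : Jet) : |imCurrent j q| ≤ ‖q.2.1‖ * ‖q.2.2.2 j‖ := by
  refine (Complex.abs_im_le_norm _).trans (le_of_eq ?_)
  rw [norm_mul, RCLike.norm_conj]

theorem abs_coord_mul_imCurrent_le (j : Fin 3) (q : Jet) :
    |q.1 j * imCurrent j q| ≤ jetWeight q := by
  rw [abs_mul]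
  have h1 := abs_imCurrent_le j q
  have h2 : |q.1 j| ≤ ‖q.1‖ := PiLp.norm_apply_le q.1 j
  have h3 := weight_sq_le_jetWeight q
  have h4 := component_sq_le_jetWeight q j
  calc |q.1 j| * |imCurrent j q| ≤ ‖q.1‖ * (‖q.2.1‖ * ‖q.2.2.2 j‖) := by gcongr
    _ ≤ _ := by
      nlinarith [sq_nonneg (‖q.1‖ * ‖q.2.1‖ - ‖q.2.2.2 j‖), sq_nonneg ‖q.2.1‖]

/-- The squares of the two currents sum to |f|²|∂_j f|², so their product is at most half of that.
This factor 1/2 produces the threshold κ < σ/6. -/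
theorem abs_reCurrent_mul_imCurrent_le (j : Fin 3) (q : Jet) :
    |reCurrent j q * imCurrent j q| ≤ 1 / 2 * (dens q * ‖q.2.2.2 j‖ ^ 2) := by
  have h : reCurrent j q ^ 2 + imCurrent j q ^ 2 = dens q * ‖q.2.2.2 j‖ ^ 2 := by
    have h1 := Complex.normSq_eq_norm_sq ((starRingEnd ℂ) q.2.1 * q.2.2.2 j)
    rw [norm_mul, RCLike.norm_conj, mul_pow, Complex.normSq_apply] at h1
    unfold reCurrent imCurrent dens
    linarith
  rw [abs_le]
  constructor <;> nlinarith [sq_nonneg (reCurrent j q + imCurrent j q),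
    sq_nonneg (reCurrent j q - imCurrent j q)]

theorem dissipation_zero (q : Jet) (j : Fin 3) : dissipation lam σ 0 q.2.1 (q.2.2.2 j) =
    σ * (dens q ^ 2 * ‖q.2.2.2 j‖ ^ 2) + 2 * lam * (reCurrent j q * imCurrent j q) +
      9 * lam ^ 2 / (4 * σ) * ‖q.2.2.2 j‖ ^ 2 := by
  simp only [dissipation, reCurrent, imCurrent, dens, Complex.ofReal_zero, zero_mul, add_zero]
  ring

theorem flux_zero (C : ℝ) (q : Jet) (j : Fin 3) : flux w C 0 j q.1 q.2.1 (q.2.2.2 j) =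
    -(w j ^ 2 * (q.1 j * imCurrent j q)) + C * ‖q.2.2.2 j‖ ^ 2 := by
  have e : (q.2.1 * (starRingEnd ℂ) (q.2.2.2 j)).im = -imCurrent j q := by
    simp [imCurrent, Complex.mul_im]; ring
  rw [flux, e]
  ring

theorem continuous_damp_dens (hε : 0 < ε) : Continuous fun q : Jet => damp ε (dens q) :=
  continuous_damp hε continuous_dens dens_nonneg

theorem continuous_damp_confinement (hε : 0 < ε) :
    Continuous fun q : Jet => damp ε (confinement w q.1) :=
  continuous_damp hε (continuous_confinement_fst w) fun _ => confinement_nonneg w _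

/-- The damped dissipation in direction `j`. -/
def regDissipation (lam σ ε : ℝ) (j : Fin 3) (q : Jet) : ℝ :=
  damp ε (dens q) ^ 3 * dissipation lam σ 0 q.2.1 (q.2.2.2 j)

/-- The time derivative of the regularized potential energy. -/
def potentialRate (w : Fin 3 → ℝ) (σ ε : ℝ) (q : Jet) : ℝ :=
  (∑ j, damp ε (confinement w q.1) ^ 2 * (w j ^ 2 * q.1 j) * imCurrent j q) -
    2 * σ * (regConfinement w ε q.1 * dens q ^ 3)

/-- The time derivative of the regularized local energy. -/
def localRate (lam σ κ ε : ℝ) (q : Jet) : ℝ :=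
  (∑ j, 2 * regDerivTwo lam κ ε (dens q) * (reCurrent j q * imCurrent j q)) -
    2 * σ * (regDeriv lam κ ε (dens q) * dens q ^ 3)

/-- The regularized energy density. -/
def regEnergyDensity (w : Fin 3 → ℝ) (lam κ ε : ℝ) (q : Jet) : ℝ :=
  (∑ j, 1 / 2 * ‖q.2.2.2 j‖ ^ 2) + regConfinement w ε q.1 * dens q + regPotential lam κ ε (dens q)

/-- The error made by the regularization. -/
def regError (w : Fin 3 → ℝ) (lam σ ε : ℝ) (q : Jet) : ℝ :=
  ∑ j, (9 * lam ^ 2 / (4 * σ) * (1 - damp ε (dens q) ^ 3) * ‖q.2.2.2 j‖ ^ 2 -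
    (1 - damp ε (confinement w q.1) ^ 2) * (w j ^ 2 * (q.1 j * imCurrent j q)))

/-- The total regularized dissipation. -/
def totalDissipation (w : Fin 3 → ℝ) (σ κ ε : ℝ) (q : Jet) : ℝ :=
  (∑ j, (σ - 6 * κ) * (damp ε (dens q) ^ 3 * dens q ^ 2 * ‖q.2.2.2 j‖ ^ 2)) +
    2 * σ * (regConfinement w ε q.1 * dens q ^ 3) +
    σ * κ * ((dens q * damp ε (dens q)) ^ 2 * dens q ^ 3)

/-- The pointwise estimate behind the energy inequality. -/
theorem totalDissipation_le (hσ : 0 < σ) (hκ : 0 < κ) (hε : 0 < ε) (q : Jet) :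
    totalDissipation w σ κ ε q ≤
      (∑ j, regDissipation lam σ ε j q) -
      (∑ j, flux w (9 * lam ^ 2 / (4 * σ)) 0 j q.1 q.2.1 (q.2.2.2 j)) -
      potentialRate w σ ε q - localRate lam σ κ ε q + lam ^ 2 * σ / κ * dens q ^ 3 +
      regError w lam σ ε q := by
  have hs := dens_nonneg q
  have hd := damp_pos hε hs
  have hd1 := damp_le_one hε hs
  have hj : ∀ j, (σ - 6 * κ) * (damp ε (dens q) ^ 3 * dens q ^ 2 * ‖q.2.2.2 j‖ ^ 2) ≤
      regDissipation lam σ ε j q - flux w (9 * lam ^ 2 / (4 * σ)) 0 j q.1 q.2.1 (q.2.2.2 j) -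
      damp ε (confinement w q.1) ^ 2 * (w j ^ 2 * q.1 j) * imCurrent j q -
      2 * regDerivTwo lam κ ε (dens q) * (reCurrent j q * imCurrent j q) +
      (9 * lam ^ 2 / (4 * σ) * (1 - damp ε (dens q) ^ 3) * ‖q.2.2.2 j‖ ^ 2 -
        (1 - damp ε (confinement w q.1) ^ 2) * (w j ^ 2 * (q.1 j * imCurrent j q))) := fun j => by
    have h1 := (le_abs_self _).trans (abs_reCurrent_mul_imCurrent_le j q)
    rw [regDissipation, dissipation_zero, flux_zero, regDerivTwo]
    set d := damp ε (dens q)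
    set s := dens q
    -- The cross term of the sextic energy is absorbed at the price 6κ; after d⁴ ≤ d³ it has the
    -- same weight as the damped dissipation. The λ cross terms cancel exactly in the `linarith`
    -- that follows.
    have h2 : 12 * κ * (s * d ^ 4) * (reCurrent j q * imCurrent j q) ≤
        6 * κ * (d ^ 3 * s ^ 2 * ‖q.2.2.2 j‖ ^ 2) := by
      have a1 := mul_le_mul_of_nonneg_left h1 (by positivity : 0 ≤ 12 * κ * (s * d ^ 4))
      have a2 : d ^ 4 ≤ d ^ 3 := pow_le_pow_of_le_one hd.le hd1 (by norm_num)
      have a3 := mul_le_mul_of_nonneg_right a2 (by positivity : 0 ≤ 6 * κ * s ^ 2 * ‖q.2.2.2 j‖ ^ 2)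
      linarith
    linarith
  have hsum := Finset.sum_le_sum fun j (_ : j ∈ (Finset.univ : Finset (Fin 3))) => hj j
  simp only [Finset.sum_add_distrib, Finset.sum_sub_distrib] at hsum
  -- Multiplied by 2σ s³, the lower bound on the derivative gives the dissipation σκ(s d)² s³ and a
  -- loss (λ²σ/κ) s³, which the mass pays for.
  have hg := mul_le_mul_of_nonneg_right (regDeriv_ge (lam := lam) hε hκ hs)
    (by positivity : 0 ≤ 2 * σ * dens q ^ 3)
  have e1 : lam ^ 2 / (2 * κ) * (2 * σ * dens q ^ 3) = lam ^ 2 * σ / κ * dens q ^ 3 := by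
    field_simp
  simp only [totalDissipation, potentialRate, localRate, regError, Finset.sum_sub_distrib]
  rw [sub_mul, e1] at hg
  linarith

theorem totalDissipation_nonneg (hσ : 0 < σ) (hκ : 0 < κ) (hκσ : 6 * κ ≤ σ) (hε : 0 < ε) (q : Jet) :
    0 ≤ totalDissipation w σ κ ε q := by
  have hs := dens_nonneg q
  have hd := damp_pos hε hs
  have hV : 0 ≤ regConfinement w ε q.1 := mul_damp_nonneg hε (confinement_nonneg w _)
  have h0 : 0 ≤ σ - 6 * κ := by linarith
  unfold totalDissipation
  positivity

theorem regConfinement_nonneg (hε : 0 < ε) (x : R3) : 0 ≤ regConfinement w ε x :=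
  mul_damp_nonneg hε (confinement_nonneg w x)

theorem continuous_regConfinement_fst (hε : 0 < ε) :
    Continuous fun q : Jet => regConfinement w ε q.1 :=
  (continuous_confinement_fst w).mul (continuous_damp_confinement hε)

theorem jetAdmissible_component_sq (j : Fin 3) : JetAdmissible fun q : Jet => ‖q.2.2.2 j‖ ^ 2 :=
  .of_le (by fun_prop) 1 zero_le_one fun q => by
    rw [Real.norm_of_nonneg (by positivity), one_mul]; exact component_sq_le_jetWeight q j

theorem jetAdmissible_dens : JetAdmissible dens :=
  .of_le continuous_dens 1 zero_le_one fun q => by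
    rw [Real.norm_of_nonneg (dens_nonneg q), one_mul]; exact dens_le_jetWeight q

theorem jetAdmissible_dens_cube : JetAdmissible fun q => dens q ^ 3 :=
  .of_le (by fun_prop) 1 zero_le_one fun q => by
    rw [Real.norm_of_nonneg (pow_nonneg (dens_nonneg q) 3), one_mul]
    exact dens_cube_le_jetWeight q

/-- Multiplying an admissible function by a bounded continuous one. -/
theorem JetAdmissible.bdd_mul {Ψ b : Jet → ℝ} (h : JetAdmissible Ψ) (hb : Continuous b) {C : ℝ}
    (hC : ∀ q, |b q| ≤ C) : JetAdmissible fun q => b q * Ψ q := by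
  obtain ⟨K, k, hK, hk, hle⟩ := h.bound
  have hC0 : 0 ≤ C := (abs_nonneg _).trans (hC 0)
  refine ⟨hb.mul h.continuous, C * K, fun x => C * k x, by positivity, hk.const_mul _, fun q => ?_⟩
  rw [norm_mul, Real.norm_eq_abs]
  calc _ ≤ C * (K * jetWeight q + k q.1) :=
        mul_le_mul (hC q) (hle q) (norm_nonneg _) hC0
    _ = _ := by ring

theorem jetAdmissible_coord_mul_imCurrent (j : Fin 3) :
    JetAdmissible fun q : Jet => q.1 j * imCurrent j q :=
  .of_le (by fun_prop) 1 zero_le_one fun q => by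
    rw [one_mul]; exact abs_coord_mul_imCurrent_le j q

theorem abs_damp_pow_le_one (hε : 0 < ε) {s : ℝ} (hs : 0 ≤ s) (n : ℕ) : |damp ε s ^ n| ≤ 1 := by
  rw [abs_of_nonneg (pow_nonneg (damp_pos hε hs).le n)]
  exact pow_le_one₀ (damp_pos hε hs).le (damp_le_one hε hs)

theorem jetAdmissible_regConfinement_mul_dens_cube (hε : 0 < ε) :
    JetAdmissible fun q => regConfinement w ε q.1 * dens q ^ 3 :=
  jetAdmissible_dens_cube.bdd_mul (continuous_regConfinement_fst hε) (C := ε⁻¹) fun q => by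
    rw [abs_of_nonneg (regConfinement_nonneg hε _)]
    exact mul_damp_le hε (confinement_nonneg w _)

theorem jetAdmissible_regConfinement_mul_dens (hε : 0 < ε) :
    JetAdmissible fun q => regConfinement w ε q.1 * dens q :=
  jetAdmissible_dens.bdd_mul (continuous_regConfinement_fst hε) (C := ε⁻¹) fun q => by
    rw [abs_of_nonneg (regConfinement_nonneg hε _)]
    exact mul_damp_le hε (confinement_nonneg w _)

theorem damp_pow_mul_le (hε : 0 < ε) {s : ℝ} (hs : 0 ≤ s) (n m : ℕ) :
    damp ε s ^ (n + m) * s ^ n ≤ ε⁻¹ ^ n := by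
  have h1 := pow_le_pow_left₀ (mul_damp_nonneg hε hs) (mul_damp_le hε hs) n
  have h2 := pow_le_one₀ (n := m) (damp_pos hε hs).le (damp_le_one hε hs)
  calc damp ε s ^ (n + m) * s ^ n = (s * damp ε s) ^ n * damp ε s ^ m := by ring
    _ ≤ ε⁻¹ ^ n * 1 := mul_le_mul h1 h2 (pow_nonneg (damp_pos hε hs).le m) (by positivity)
    _ = _ := mul_one _

/-- The factor d³ turns the growth of the density into a constant depending on ε, leaving only |∂_j
f|², which is integrable. -/
theorem jetAdmissible_damp_mul_currents (hε : 0 < ε) (j : Fin 3) :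
    JetAdmissible fun q => damp ε (dens q) ^ 3 * (reCurrent j q * imCurrent j q) := by
  have hc := continuous_damp_dens hε
  refine .of_le (by fun_prop) ε⁻¹ (by positivity) fun q => ?_
  have hd := damp_pos hε (dens_nonneg q)
  rw [Real.norm_eq_abs, abs_mul, abs_of_nonneg (by positivity : 0 ≤ damp ε (dens q) ^ 3)]
  have h1 := abs_reCurrent_mul_imCurrent_le j q
  have h2 := damp_pow_mul_le hε (dens_nonneg q) 1 2
  have h3 := component_sq_le_jetWeight q j
  have h4 := dens_nonneg q
  calc _ ≤ damp ε (dens q) ^ 3 * (1 / 2 * (dens q * ‖q.2.2.2 j‖ ^ 2)) := by gcongr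
    _ = 1 / 2 * (damp ε (dens q) ^ (1 + 2) * dens q ^ 1) * ‖q.2.2.2 j‖ ^ 2 := by ring
    _ ≤ 1 * (ε⁻¹ ^ 1) * jetWeight q := by
        gcongr
        · norm_num
    _ = _ := by ring

theorem jetAdmissible_damp_mul_dens_sq (hε : 0 < ε) (j : Fin 3) :
    JetAdmissible fun q => damp ε (dens q) ^ 3 * dens q ^ 2 * ‖q.2.2.2 j‖ ^ 2 := by
  have hc := continuous_damp_dens hε
  refine (jetAdmissible_component_sq j).bdd_mul (by fun_prop) (C := ε⁻¹ ^ 2) fun q => ?_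
  have hd := damp_pos hε (dens_nonneg q)
  rw [abs_of_nonneg (by positivity)]
  exact damp_pow_mul_le hε (dens_nonneg q) 2 1

theorem jetAdmissible_regDissipation (hε : 0 < ε) (j : Fin 3) :
    JetAdmissible (regDissipation lam σ ε j) := by
  have hc := continuous_damp_dens hε
  have h1 := (jetAdmissible_damp_mul_dens_sq hε j).const_mul σ
  have h2 := (jetAdmissible_damp_mul_currents hε j).const_mul (2 * lam)
  have h3 := ((jetAdmissible_component_sq j).bdd_mul (hc.pow 3) (fun q =>
    abs_damp_pow_le_one hε (dens_nonneg q) 3)).const_mul (9 * lam ^ 2 / (4 * σ))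
  convert (h1.add h2).add h3 using 2 with q
  rw [regDissipation, dissipation_zero, Pi.pow_apply]
  ring

theorem jetAdmissible_potentialRate (hε : 0 < ε) : JetAdmissible (potentialRate w σ ε) := by
  have hc := continuous_damp_confinement (w := w) hε
  refine (JetAdmissible.sum _ fun j => ?_).sub
    ((jetAdmissible_regConfinement_mul_dens_cube hε).const_mul (2 * σ))
  convert ((jetAdmissible_coord_mul_imCurrent j).bdd_mul (hc.pow 2) (fun q =>
    abs_damp_pow_le_one hε (confinement_nonneg w q.1) 2)).const_mul (w j ^ 2) using 2 with q
  rw [Pi.pow_apply]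
  ring

theorem continuous_regDeriv_dens (hε : 0 < ε) : Continuous fun q => regDeriv lam κ ε (dens q) := by
  have hc := continuous_damp_dens hε
  unfold regDeriv
  fun_prop

theorem continuous_regDerivTwo_dens (hε : 0 < ε) :
    Continuous fun q => regDerivTwo lam κ ε (dens q) := by
  have hc := continuous_damp_dens hε
  unfold regDerivTwo
  fun_prop

theorem jetAdmissible_localRate (hε : 0 < ε) : JetAdmissible (localRate lam σ κ ε) := by
  have hc := continuous_regDerivTwo_dens (lam := lam) (κ := κ) hε
  refine (JetAdmissible.sum _ fun j => ?_).sub (((jetAdmissible_dens_cube).bdd_mul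
    (continuous_regDeriv_dens hε) fun q => abs_regDeriv_le hε (dens_nonneg q)).const_mul (2 * σ))
  refine .of_le (by fun_prop) (|lam| * ε⁻¹ + 6 * |κ| * ε⁻¹ ^ 2) (by positivity) fun q => ?_
  rw [Real.norm_eq_abs, abs_mul, abs_mul, abs_two]
  have h1 := abs_reCurrent_mul_imCurrent_le j q
  have h2 := mul_abs_regDerivTwo_le (lam := lam) (κ := κ) hε (dens_nonneg q)
  have h3 := component_sq_le_jetWeight q j
  calc _ ≤ 2 * |regDerivTwo lam κ ε (dens q)| * (1 / 2 * (dens q * ‖q.2.2.2 j‖ ^ 2)) := by gcongr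
    _ = dens q * |regDerivTwo lam κ ε (dens q)| * ‖q.2.2.2 j‖ ^ 2 := by ring
    _ ≤ _ := mul_le_mul h2 h3 (sq_nonneg _) (by positivity)

theorem continuous_regPotential_dens (hε : 0 < ε) :
    Continuous fun q => regPotential lam κ ε (dens q) := by
  have hc := continuous_damp_dens hε
  unfold regPotential
  fun_prop

theorem norm_regPotential_dens_le (hε : 0 < ε) (q : Jet) :
    ‖regPotential lam κ ε (dens q)‖ ≤ (|κ| + |lam|) * jetWeight q := by
  refine (abs_regPotential_le hε (dens_nonneg q)).trans ?_
  have h1 := mul_le_mul_of_nonneg_left (dens_cube_le_jetWeight q) (abs_nonneg κ)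
  have h2 := mul_le_mul_of_nonneg_left (dens_sq_le_jetWeight q) (abs_nonneg lam)
  linarith

theorem jetAdmissible_regPotential (hε : 0 < ε) :
    JetAdmissible fun q => regPotential lam κ ε (dens q) :=
  .of_le (continuous_regPotential_dens hε) (|κ| + |lam|) (by positivity)
    (norm_regPotential_dens_le hε)

theorem continuous_regError (hε : 0 < ε) : Continuous (regError w lam σ ε) := by
  have hc := continuous_damp_dens hε
  have hc' := continuous_damp_confinement (w := w) hε
  unfold regError
  fun_prop

/-- The constant does not depend on ε, because both damping factors lie between 0 and 1. Dominated
convergence then removes the error in the limit. -/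
theorem norm_regError_le (hσ : 0 < σ) (hε : 0 < ε) (q : Jet) : ‖regError w lam σ ε q‖ ≤
    (∑ j, (9 * lam ^ 2 / (4 * σ) + w j ^ 2)) * jetWeight q := by
  rw [Finset.sum_mul]
  refine norm_sum_le_of_le _ fun j _ => (norm_sub_le _ _).trans ?_
  have hd := damp_pos hε (dens_nonneg q)
  have hd' := damp_pos hε (confinement_nonneg w q.1)
  have h1 := (abs_le.1 (abs_damp_pow_le_one hε (dens_nonneg q) 3)).2
  have h2 := (abs_le.1 (abs_damp_pow_le_one hε (confinement_nonneg w q.1) 2)).2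
  have h3 : 0 ≤ damp ε (dens q) ^ 3 := by positivity
  have h4 : 0 ≤ damp ε (confinement w q.1) ^ 2 := by positivity
  rw [norm_mul, norm_mul, norm_mul, norm_mul, Real.norm_of_nonneg (sq_nonneg (w j)),
    Real.norm_of_nonneg (by linarith : 0 ≤ 1 - damp ε (dens q) ^ 3),
    Real.norm_of_nonneg (by linarith : 0 ≤ 1 - damp ε (confinement w q.1) ^ 2),
    Real.norm_of_nonneg (by positivity : 0 ≤ 9 * lam ^ 2 / (4 * σ)),
    Real.norm_of_nonneg (sq_nonneg ‖q.2.2.2 j‖), Real.norm_eq_abs, add_mul]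
  have h5 := component_sq_le_jetWeight q j
  have h6 := abs_coord_mul_imCurrent_le j q
  have h7 := jetWeight_nonneg q
  refine add_le_add ?_ ?_
  · calc _ ≤ 9 * lam ^ 2 / (4 * σ) * 1 * jetWeight q := by gcongr; linarith
      _ = _ := by ring
  · calc _ ≤ 1 * (w j ^ 2 * jetWeight q) := by gcongr; linarith
      _ = _ := by ring

theorem jetAdmissible_totalDissipation (hε : 0 < ε) : JetAdmissible (totalDissipation w σ κ ε) := by
  have hc := continuous_damp_dens hε
  refine ((JetAdmissible.sum _ fun j => (jetAdmissible_damp_mul_dens_sq hε j).const_mul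
    (σ - 6 * κ)).add ((jetAdmissible_regConfinement_mul_dens_cube hε).const_mul (2 * σ))).add
    ((jetAdmissible_dens_cube.bdd_mul (by fun_prop) (C := ε⁻¹ ^ 2) fun q => ?_).const_mul (σ * κ))
  rw [abs_of_nonneg (sq_nonneg _)]
  exact pow_le_pow_left₀ (mul_damp_nonneg hε (dens_nonneg q)) (mul_damp_le hε (dens_nonneg q)) 2

theorem integral_regEnergyDensity (hε : 0 < ε) (hf : MemSigma f) :
    ∫ x, regEnergyDensity w lam κ ε (jet 0 f x) =
      (∑ j, ∫ x, 1 / 2 * ‖weakGradient f x j‖ ^ 2) +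
      (∫ x, regConfinement w ε x * ‖f x‖ ^ 2) + ∫ x, regPotential lam κ ε (‖f x‖ ^ 2) := by
  have h1 := fun j => ((jetAdmissible_component_sq j).const_mul (1 / 2)).integrable hf 0
  have h2 := (jetAdmissible_regConfinement_mul_dens (w := w) hε).integrable hf 0
  have h3 := (jetAdmissible_regPotential (lam := lam) (κ := κ) hε).integrable hf 0
  have h4 := ((JetAdmissible.sum Finset.univ fun j =>
    (jetAdmissible_component_sq j).const_mul (1 / 2)).add
    (jetAdmissible_regConfinement_mul_dens (w := w) hε)).integrable hf 0
  have h5 := (JetAdmissible.sum Finset.univ fun j =>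
    (jetAdmissible_component_sq j).const_mul (1 / 2)).integrable hf 0
  unfold regEnergyDensity
  rw [integral_add h4 h3, integral_add h5 h2, integral_finsetSum _ fun j _ => h1 j]
  rfl

/-- The regularized energy inequality. -/
theorem IsSolution.regEnergy_le (hu : IsSolution w lam σ T u) (hσ : 0 < σ) (hκ : 0 < κ)
    (hε : 0 < ε) (ht : t ∈ timeInterval T) :
    (∫ x, regEnergyDensity w lam κ ε (jet 0 (u t) x)) +
        spaceTime u t (totalDissipation w σ κ ε) ≤
      (∫ x, regEnergyDensity w lam κ ε (jet 0 (u 0) x)) +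
      lam ^ 2 / (2 * κ) * ((∫ x, ‖u 0 x‖ ^ 2) - ∫ x, ‖u t x‖ ^ 2) +
      spaceTime u t (regError w lam σ ε) := by
  have hc := hu.continuousInSigma
  have hC : 0 ≤ 9 * lam ^ 2 / (4 * σ) := by positivity
  have h0 : MemSigma (u 0) := hu.memSigma (Icc_subset_timeInterval ht ⟨le_rfl, ht.1⟩)
  have hK := Finset.sum_le_sum fun j (_ : j ∈ (Finset.univ : Finset (Fin 3))) =>
    hu.spaceTime_le hσ ht j (jetAdmissible_regDissipation (lam := lam) (σ := σ) hε j) fun q => by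
      -- Nonnegativity was proved for nonzero steps only and passes to step 0 by continuity.
      -- Multiplying by d³ ≤ 1 then gives an admissible minorant of the dissipation.
      have h1 : 0 ≤ dissipation lam σ 0 q.2.1 (q.2.2.2 j) := by
        have h2 : Tendsto (fun h : ℝ => dissipation lam σ h q.2.1 (q.2.2.2 j)) (𝓝[≠] 0)
            (𝓝 (dissipation lam σ 0 q.2.1 (q.2.2.2 j))) :=
          (((continuous_dissipation (lam := lam) (σ := σ)).comp (by fun_prop :
            Continuous fun h : ℝ => (h, q.2.1, q.2.2.2 j))).tendsto 0).mono_left nhdsWithin_le_nhds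
        exact ge_of_tendsto h2 (eventually_mem_nhdsWithin.mono fun h hh =>
          dissipation_nonneg hσ hh _ _)
      exact mul_le_of_le_one_left h1 (abs_le.1 (abs_damp_pow_le_one hε (dens_nonneg q) 3)).2
  have hP := spaceTime_eq_sub (jetAdmissible_regConfinement_mul_dens (w := w) hε)
    (jetAdmissible_potentialRate (w := w) (σ := σ) hε) hc ht fun s hs hsT => by
      refine (hu.hasDerivAt_regConfinement hε hs hsT).congr_deriv ?_
      simp only [potentialRate, dens_cube]
      rfl
  have hL := spaceTime_eq_sub (jetAdmissible_regPotential (lam := lam) (κ := κ) hε)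
    (jetAdmissible_localRate (lam := lam) (κ := κ) (σ := σ) hε) hc ht fun s hs hsT => by
      refine (hu.hasDerivAt_regPotential hε hs hsT).congr_deriv ?_
      simp only [localRate, dens_cube]
      rfl
  have hM := spaceTime_eq_sub jetAdmissible_dens (jetAdmissible_dens_cube.const_mul (-(2 * σ))) hc
    ht fun s hs hsT => by
      simp only [dens_cube]
      exact hu.hasDerivAt_mass hs hsT
  have aD := fun j => jetAdmissible_regDissipation (lam := lam) (σ := σ) hε j
  have aF := fun j => jetAdmissible_flux w hC j
  have aP := jetAdmissible_potentialRate (w := w) (σ := σ) hε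
  have aL := jetAdmissible_localRate (lam := lam) (σ := σ) (κ := κ) hε
  have aM := jetAdmissible_dens_cube.const_mul (lam ^ 2 * σ / κ)
  have aE : JetAdmissible (regError w lam σ ε) := .of_le (continuous_regError hε) _
    (by positivity) (norm_regError_le hσ hε)
  have b1 := (JetAdmissible.sum Finset.univ aD).sub (JetAdmissible.sum Finset.univ aF)
  have b2 := b1.sub aP
  have b3 := b2.sub aL
  have b4 := b3.add aM
  have key := spaceTime_mono (jetAdmissible_totalDissipation hε) (b4.add aE) hc ht
    (totalDissipation_le hσ hκ hε)
  rw [spaceTime_add b4 aE hc ht, spaceTime_add b3 aM hc ht, spaceTime_sub b2 aL hc ht,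
    spaceTime_sub b1 aP hc ht, spaceTime_sub (JetAdmissible.sum Finset.univ aD)
    (JetAdmissible.sum Finset.univ aF) hc ht, spaceTime_sum _ aD hc ht, spaceTime_sum _ aF hc ht,
    hP, hL, spaceTime_const_mul] at key
  rw [spaceTime_const_mul] at hM
  -- By the mass balance the space-time integral of |u|⁶ is the lost mass divided by 2σ, which turns
  -- λ²σ/κ into λ²/(2κ).
  have hM' : lam ^ 2 * σ / κ * spaceTime u t (fun q => dens q ^ 3) =
      lam ^ 2 / (2 * κ) * ((∫ x, ‖u 0 x‖ ^ 2) - ∫ x, ‖u t x‖ ^ 2) := by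
    have e : (∫ x, dens (jet 0 (u t) x)) - (∫ x, dens (jet 0 (u 0) x)) =
      (∫ x, ‖u t x‖ ^ 2) - ∫ x, ‖u 0 x‖ ^ 2 := rfl
    rw [e] at hM
    rw [show (∫ x, ‖u 0 x‖ ^ 2) - (∫ x, ‖u t x‖ ^ 2) =
      2 * σ * spaceTime u t (fun q => dens q ^ 3) by linarith]
    field_simp
  rw [hM'] at key
  simp only [Finset.sum_add_distrib, Finset.sum_sub_distrib] at hK
  rw [integral_regEnergyDensity hε (hu.memSigma ht), integral_regEnergyDensity hε h0]
  simp only [jet, dens] at key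
  linarith

/-- The mass is nonincreasing. -/
theorem IsSolution.mass_le (hu : IsSolution w lam σ T u) (hσ : 0 < σ) (ht : t ∈ timeInterval T) :
    ∫ x, ‖u t x‖ ^ 2 ≤ ∫ x, ‖u 0 x‖ ^ 2 := by
  have hc := hu.continuousInSigma
  have hM := spaceTime_eq_sub jetAdmissible_dens (jetAdmissible_dens_cube.const_mul (-(2 * σ))) hc
    ht fun s hs hsT => by
      simp only [dens_cube]
      exact hu.hasDerivAt_mass hs hsT
  have h := spaceTime_mono (jetAdmissible_dens_cube.const_mul (-(2 * σ))) JetAdmissible.zero hc ht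
    fun q => by
      have := pow_nonneg (dens_nonneg q) 3
      nlinarith
  rw [hM] at h
  simp only [spaceTime, integral_zero, intervalIntegral.integral_zero] at h
  simp only [jet, dens] at h
  linarith

end RegularizedEnergy

/-! ### Removal of the regularization and space-time bounds -/

section EnergyBounds

variable {w : Fin 3 → ℝ} {lam σ κ : ℝ} {T : EReal} {u : ℝ → R3 → ℂ} {t : ℝ} {f : R3 → ℂ}

/-- The energy density as a function of the jet. -/
def energyJet (w : Fin 3 → ℝ) (lam κ : ℝ) (q : Jet) : ℝ :=
  (∑ j, 1 / 2 * ‖q.2.2.2 j‖ ^ 2) + confinement w q.1 * dens q +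
    dens q * (κ * dens q ^ 2 + lam / 2 * dens q)

theorem energyJet_jet (a : R3) (x : R3) :
    energyJet w lam κ (jet a f x) = energyDensity w lam κ f x := by
  simp only [energyJet, energyDensity, jet, dens, EuclideanSpace.norm_sq_eq, ← Finset.mul_sum]
  ring

theorem sum_component_sq_le (q : Jet) : |∑ j, 1 / 2 * ‖q.2.2.2 j‖ ^ 2| ≤ 3 / 2 * jetWeight q := by
  rw [abs_of_nonneg (by positivity)]
  have h := Finset.sum_le_sum fun j (_ : j ∈ (Finset.univ : Finset (Fin 3))) =>
    mul_le_mul_of_nonneg_left (component_sq_le_jetWeight q j) (by norm_num : (0 : ℝ) ≤ 1 / 2)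
  refine h.trans (le_of_eq ?_)
  simp
  ring

theorem norm_regEnergyDensity_le {ε : ℝ} (hε : 0 < ε) (q : Jet) :
    ‖regEnergyDensity w lam κ ε q‖ ≤
      (3 / 2 + (∑ j, w j ^ 2) + (|κ| + |lam|)) * jetWeight q := by
  have h1 := sum_component_sq_le q
  have h2 := norm_regPotential_dens_le (lam := lam) (κ := κ) hε q
  have h3 : |regConfinement w ε q.1 * dens q| ≤ (∑ j, w j ^ 2) * jetWeight q := by
    rw [abs_of_nonneg (mul_nonneg (regConfinement_nonneg hε _) (dens_nonneg q))]
    refine le_trans (mul_le_mul_of_nonneg_right ?_ (dens_nonneg q)) (confinement_mul_dens_le w q)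
    exact mul_le_of_le_one_right (confinement_nonneg w _) (damp_le_one hε (confinement_nonneg w _))
  refine (norm_add_le _ _).trans ?_
  have h4 := norm_add_le (∑ j, 1 / 2 * ‖q.2.2.2 j‖ ^ 2) (regConfinement w ε q.1 * dens q)
  simp only [Real.norm_eq_abs] at *
  linarith

theorem continuous_regEnergyDensity {ε : ℝ} (hε : 0 < ε) :
    Continuous (regEnergyDensity w lam κ ε) := by
  have h1 := continuous_regPotential_dens (lam := lam) (κ := κ) hε
  have h2 := continuous_regConfinement_fst (w := w) hε
  unfold regEnergyDensity
  fun_prop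

theorem integrable_energyDensity (hf : MemSigma f) : Integrable (energyDensity w lam κ f) := by
  have h : JetAdmissible (energyJet w lam κ) := by
    refine .of_le (by unfold energyJet; fun_prop)
      (3 / 2 + (∑ j, w j ^ 2) + (|κ| + |lam|)) (by positivity) fun q => ?_
    have h1 := sum_component_sq_le q
    have h2 : |confinement w q.1 * dens q| ≤ (∑ j, w j ^ 2) * jetWeight q := by
      rw [abs_of_nonneg (mul_nonneg (confinement_nonneg w _) (dens_nonneg q))]
      exact confinement_mul_dens_le w q
    have h3 : |dens q * (κ * dens q ^ 2 + lam / 2 * dens q)| ≤ (|κ| + |lam|) * jetWeight q := by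
      rw [show dens q * (κ * dens q ^ 2 + lam / 2 * dens q) =
        κ * dens q ^ 3 + lam / 2 * dens q ^ 2 by ring]
      refine (abs_add_le _ _).trans ?_
      rw [abs_mul, abs_mul, abs_div, abs_two, abs_of_nonneg (pow_nonneg (dens_nonneg q) 3),
        abs_of_nonneg (pow_nonneg (dens_nonneg q) 2)]
      have a1 := mul_le_mul_of_nonneg_left (dens_cube_le_jetWeight q) (abs_nonneg κ)
      have a2 := mul_le_mul_of_nonneg_left (dens_sq_le_jetWeight q) (abs_nonneg lam)
      have a3 := mul_nonneg (abs_nonneg lam) (pow_nonneg (dens_nonneg q) 2)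
      linarith
    refine (norm_add_le _ _).trans ?_
    have h4 := norm_add_le (∑ j, 1 / 2 * ‖q.2.2.2 j‖ ^ 2) (confinement w q.1 * dens q)
    simp only [Real.norm_eq_abs] at *
    linarith
  refine (h.integrable hf 0).congr (ae_of_all _ fun x => energyJet_jet 0 x)

theorem tendsto_mul_damp {ε : ℕ → ℝ} (hε : Tendsto ε atTop (𝓝 0)) (s : ℝ) :
    Tendsto (fun n => s * damp (ε n) s) atTop (𝓝 s) := by
  simpa using (tendsto_damp hε s).const_mul s

theorem tendsto_integral_regEnergyDensity {ε : ℕ → ℝ} (hε : Tendsto ε atTop (𝓝 0))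
    (hpos : ∀ n, 0 < ε n) (hf : MemSigma f) :
    Tendsto (fun n => ∫ x, regEnergyDensity w lam κ (ε n) (jet 0 f x)) atTop
      (𝓝 (energy w lam κ f)) := by
  have h := tendsto_integral_jet (Θ' := energyJet w lam κ)
    (fun n => continuous_regEnergyDensity (w := w) (lam := lam) (κ := κ) (hpos n))
    (fun n => norm_regEnergyDensity_le (hpos n)) (fun q => ?_) hf
  · simpa only [energyJet_jet, energy] using h
  · have h1 := tendsto_mul_damp hε (confinement w q.1)
    have h2 := tendsto_mul_damp hε (dens q)
    exact (tendsto_const_nhds.add (h1.mul_const _)).add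
      ((((h2.pow 2).const_mul κ).add (h2.const_mul (lam / 2))).const_mul (dens q))

theorem tendsto_spaceTime_regError {ε : ℕ → ℝ} (hε : Tendsto ε atTop (𝓝 0))
    (hpos : ∀ n, 0 < ε n) (hσ : 0 < σ) (hu : ContinuousInSigma T u) (ht : t ∈ timeInterval T) :
    Tendsto (fun n => spaceTime u t (regError w lam σ (ε n))) atTop (𝓝 0) := by
  have h := tendsto_spaceTime (Θ' := fun _ => 0) (by positivity)
    (fun n => continuous_regError (w := w) (lam := lam) (σ := σ) (hpos n))
    (fun n => norm_regError_le hσ (hpos n)) (fun q => ?_) hu ht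
  · simpa [spaceTime] using h
  · have h1 := tendsto_damp hε (dens q)
    have h2 := tendsto_damp hε (confinement w q.1)
    have h3 : ∀ j : Fin 3, Tendsto (fun n => 9 * lam ^ 2 / (4 * σ) * (1 - damp (ε n) (dens q) ^ 3) *
        ‖q.2.2.2 j‖ ^ 2 - (1 - damp (ε n) (confinement w q.1) ^ 2) *
        (w j ^ 2 * (q.1 j * imCurrent j q))) atTop (𝓝 0) := fun j => by
      have := ((((h1.pow 3).const_sub 1).const_mul (9 * lam ^ 2 / (4 * σ))).mul_const
        (‖q.2.2.2 j‖ ^ 2)).sub (((h2.pow 2).const_sub 1).mul_const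
        (w j ^ 2 * (q.1 j * imCurrent j q)))
      simpa using this
    have := tendsto_finsetSum Finset.univ fun j _ => h3 j
    simpa [regError] using this

/-- The total dissipation as a function of the jet. -/
def dissipationJet (w : Fin 3 → ℝ) (σ κ : ℝ) (q : Jet) : ℝ :=
  (∑ j, (σ - 6 * κ) * (dens q ^ 2 * ‖q.2.2.2 j‖ ^ 2)) +
    2 * σ * (confinement w q.1 * dens q ^ 3) + σ * κ * (dens q ^ 2 * dens q ^ 3)

theorem dissipationJet_jet (a : R3) (x : R3) : dissipationJet w σ κ (jet a f x) =
    (σ - 6 * κ) * (‖f x‖ ^ 4 * ‖weakGradient f x‖ ^ 2) +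
      2 * σ * (confinement w x * ‖f x‖ ^ 6) + σ * κ * ‖f x‖ ^ 10 := by
  simp only [dissipationJet, jet, dens, EuclideanSpace.norm_sq_eq, ← Finset.mul_sum]
  ring

theorem l2norm_sq (hf : MemSigma f) : l2norm f ^ 2 = ∫ x, ‖f x‖ ^ 2 :=
  (integral_sq_eq_toReal hf.memLp).symm

/-- Kinetic and confinement parts are nonnegative, so the bound on `regPotential` is all that is
needed. It allows the energy at time t to be dropped when the dissipation is estimated. -/
theorem neg_le_integral_regEnergyDensity {ε : ℝ} (hκ : 0 < κ) (hε : 0 < ε) (hf : MemSigma f) :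
    -(lam ^ 2 / (16 * κ)) * ∫ x, ‖f x‖ ^ 2 ≤ ∫ x, regEnergyDensity w lam κ ε (jet 0 f x) := by
  rw [← integral_const_mul]
  refine integral_mono (hf.integrable_sq.const_mul _) ((JetAdmissible.of_le
    (continuous_regEnergyDensity hε) _ (by positivity) (norm_regEnergyDensity_le hε)).integrable
    hf 0) fun x => ?_
  have h1 := regPotential_ge (lam := lam) (ε := ε) hκ (dens_nonneg (jet 0 f x))
  have h2 := mul_nonneg (regConfinement_nonneg (w := w) hε (jet 0 f x).1) (dens_nonneg (jet 0 f x))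
  have h3 : 0 ≤ ∑ j, 1 / 2 * ‖(jet 0 f x).2.2.2 j‖ ^ 2 := by positivity
  simp only [regEnergyDensity]
  have e : dens (jet 0 f x) = ‖f x‖ ^ 2 := rfl
  rw [← e]
  linarith

/-- The energy inequality and the bound on the total dissipation. -/
theorem IsSolution.energy_bounds (hu : IsSolution w lam σ T u) (hκ : 0 < κ) (hκσ : κ < σ / 6)
    (ht : t ∈ timeInterval T) :
    energy w lam κ (u t) ≤ energy w lam κ (u 0) + lam ^ 2 / (2 * κ) * l2norm (u 0) ^ 2 ∧
    ∫⁻ s in Set.Ioo 0 t, ∫⁻ x, ENNReal.ofReal (dissipationJet w σ κ (jet 0 (u s) x)) ≤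
      ENNReal.ofReal (energy w lam κ (u 0) + lam ^ 2 / κ * l2norm (u 0) ^ 2) := by
  have hσ : 0 < σ := by linarith
  have h0 : MemSigma (u 0) := hu.memSigma (Icc_subset_timeInterval ht ⟨le_rfl, ht.1⟩)
  have hmt : MemSigma (u t) := hu.memSigma ht
  set ε : ℕ → ℝ := fun n => 1 / ((n : ℝ) + 1)
  have hpos : ∀ n, 0 < ε n := fun n => by positivity
  have hε : Tendsto ε atTop (𝓝 0) := tendsto_one_div_add_atTop_nhds_zero_nat
  have hreg := fun n => hu.regEnergy_le (κ := κ) hσ hκ (hpos n) ht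
  have hE := tendsto_integral_regEnergyDensity (w := w) (lam := lam) (κ := κ) hε hpos hmt
  have hE0 := tendsto_integral_regEnergyDensity (w := w) (lam := lam) (κ := κ) hε hpos h0
  have hErr := tendsto_spaceTime_regError (w := w) (lam := lam) hε hpos hσ hu.continuousInSigma ht
  have hm := hu.mass_le hσ ht
  have hm0 : 0 ≤ ∫ x, ‖u t x‖ ^ 2 := integral_nonneg fun x => sq_nonneg _
  have hc : 0 ≤ lam ^ 2 / κ := by positivity
  have e1 : lam ^ 2 / (2 * κ) = lam ^ 2 / κ / 2 := by field_simp
  have e2 : lam ^ 2 / (16 * κ) = lam ^ 2 / κ / 16 := by field_simp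
  rw [l2norm_sq h0]
  have hlim : ∀ a : ℝ, Tendsto (fun n => (∫ x, regEnergyDensity w lam κ (ε n) (jet 0 (u 0) x)) +
      a + spaceTime u t (regError w lam σ (ε n))) atTop (𝓝 (energy w lam κ (u 0) + a)) :=
    fun a => by simpa using (hE0.add_const a).add hErr
  refine ⟨le_of_tendsto_of_tendsto' hE (hlim _) fun n => ?_, ?_⟩
  · have h1 : 0 ≤ spaceTime u t (totalDissipation w σ κ (ε n)) := by
      have := spaceTime_mono JetAdmissible.zero (jetAdmissible_totalDissipation (hpos n))
        hu.continuousInSigma ht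
        (totalDissipation_nonneg (w := w) hσ hκ (by linarith) (hpos n))
      simpa [spaceTime] using this
    have h2 := hreg n
    rw [e1] at h2 ⊢
    nlinarith [mul_nonneg hc hm0]
  · refine lintegral_jet_le (fun n => jetAdmissible_totalDissipation (hpos n))
      (fun n => totalDissipation_nonneg (w := w) hσ hκ (by linarith) (hpos n)) (fun q => ?_)
      hu.continuousInSigma ht (L := fun n => (∫ x, regEnergyDensity w lam κ (ε n) (jet 0 (u 0) x)) +
        lam ^ 2 / κ * (∫ x, ‖u 0 x‖ ^ 2) + spaceTime u t (regError w lam σ (ε n)))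
      (fun n => ?_) (hlim _)
    · have h1 := tendsto_damp hε (dens q)
      have h2 := tendsto_mul_damp hε (dens q)
      have h3 := tendsto_mul_damp hε (confinement w q.1)
      refine ((tendsto_finsetSum Finset.univ fun j _ => ?_).add
        ((h3.mul_const (dens q ^ 3)).const_mul (2 * σ))).add
        (((h2.pow 2).mul_const (dens q ^ 3)).const_mul (σ * κ))
      have := (((h1.pow 3).mul_const (dens q ^ 2)).mul_const (‖q.2.2.2 j‖ ^ 2)).const_mul (σ - 6 * κ)
      simpa using this
    -- The lower bound on the energy costs (λ²/(16κ)) M(t), with M(t) the mass at time t, and the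
    -- lost mass contributes (λ²/(2κ))(M(0) - M(t)); both fit generously into (λ²/κ) M(0).
    · have h1 := neg_le_integral_regEnergyDensity (w := w) (lam := lam) hκ (hpos n) hmt
      have h2 := hreg n
      rw [e1] at h2
      rw [e2] at h1
      have h3 := mul_le_mul_of_nonneg_left hm hc
      have h4 := mul_nonneg hc hm0
      nlinarith

/-- Up to the null set {0} the time interval is the increasing union of (0, q) over rational times q
< T. Restricting to rationals makes the union countable, and finite and infinite T are treated
alike. -/
theorem setLIntegral_timeInterval_le {F : ℝ → ENNReal} {B : ENNReal}
    (h : ∀ t ∈ timeInterval T, ∫⁻ s in Set.Ioo 0 t, F s ≤ B) :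
    ∫⁻ s in timeInterval T, F s ≤ B := by
  set I := {q : ℚ // (q : ℝ) ∈ timeInterval T}
  set S : I → Set ℝ := fun q => Set.Ioo 0 (q.1 : ℝ)
  have hdir : Directed (· ⊆ ·) S := by
    intro p q
    rcases le_total p.1 q.1 with hpq | hpq
    · exact ⟨q, Set.Ioo_subset_Ioo_right (by exact_mod_cast hpq), subset_rfl⟩
    · exact ⟨p, subset_rfl, Set.Ioo_subset_Ioo_right (by exact_mod_cast hpq)⟩
  have hsub : timeInterval T ⊆ {0} ∪ ⋃ q, S q := fun s hs => by
    rcases hs.1.eq_or_lt with h0 | h0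
    · exact Or.inl h0.symm
    · obtain ⟨q, hq1, hq2⟩ := EReal.lt_iff_exists_rat_btwn.1 hs.2
      have hq : s < q := by exact_mod_cast hq1
      exact Or.inr (Set.mem_iUnion.2 ⟨⟨q, h0.le.trans hq.le, hq2⟩, h0, hq⟩)
  calc ∫⁻ s in timeInterval T, F s ≤ ∫⁻ s in {0} ∪ ⋃ q, S q, F s :=
        lintegral_mono_set hsub
    _ ≤ (∫⁻ s in {0}, F s) + ∫⁻ s in ⋃ q, S q, F s := lintegral_union_le _ _ _
    _ = ⨆ q, ∫⁻ s in S q, F s := by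
        rw [setLIntegral_measure_zero _ _ (by simp), zero_add,
          setLIntegral_iUnion_of_directed _ hdir]
    _ ≤ B := iSup_le fun q => h q.1 q.2

theorem lintegral_le_of_mul_le {c L : ℝ} (hc : 0 < c) {J : ℝ → R3 → ℝ}
    (hJ : ∀ s x, c * J s x ≤ dissipationJet w σ κ (jet 0 (u s) x))
    (h : ∀ t ∈ timeInterval T, ∫⁻ s in Set.Ioo 0 t, ∫⁻ x,
      ENNReal.ofReal (dissipationJet w σ κ (jet 0 (u s) x)) ≤ ENNReal.ofReal L) :
    -- The maximum with 0 and the added 1 make the bound a strictly positive real, as required of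
    -- the constants of the theorem.
    ∫⁻ s in timeInterval T, ∫⁻ x, ENNReal.ofReal (J s x) ≤
      ENNReal.ofReal (max L 0 / c + 1) := by
  refine setLIntegral_timeInterval_le fun t ht => ?_
  have h1 : ∀ s x, ENNReal.ofReal (J s x) ≤
      ENNReal.ofReal c⁻¹ * ENNReal.ofReal (dissipationJet w σ κ (jet 0 (u s) x)) := fun s x => by
    rw [← ENNReal.ofReal_mul (by positivity)]
    refine ENNReal.ofReal_le_ofReal ?_
    rw [inv_mul_eq_div, le_div_iff₀' hc]
    exact hJ s x
  calc _ ≤ ∫⁻ s in Set.Ioo 0 t, ∫⁻ x, ENNReal.ofReal c⁻¹ *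
          ENNReal.ofReal (dissipationJet w σ κ (jet 0 (u s) x)) :=
        lintegral_mono fun s => lintegral_mono fun x => h1 s x
    _ = ENNReal.ofReal c⁻¹ * ∫⁻ s in Set.Ioo 0 t, ∫⁻ x,
          ENNReal.ofReal (dissipationJet w σ κ (jet 0 (u s) x)) := by
        simp only [lintegral_const_mul' _ _ ENNReal.ofReal_ne_top]
    _ ≤ ENNReal.ofReal c⁻¹ * ENNReal.ofReal L := by gcongr; exact h t ht
    _ = ENNReal.ofReal (c⁻¹ * L) := (ENNReal.ofReal_mul (by positivity)).symm
    _ ≤ _ := by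
        refine ENNReal.ofReal_le_ofReal ?_
        have := mul_le_mul_of_nonneg_left (le_max_left L 0) (by positivity : 0 ≤ c⁻¹)
        rw [div_eq_inv_mul]
        linarith

end EnergyBounds

end DampedNLS

end

/-! ### Assembly of the constants -/

theorem mainTheorem2 (κ σ Λ : ℝ) (hκ : 0 < κ) (hκσ : κ < σ / 6) :
    ∃ (C₁ : ℝ → ℝ) (C₂ : ℝ → ℝ → ℝ),
      (∀ m, 0 < C₁ m) ∧ (∀ e m, 0 < C₂ e m) ∧
      ∀ (lam : ℝ), |lam| = Λ → ∀ (w : Fin 3 → ℝ) (T : EReal), 0 < T →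
      ∀ u : ℝ → DampedNLS.R3 → ℂ, DampedNLS.IsSolution w lam σ T u →
        (∀ t ∈ DampedNLS.timeInterval T,
          MeasureTheory.Integrable (DampedNLS.energyDensity w lam κ (u t)) ∧
          DampedNLS.energy w lam κ (u t)
            ≤ DampedNLS.energy w lam κ (u 0) + C₁ (DampedNLS.l2norm (u 0))) ∧
        (∫⁻ t in DampedNLS.timeInterval T, ∫⁻ x,
            ‖u t x‖ₑ ^ 4 * ‖DampedNLS.weakGradient (u t) x‖ₑ ^ 2
          ≤ ENNReal.ofReal (C₂ (DampedNLS.energy w lam κ (u 0)) (DampedNLS.l2norm (u 0)))) ∧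
        (∫⁻ t in DampedNLS.timeInterval T, ∫⁻ x,
            ENNReal.ofReal (DampedNLS.confinement w x) * ‖u t x‖ₑ ^ 6
          ≤ ENNReal.ofReal (C₂ (DampedNLS.energy w lam κ (u 0)) (DampedNLS.l2norm (u 0)))) ∧
        (∫⁻ t in DampedNLS.timeInterval T, ∫⁻ x, ‖u t x‖ₑ ^ 10
          ≤ ENNReal.ofReal (C₂ (DampedNLS.energy w lam κ (u 0)) (DampedNLS.l2norm (u 0)))) := by
  have hσ : 0 < σ := by linarith
  -- The smallest of the three coefficients in `dissipationJet`; all three densities are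
  -- nonnegative, so c times each one is bounded by the total dissipation.
  set c : ℝ := min (σ - 6 * κ) (min (2 * σ) (σ * κ)) with hcd
  have hc : 0 < c := lt_min (by linarith) (lt_min (by positivity) (by positivity))
  have hc1 : c ≤ σ - 6 * κ := min_le_left _ _
  have hc2 : c ≤ 2 * σ := (min_le_right _ _).trans (min_le_left _ _)
  have hc3 : c ≤ σ * κ := (min_le_right _ _).trans (min_le_right _ _)
  -- λ enters the estimates only through λ² = Λ², so the constants depend on Λ alone. The summands 1
  -- serve strict positivity.
  refine ⟨fun m => Λ ^ 2 / (2 * κ) * m ^ 2 + 1, fun e m => max (e + Λ ^ 2 / κ * m ^ 2) 0 / c + 1,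
    fun m => by positivity, fun e m => by positivity, fun lam hlam w T _ u hu => ?_⟩
  have hsq : lam ^ 2 = Λ ^ 2 := by rw [← hlam, sq_abs]
  have hE := fun t (ht : t ∈ DampedNLS.timeInterval T) => hu.energy_bounds hκ hκσ ht
  simp only [hsq] at hE
  have hnn : ∀ s x, 0 ≤ (σ - 6 * κ) * (‖u s x‖ ^ 4 * ‖DampedNLS.weakGradient (u s) x‖ ^ 2) ∧
      0 ≤ 2 * σ * (DampedNLS.confinement w x * ‖u s x‖ ^ 6) ∧ 0 ≤ σ * κ * ‖u s x‖ ^ 10 :=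
    fun s x => by
      have h1 : 0 ≤ σ - 6 * κ := by linarith
      have h2 := DampedNLS.confinement_nonneg w x
      exact ⟨by positivity, by positivity, by positivity⟩
  refine ⟨fun t ht => ⟨DampedNLS.integrable_energyDensity (hu.memSigma ht),
    (hE t ht).1.trans (by linarith)⟩, ?_, ?_, ?_⟩
  · convert DampedNLS.lintegral_le_of_mul_le hc
      (J := fun s x => ‖u s x‖ ^ 4 * ‖DampedNLS.weakGradient (u s) x‖ ^ 2)
      (fun s x => ?_) fun t ht => (hE t ht).2 using 5 with s x
    · rw [ENNReal.ofReal_mul (by positivity), ENNReal.ofReal_pow (norm_nonneg _),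
        ENNReal.ofReal_pow (norm_nonneg _), ofReal_norm, ofReal_norm]
    · rw [DampedNLS.dissipationJet_jet]
      have h1 := mul_le_mul_of_nonneg_right hc1
        (by positivity : 0 ≤ ‖u s x‖ ^ 4 * ‖DampedNLS.weakGradient (u s) x‖ ^ 2)
      linarith [(hnn s x).2.1, (hnn s x).2.2]
  · convert DampedNLS.lintegral_le_of_mul_le hc
      (J := fun s x => DampedNLS.confinement w x * ‖u s x‖ ^ 6)
      (fun s x => ?_) fun t ht => (hE t ht).2 using 5 with s x
    · rw [ENNReal.ofReal_mul (DampedNLS.confinement_nonneg w x),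
        ENNReal.ofReal_pow (norm_nonneg _), ofReal_norm]
    · rw [DampedNLS.dissipationJet_jet]
      have h1 := mul_le_mul_of_nonneg_right hc2
        (mul_nonneg (DampedNLS.confinement_nonneg w x) (pow_nonneg (norm_nonneg (u s x)) 6))
      linarith [(hnn s x).1, (hnn s x).2.2]
  · convert DampedNLS.lintegral_le_of_mul_le hc (J := fun s x => ‖u s x‖ ^ 10)
      (fun s x => ?_) fun t ht => (hE t ht).2 using 5 with s x
    · rw [ENNReal.ofReal_pow (norm_nonneg _), ofReal_norm]
    · rw [DampedNLS.dissipationJet_jet]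
      have h1 := mul_le_mul_of_nonneg_right hc3 (pow_nonneg (norm_nonneg (u s x)) 10)
      linarith [(hnn s x).1, (hnn s x).2.1]
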